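/- Let $B$ be a unital algebra over $\mathbb{C}$ and let $(\mathcal{A},E,\varepsilon)$ be a $B$-$B$-non-commutative probability space: $\mathcal{A}$ is a unital $\mathbb{C}$-algebra, $\varepsilon: B\otimes B^{\mathrm{op}}\to\mathcal{A}$ is a unital homomorphism which is injective on $B\otimes 1$ and on $1\otimes B^{\mathrm{op}}$, and, with $L_b=\varepsilon(b\otimes 1)$ and $R_b=\varepsilon(1\otimes b)$, $E:\mathcal{A}\to B$ is a linear map with $E(L_{b_1}R_{b_2}T)=b_1E(T)b_2$ and $E(TL_b)=E(TR_b)$. Let $\mathcal{A}_\ell$ be the algebra of elements commuting with all $R_b$ and $\mathcal{A}_r$ the algebra of elements commuting with all $L_b$. For $\chi:\{1,\dots,n\}\to\{\ell,r\}$ let $\prec_\chi$ be the total order listing first $\chi^{-1}(\ell)$ increasingly and then $\chi^{-1}(r)$ decreasingly; $BNC(\chi)$ is the set of partitions of $\{1,\dots,n\}$ that are non-crossing for $\prec_\chi$, ordered by refinement, with largest element $1_\chi$. Let $\zeta_{BNC}(\sigma,\pi)=1$ for $\sigma\le\pi$ and $0$ otherwise, and let $\mu_{BNC}$ be its inverse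 in the incidence algebra. For $\Phi:\bigcup_{n\ge1}\bigcup_{\chi}BNC(\chi)\times\mathcal{A}_{\chi(1)}\times\cdots\times\mathcal{A}_{\chi(n)}\to B$ and $f$ in the incidence algebra put $$(\Phi* f)_\pi(T_1,\dots,T_n)=\sum_{\sigma\le\pi}\Phi_\sigma(T_1,\dots,T_n)f(\sigma,\pi).$$ $\Phi$ is *bi-multiplicative* if it is linear in each $T_k$ and the following hold for all $\chi$, $T_k\in\mathcal{A}_{\chi(k)}$, $b\in B$ and $\pi\in BNC(\chi)$. Write $C^\ell_b=L_b$ and $C^r_b=R_b$. (i) If $q=\max\{k:\chi(k)\ne\chi(n)\}$ exists, then replacing $T_n$ by $T_nC_b^{\chi(n)}$ and replacing $T_q$ by $T_qC_b^{\chi(q)}$ in $\Phi_{1_\chi}(T_1,\dots,T_n)$ give the same value; if it does not exist, $\Phi_{1_\chi}(T_1,\dots,T_nC_b^{\chi(n)})$ equals $\Phi_{1_\chi}(T_1,\dots,T_n)b$ if $\chi(n)=\ell$ and $b\,\Phi_{1_\chi}(T_1,\dots,T_n)$ if $\chi(n)=r$. (ii) For each $p$, if $q=\max\{k<p:\chi(k)=\chi(p)\}$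 exists, then replacing $T_p$ by $C_b^{\chi(p)}T_p$ and replacing $T_q$ by $T_qC_b^{\chi(q)}$ in $\Phi_{1_\chi}(T_1,\dots,T_n)$ give the same value; if it does not exist, $\Phi_{1_\chi}(T_1,\dots,C_b^{\chi(p)}T_p,\dots,T_n)$ equals $b\,\Phi_{1_\chi}(T_1,\dots,T_n)$ if $\chi(p)=\ell$ and $\Phi_{1_\chi}(T_1,\dots,T_n)b$ if $\chi(p)=r$. (iii) If $V_1,\dots,V_m$ are nonempty $\prec_\chi$-intervals, in $\prec_\chi$-increasing order, which partition $\{1,\dots,n\}$ and are unions of blocks of $\pi$, then $\Phi_\pi(T_1,\dots,T_n)=\Phi_{\pi|_{V_1}}((T_1,\dots,T_n)|_{V_1})\cdots\Phi_{\pi|_{V_m}}((T_1,\dots,T_n)|_{V_m})$. (iv) Let $V$ be a nonempty $\prec_\chi$-interval which is a union of blocks of $\pi$ and whose complement $W$ contains the $\prec_\chi$-first and $\prec_\chi$-last elements of $\{1,\dots,n\}$. Let $\theta$ be the last element of $W$ before $V$ and $\gamma$ the first element of $W$ after $V$ (for $\prec_\chi$), and $c=\Phi_{\pi|_V}((T_1,\dots,T_n)|_V)$.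 Then $\Phi_\pi(T_1,\dots,T_n)$ equals $\Phi_{\pi|_W}$ of the tuple $(T_1,\dots,T_n)|_W$ in which $T_\theta$ is replaced by $T_\theta L_c$ if $\chi(\theta)=\ell$ and by $R_cT_\theta$ if $\chi(\theta)=r$; it also equals $\Phi_{\pi|_W}$ of the tuple $(T_1,\dots,T_n)|_W$ in which $T_\gamma$ is replaced by $L_cT_\gamma$ if $\chi(\gamma)=\ell$ and by $T_\gamma R_c$ if $\chi(\gamma)=r$. For $1\le q<n$ let $\chi|_{\setminus q}$ be the restriction of $\chi$ to $\{1,\dots,n\}\setminus\{q\}$. A bi-multiplicative $\Phi$ is a *bi-moment function* if, whenever $\chi(q)=\chi(q+1)$ and $T_k\in\mathcal{A}_{\chi(k)}$, $$\Phi_{1_\chi}(T_1,\dots,T_n)=\Phi_{1_{\chi|_{\setminus q}}}(T_1,\dots,T_{q-1},T_qT_{q+1},T_{q+2},\dots,T_n),$$ and a *bi-cumulant function* if, whenever $\chi(q)=\chi(q+1)$ and $T_k\in\mathcal{A}_{\chi(k)}$, $$\Phi_{1_{\chi|_{\setminus q}}}(T_1,\dots,T_{q-1},T_qT_{q+1},T_{q+2},\dots,T_n)=\Phi_{1_\chi}(T_1,\dots,T_n)+\sum_{\substack{\pi\in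 BNC(\chi),\ |\pi|=2\\ q\not\sim_\pi q+1}}\Phi_\pi(T_1,\dots,T_n).$$ The *operator-valued bi-free moment function* $\mathcal{E}_\pi(T_1,\dots,T_n)=E_\pi(T_1,\dots,T_n)$ is defined recursively (for arbitrary $T_k\in\mathcal{A}$) by $E_{1_\chi}(T_1,\dots,T_n)=E(T_1\cdots T_n)$ and, for $\pi\neq1_\chi$, as follows. Let $V$ be the block of $\pi$ with the largest minimum $v$, $c=E_{\pi|_V}((T_1,\dots,T_n)|_V)$, and $C=L_c$ if $\chi(v)=\ell$, $C=R_c$ if $\chi(v)=r$. If $V=\{k+1,\dots,n\}$, then $E_\pi(T_1,\dots,T_n)=E_{\pi|_{V^c}}(T_1,\dots,T_{k-1},T_kC)$. Otherwise let $W$ be the block whose spine is adjacent to $v$ in the bi-non-crossing diagram of $\pi$, i.e. the block of the $\prec_\chi$-first (if $\chi(v)=\ell$), respectively $\prec_\chi$-last (if $\chi(v)=r$), element of $\{j>v: j\notin V\}$, and let $k=\min\{j\in W:j>v\}$; then $E_\pi(T_1,\dots,T_n)=E_{\pi|_{V^c}}((T_1,\dots,T_{k-1},CT_k,T_{k+1},\dots,T_n)|_{V^c})$.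 The *operator-valued bi-free cumulant function* is $\kappa=\mathcal{E}*\mu_{BNC}$. **Theorem.** Let $\Phi,\Psi:\bigcup_{n\ge1}\bigcup_{\chi}BNC(\chi)\times\mathcal{A}_{\chi(1)}\times\cdots\times\mathcal{A}_{\chi(n)}\to B$. Then $\Phi=\Psi*\zeta_{BNC}$ if and only if $\Psi=\Phi*\mu_{BNC}$, and if this is the case, then $\Phi$ is a bi-moment function if and only if $\Psi$ is a bi-cumulant function. Consequently, the operator-valued bi-free cumulant function $\kappa$ is a bi-cumulant function. -/

import Mathlib

open scoped TensorProduct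

noncomputable section

namespace BiFree

/-- The two sides: left `ℓ` and right `r`. -/
inductive Side : Type
  | l : Side
  | r : Side

variable {n : ℕ}

/-! ### The order `≺_χ` and bi-non-crossing partitions -/

/-- The strict total order `≺_χ` on the nodes: first the left nodes in increasing order, then the
right nodes in decreasing order. -/
def Prec (χ : Fin n → Side) (a b : Fin n) : Prop :=
  match χ a, χ b with
  | .l, .l => a < b
  | .l, .r => True
  | .r, .l => False
  | .r, .r => b < a

/-- `x` is the `≺_χ`-minimum of `S`. -/
def IsPrecLeast (χ : Fin n → Side) (S : Set (Fin n)) (x : Fin n) : Prop :=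
  x ∈ S ∧ ∀ y ∈ S, y = x ∨ Prec χ x y

/-- `x` is the `≺_χ`-maximum of `S`. -/
def IsPrecGreatest (χ : Fin n → Side) (S : Set (Fin n)) (x : Fin n) : Prop :=
  x ∈ S ∧ ∀ y ∈ S, y = x ∨ Prec χ y x

/-- `V` is a `χ`-interval. -/
def IsChiInterval (χ : Fin n → Side) (V : Finset (Fin n)) : Prop :=
  ∀ a ∈ V, ∀ b ∈ V, ∀ k, Prec χ a k → Prec χ k b → k ∈ V

/-- A partition (given by its equivalence relation) is bi-non-crossing with respect to `χ` if it is
non-crossing for the order `≺_χ`. -/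
def IsBiNonCrossing (χ : Fin n → Side) (π : Setoid (Fin n)) : Prop :=
  ∀ u₁ v₁ u₂ v₂ : Fin n, Prec χ u₁ v₁ → Prec χ v₁ u₂ → Prec χ u₂ v₂ →
    π u₁ u₂ → π v₁ v₂ → π u₁ v₁

/-- The set `BNC(χ)`, ordered by refinement. -/
abbrev BNC (χ : Fin n → Side) : Type := {π : Setoid (Fin n) // IsBiNonCrossing χ π}

instance instFiniteBNC (χ : Fin n → Side) : Finite (BNC χ) :=
  Finite.of_injective (fun π : BNC χ => (fun a b => π.1 a b : Fin n → Fin n → Prop))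
    (fun _ _ h => Subtype.ext (Setoid.ext fun a b => iff_of_eq (congrFun (congrFun h a) b)))

instance instFintypeBNC (χ : Fin n → Side) : Fintype (BNC χ) := Fintype.ofFinite _

open Classical in
instance instLocallyFiniteOrderBNC (χ : Fin n → Side) : LocallyFiniteOrder (BNC χ) :=
  Fintype.toLocallyFiniteOrder

/-- The one-block partition `1_χ`. -/
def BNC.one (χ : Fin n → Side) : BNC χ := ⟨⊤, fun _ _ _ _ _ _ _ _ _ => trivial⟩

/-- The number `|π|` of blocks. -/
def BNC.numBlocks {χ : Fin n → Side} (π : BNC χ) : ℕ := π.1.classes.ncard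

/-- `V` is a union of blocks of `π`. -/
def IsUnionOfBlocks (π : Setoid (Fin n)) (V : Finset (Fin n)) : Prop :=
  ∀ a b, π a b → a ∈ V → b ∈ V

/-- The increasing enumeration of the elements of `V`. -/
def enum (V : Finset (Fin n)) : Fin V.card ↪o Fin n := V.orderEmbOfFin rfl

/-- `χ|_V`, with the elements of `V` relabelled increasingly. -/
abbrev resSide (χ : Fin n → Side) (V : Finset (Fin n)) : Fin V.card → Side := fun i => χ (enum V i)

theorem prec_resSide (χ : Fin n → Side) (V : Finset (Fin n)) {a b : Fin V.card}
    (h : Prec (resSide χ V) a b) : Prec χ (enum V a) (enum V b) := by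
  unfold Prec at h ⊢
  simp only [resSide] at h
  split at h <;> simp_all

/-- `π|_V`, with the elements of `V` relabelled increasingly. -/
def BNC.restrict {χ : Fin n → Side} (π : BNC χ) (V : Finset (Fin n)) : BNC (resSide χ V) :=
  ⟨π.1.comap (enum V), fun _ _ _ _ h₁ h₂ h₃ h₄ h₅ =>
    π.2 _ _ _ _ (prec_resSide χ V h₁) (prec_resSide χ V h₂) (prec_resSide χ V h₃) h₄ h₅⟩

/-! ### The incidence algebra of `BNC` -/

/-- Elements of `IA(BNC)`: one element of the incidence algebra of each poset `BNC(χ)`. -/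
def IA : Type := ∀ ⦃n : ℕ⦄ (χ : Fin n → Side), IncidenceAlgebra ℂ (BNC χ)

open Classical in
/-- The zeta function `ζ_BNC`. -/
def zetaBNC : IA := fun _ _ => IncidenceAlgebra.zeta ℂ

open Classical in
/-- The Möbius function `μ_BNC`, the convolution inverse of `ζ_BNC`. -/
def muBNC : IA := fun _ _ => IncidenceAlgebra.mu ℂ

/-! ### `B`-`B`-non-commutative probability spaces -/

/-- A `B`-`B`-non-commutative probability space `(A, E, ε)`. -/
structure NCPS (B A : Type*) [Ring B] [Algebra ℂ B] [Ring A] [Algebra ℂ A] where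
  /-- the homomorphism `ε : B ⊗ Bᵒᵖ → A` -/
  ε : B ⊗[ℂ] Bᵐᵒᵖ →ₐ[ℂ] A
  /-- the expectation `E : A → B` -/
  E : A →ₗ[ℂ] B
  injective_left : Function.Injective fun b : B => ε (b ⊗ₜ[ℂ] 1)
  injective_right : Function.Injective fun b : B => ε (1 ⊗ₜ[ℂ] MulOpposite.op b)
  E_bimodule : ∀ (b₁ b₂ : B) (T : A), E (ε (b₁ ⊗ₜ[ℂ] MulOpposite.op b₂) * T) = b₁ * E T * b₂
  E_right : ∀ (b : B) (T : A), E (T * ε (b ⊗ₜ[ℂ] 1)) = E (T * ε (1 ⊗ₜ[ℂ] MulOpposite.op b))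

variable {B A : Type*} [Ring B] [Algebra ℂ B] [Ring A] [Algebra ℂ A]

namespace NCPS

variable (P : NCPS B A)

/-- `L_b = ε(b ⊗ 1)`. -/
def L (b : B) : A := P.ε (b ⊗ₜ[ℂ] 1)

/-- `R_b = ε(1 ⊗ b)`. -/
def R (b : B) : A := P.ε (1 ⊗ₜ[ℂ] MulOpposite.op b)

theorem L_mul_R (b c : B) : P.L b * P.R c = P.R c * P.L b := by
  simp [L, R, ← map_mul]

/-- The left algebra `A_ℓ` (the commutant of all `R_b`) and the right algebra `A_r` (the commutant
of all `L_b`). -/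
def face : Side → Subalgebra ℂ A
  | .l => Subalgebra.centralizer ℂ (Set.range P.R)
  | .r => Subalgebra.centralizer ℂ (Set.range P.L)

/-- The `B`-operator of the given side: `L_b` on the left, `R_b` on the right. -/
def bop : (s : Side) → B → P.face s
  | .l, b => ⟨P.L b, by
      rintro _ ⟨c, rfl⟩
      exact (P.L_mul_R b c).symm⟩
  | .r, b => ⟨P.R b, by
      rintro _ ⟨c, rfl⟩
      exact P.L_mul_R c b⟩

/-- Insert `b` immediately after an entry with respect to `≺_χ`:
`T L_b` for a left entry and `R_b T` for a right entry. -/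
def insertAfter (b : B) : (s : Side) → P.face s → P.face s
  | .l, T => T * P.bop .l b
  | .r, T => P.bop .r b * T

/-- Insert `b` immediately before an entry with respect to `≺_χ`:
`L_b T` for a left entry and `T R_b` for a right entry. -/
def insertBefore (b : B) : (s : Side) → P.face s → P.face s
  | .l, T => P.bop .l b * T
  | .r, T => T * P.bop .r b

/-- The tuples `(T_1, …, T_n)` with `T_k ∈ A_{χ(k)}`. -/
abbrev Entries (χ : Fin n → Side) : Type _ := ∀ k : Fin n, P.face (χ k)

/-- Functions `⋃_χ BNC(χ) × A_{χ(1)} × ⋯ × A_{χ(n)} → B`. (The value on the empty tuple, `n = 0`,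
is never used.) -/
abbrev BNCFun : Type _ := ∀ ⦃n : ℕ⦄ (χ : Fin n → Side), BNC χ → P.Entries χ → B

variable {P}

/-- `(T_1, …, T_n)|_V`. -/
def Entries.restrict {χ : Fin n → Side} (T : P.Entries χ) (V : Finset (Fin n)) :
    P.Entries (resSide χ V) :=
  fun i => T (enum V i)

/-- `(T_1, …, T_{q-1}, T_q T_{q+1}, T_{q+2}, …, T_{n+1})`, where the nodes `q` and `q+1` are
`q.castSucc` and `q.succ`; the side function is `χ|_{∖q}`. -/
def Entries.merge {χ : Fin (n + 1) → Side} (T : P.Entries χ) (q : Fin n)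
    (h : χ q.castSucc = χ q.succ) : P.Entries (fun i => χ (q.castSucc.succAbove i)) :=
  fun i =>
    ⟨if i = q then (T q.castSucc : A) * (T q.succ : A) else (T (q.castSucc.succAbove i) : A), by
      split_ifs with hi
      · subst hi
        have hi : χ (i.castSucc.succAbove i) = χ i.succ := by rw [Fin.succAbove_castSucc_self]
        simp only [hi]
        exact mul_mem (h ▸ (T i.castSucc).2) (T i.succ).2
      · exact (T _).2⟩

/-! ### Bi-multiplicative, bi-moment and bi-cumulant functions -/

/-- Bi-multiplicative functions. -/
structure IsBiMultiplicative (Φ : P.BNCFun) : Prop where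
  /-- linearity in each entry -/
  linear : ∀ {n : ℕ} (χ : Fin n → Side) (π : BNC χ),
    ∃ M : MultilinearMap ℂ (fun k => P.face (χ k)) B, ∀ T, Φ χ π T = M T
  /-- a `B`-operator at the right of the last entry moves to the last entry of the other side -/
  last_move : ∀ {n : ℕ} (χ : Fin (n + 1) → Side) (T : P.Entries χ) (b : B) (q : Fin (n + 1)),
    IsGreatest {k | χ k ≠ χ (Fin.last n)} q →
    Φ χ (.one χ) (Function.update T (Fin.last n) (T (Fin.last n) * P.bop _ b)) =
      Φ χ (.one χ) (Function.update T q (T q * P.bop _ b))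
  /-- if all entries are on the same side, it moves out of the function -/
  last_out : ∀ {n : ℕ} (χ : Fin (n + 1) → Side) (T : P.Entries χ) (b : B),
    (∀ k, χ k = χ (Fin.last n)) →
    Φ χ (.one χ) (Function.update T (Fin.last n) (T (Fin.last n) * P.bop _ b)) =
      match χ (Fin.last n) with
      | .l => Φ χ (.one χ) T * b
      | .r => b * Φ χ (.one χ) T
  /-- a `B`-operator at the left of an entry moves to the previous entry of the same side -/
  left_move : ∀ {n : ℕ} (χ : Fin n → Side) (T : P.Entries χ) (b : B) (p q : Fin n),
    IsGreatest {k | χ k = χ p ∧ k < p} q →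
    Φ χ (.one χ) (Function.update T p (P.bop _ b * T p)) =
      Φ χ (.one χ) (Function.update T q (T q * P.bop _ b))
  /-- if there is no previous entry of the same side, it moves out of the function -/
  left_out : ∀ {n : ℕ} (χ : Fin n → Side) (T : P.Entries χ) (b : B) (p : Fin n),
    (∀ k, k < p → χ k ≠ χ p) →
    Φ χ (.one χ) (Function.update T p (P.bop _ b * T p)) =
      match χ p with
      | .l => b * Φ χ (.one χ) T
      | .r => Φ χ (.one χ) T * b
  /-- factorization over an ordered decomposition into `χ`-intervals -/
  prod_intervals : ∀ {n m : ℕ} (χ : Fin n → Side) (T : P.Entries χ) (π : BNC χ)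
    (V : Fin m → Finset (Fin n)), 0 < n →
    (∀ i, (V i).Nonempty) → (∀ k, ∃! i, k ∈ V i) →
    (∀ i, IsChiInterval χ (V i)) → (∀ i, IsUnionOfBlocks π.1 (V i)) →
    (∀ i j, i < j → ∀ a ∈ V i, ∀ b ∈ V j, Prec χ a b) →
    Φ χ π T = (List.ofFn fun i => Φ _ (π.restrict (V i)) (T.restrict (V i))).prod
  /-- removal of an inner `χ`-interval `V` with complement `W = Vᶜ`; here `v₀, v₁` are the `≺_χ`-extremal elements of `V` and
  `x₀, x₁` those of the set of all nodes -/
  nested : ∀ {n : ℕ} (χ : Fin n → Side) (T : P.Entries χ) (π : BNC χ) (V : Finset (Fin n))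
    (v₀ v₁ x₀ x₁ θ γ : Fin n),
    IsChiInterval χ V → IsUnionOfBlocks π.1 V →
    IsPrecLeast χ V v₀ → IsPrecGreatest χ V v₁ →
    IsPrecLeast χ Set.univ x₀ → IsPrecGreatest χ Set.univ x₁ →
    x₀ ∈ Vᶜ → x₁ ∈ Vᶜ →
    IsPrecGreatest χ {k | k ∈ Vᶜ ∧ Prec χ k v₀} θ →
    IsPrecLeast χ {k | k ∈ Vᶜ ∧ Prec χ v₁ k} γ →
    Φ χ π T = Φ _ (π.restrict Vᶜ) (Entries.restrict (Function.update T θ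
        (P.insertAfter (Φ _ (π.restrict V) (T.restrict V)) _ (T θ))) Vᶜ) ∧
    Φ χ π T = Φ _ (π.restrict Vᶜ) (Entries.restrict (Function.update T γ
        (P.insertBefore (Φ _ (π.restrict V) (T.restrict V)) _ (T γ))) Vᶜ)

/-- Bi-moment functions. -/
structure IsBiMoment (Φ : P.BNCFun) : Prop where
  biMultiplicative : IsBiMultiplicative Φ
  merge : ∀ {n : ℕ} (χ : Fin (n + 1) → Side) (q : Fin n) (h : χ q.castSucc = χ q.succ)
    (T : P.Entries χ), Φ χ (.one χ) T = Φ _ (.one _) (T.merge q h)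

open Classical in
/-- Bi-cumulant functions. -/
structure IsBiCumulant (Φ : P.BNCFun) : Prop where
  biMultiplicative : IsBiMultiplicative Φ
  merge : ∀ {n : ℕ} (χ : Fin (n + 1) → Side) (q : Fin n) (h : χ q.castSucc = χ q.succ)
    (T : P.Entries χ),
    Φ _ (.one _) (T.merge q h) =
      Φ χ (.one χ) T +
        ∑ π : BNC χ with π.numBlocks = 2 ∧ ¬ π.1 q.castSucc q.succ, Φ χ π T

open Classical in
/-- The convolution `Φ ∗ f`. -/
def BNCFun.conv (Φ : P.BNCFun) (f : IA) : P.BNCFun :=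
  fun _ χ π T => ∑ σ : BNC χ with σ ≤ π, f χ σ π • Φ χ σ T

/-! ### The operator-valued bi-free moment and cumulant functions -/

variable (P)

/-- The product of the `T_k`, `k ∈ S`, in increasing order of `k`. -/
def orderedProd (S : Finset (Fin n)) (T : Fin n → A) : A := ((S.sort (· ≤ ·)).map T).prod

open Classical in
/-- The minima of those blocks of `π` that are contained in `S` (a union of blocks). -/
def blockMins (π : Setoid (Fin n)) (S : Finset (Fin n)) : Finset (Fin n) :=
  S.filter fun k => ∀ j ∈ S, π k j → k ≤ j

open Classical in
theorem blockMins_nonempty (π : Setoid (Fin n)) {S : Finset (Fin n)} (hS : S.Nonempty) :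
    (blockMins π S).Nonempty :=
  ⟨S.min' hS, Finset.mem_filter.2 ⟨S.min'_mem hS, fun j hj _ => S.min'_le j hj⟩⟩

/-- `w` is a node of the block whose spine is adjacent to `v`, in the diagram of the nodes in `S`,
where `v` is the top node of the block that terminates closest to the bottom. All nodes of `S` below
`v` that are not in the block of `v` belong to blocks whose spines pass `v`; if `v` is on the left,
the spine next to `v` is that of the `≺_χ`-first of these nodes, if `v` is on the right, that of the
`≺_χ`-last one. -/
def IsAdjacentSpine (χ : Fin n → Side) (π : Setoid (Fin n)) (S : Finset (Fin n)) (v w : Fin n) :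
    Prop :=
  match χ v with
  | .l => IsPrecLeast χ {j | j ∈ S ∧ v < j ∧ ¬ π v j} w
  | .r => IsPrecGreatest χ {j | j ∈ S ∧ v < j ∧ ¬ π v j} w

open Classical in
/-- The recursively defined `E_{π|_S}((T_1, …, T_n)|_S)`, for `S` a union of blocks of `π`. In the
recursive step, `v` is the largest block minimum, `V` is its block and `b = E_{π|_V}(T|_V)`. -/
def Epi (χ : Fin n → Side) (π : Setoid (Fin n)) (S : Finset (Fin n)) (T : Fin n → A) : B :=
  if h : ∀ i ∈ S, ∀ j ∈ S, π i j then P.E (orderedProd S T)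
  else
    have hS : S.Nonempty := by
      by_contra hS
      simp [Finset.not_nonempty_iff_eq_empty.1 hS] at h
    let v := (blockMins π S).max' (blockMins_nonempty π hS)
    let V := S.filter fun j => π v j
    let b := P.E (orderedProd V T)
    have : (S \ V).card < S.card := by
      have hv : v ∈ S := (Finset.mem_filter.1 (Finset.max'_mem _ (blockMins_nonempty π hS))).1
      refine Finset.card_lt_card ⟨Finset.sdiff_subset, fun hsub => ?_⟩
      exact (Finset.mem_sdiff.1 (hsub hv)).2 (Finset.mem_filter.2 ⟨hv, π.refl v⟩)
    if ∀ j ∈ S, v < j → j ∈ V then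
      -- `V` consists of the last nodes: multiply the node just above `V` on the right
      Epi χ π (S \ V) fun k =>
        if IsGreatest {j | j ∈ S ∧ j < v} k then T k * (P.bop (χ v) b : A) else T k
    else
      -- multiply the first node below `v` of the adjacent block on the left
      Epi χ π (S \ V) fun k =>
        if ∃ w, IsAdjacentSpine χ π S v w ∧ IsLeast {j | j ∈ S ∧ π w j ∧ v < j} k then
          (P.bop (χ v) b : A) * T k
        else T k
termination_by S.card

/-- The operator-valued bi-free moment function. -/
def momentFun : P.BNCFun := fun _ χ π T => P.Epi χ π.1 Finset.univ fun k => (T k : A)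

/-- The operator-valued bi-free cumulant function `κ = 𝓔 ∗ μ_BNC`. -/
def cumulantFun : P.BNCFun := BNCFun.conv P.momentFun muBNC

end NCPS

end BiFree

end

/-! ### The order `≺_χ` through numerical positions. -/

noncomputable section

namespace BiFree

variable {n : ℕ}

/-! The guiding principle is that everything becomes one-sided once the nodes are read in the order
`≺_χ`. Each algebra `A_ℓ`, `A_r` is a `B`-`B`-bimodule: `b` can be inserted before or after an entry
with respect to `≺_χ`, and on the right face this reverses the sides of multiplication. In this
language conditions (i) and (ii) say that `Φ` is balanced over `B` for `≺_χ` (`IsBalanced`).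
Conditions (iii) and (iv) say that an interval `U` which is a union of blocks can be removed, its
value being inserted into the gap that it leaves (`gapInsert`, `Removes`). Hence bi-multiplicativity
is equivalent to `IsMultiplicative`, which is linearity, balancedness and removal.

The moment function does not obviously have these properties: its recursion multiplies the value of
the removed block into an adjacent block at the height of the block's minimum `v`, which need not be
the neighbouring entry for `≺_χ`. The remedy is to regard this factor as the entry of an extra node
`v` joined to the adjacent block (`Epi_insert_node`). The enlarged configuration has one block less
than the original one, so it is balanced by induction on the number of blocks. The factor can
therefore be moved to the true neighbour, leaving the entry `1`, which can be dropped
(`epiSys_eq_gapInsert_of_isTopMin`). Arbitrary intervals are then removed by exchanging or nesting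
removals (`gapInsert_swap`, `gapInsert_trans`). This gives `isBalanced_and_removes_epiSys`, and
`isBiMoment_momentFun` follows since merging is associativity of the product.

Möbius inversion is associativity of the action of the incidence algebra. For multiplicativity, the
partitions below `π` are pairs of partitions of `U` and of its complement, if `U` is a union of
blocks of `π`; so the sum defining `Ψ ∗ ζ` factors (`BNCFun.sum_gapInsert`). Read backwards, by
induction on `π`, the same factorization makes `Ψ` multiplicative when `Ψ ∗ ζ` is.

For the merging rules, let `Φ = Ψ ∗ ζ`. The value of `Φ` at the merged tuple is a sum over the
partitions `π` with `q ∼ q+1`, and the value at the original tuple is a sum over all `σ`, which is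
grouped by the partition `π` obtained from `σ` by joining the blocks of `q` and `q+1`. The term of
`π = 1` in the equality of these sums is exactly the bi-cumulant rule. By multiplicativity, the
terms of the other `π` follow from the same rule on the block of `q`, which has fewer nodes
(`IsMultiplicative.sys_mulInto`). So the cumulant rule implies the moment rule term by term, and the
converse follows by induction on the number of nodes, cancelling all terms but one. -/

/-- The position of a node with respect to `≺_χ`: `Prec χ a b ↔ pos χ a < pos χ b`. -/
def pos (χ : Fin n → Side) (k : Fin n) : ℕ :=
  match χ k with
  | .l => k
  -- Since `k < n`, the subtraction is not truncated and right nodes get positions above `n`, beyond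
  -- all left nodes, in reversed order.
  | .r => 2 * n - k

theorem pos_l {χ : Fin n → Side} {k : Fin n} (h : χ k = .l) : pos χ k = k := by
  simp [pos, h]

theorem pos_r {χ : Fin n → Side} {k : Fin n} (h : χ k = .r) : pos χ k = 2 * n - k := by
  simp [pos, h]

theorem side_cases (χ : Fin n → Side) (k : Fin n) :
    (χ k = .l ∧ pos χ k = k) ∨ (χ k = .r ∧ pos χ k = 2 * n - k) := by
  cases h : χ k
  · exact Or.inl ⟨rfl, pos_l h⟩
  · exact Or.inr ⟨rfl, pos_r h⟩

theorem prec_iff {χ : Fin n → Side} {a b : Fin n} : Prec χ a b ↔ pos χ a < pos χ b := by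
  unfold Prec
  rcases side_cases χ a with ⟨ha, ha'⟩ | ⟨ha, ha'⟩ <;>
    rcases side_cases χ b with ⟨hb, hb'⟩ | ⟨hb, hb'⟩ <;>
    rw [ha, hb, ha', hb'] <;> simp only [Fin.lt_def] <;> have := a.2 <;> have := b.2 <;>
    first | omega | (simp; omega)

theorem pos_injective (χ : Fin n → Side) : Function.Injective (pos χ) := by
  intro a b h
  have h1 : ¬ Prec χ a b := by rw [prec_iff]; omega
  have h2 : ¬ Prec χ b a := by rw [prec_iff]; omega
  unfold Prec at h1 h2
  cases ha : χ a <;> cases hb : χ b <;> simp only [ha, hb] at h1 h2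
  · omega
  · exact absurd trivial h1
  · exact absurd trivial h2
  · omega

theorem pos_lt_of_le_of_ne {χ : Fin n → Side} {a b : Fin n} (h : pos χ a ≤ pos χ b) (hne : a ≠ b) :
    pos χ a < pos χ b :=
  lt_of_le_of_ne h fun h => hne (pos_injective χ h)

/-- `p` is the `≺_χ`-last element of `S` before `x`. -/
def IsPred (χ : Fin n → Side) (S : Finset (Fin n)) (x p : Fin n) : Prop :=
  p ∈ S ∧ pos χ p < pos χ x ∧ ∀ q ∈ S, pos χ q < pos χ x → pos χ q ≤ pos χ p

/-- `p` is the `≺_χ`-first element of `S` after `x`. -/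
def IsSucc (χ : Fin n → Side) (S : Finset (Fin n)) (x p : Fin n) : Prop :=
  p ∈ S ∧ pos χ x < pos χ p ∧ ∀ q ∈ S, pos χ x < pos χ q → pos χ p ≤ pos χ q

theorem IsPred.unique {χ : Fin n → Side} {S : Finset (Fin n)} {x p q : Fin n}
    (hp : IsPred χ S x p) (hq : IsPred χ S x q) : p = q :=
  pos_injective χ (le_antisymm (hq.2.2 p hp.1 hp.2.1) (hp.2.2 q hq.1 hq.2.1))

theorem exists_isPred {χ : Fin n → Side} {S : Finset (Fin n)} {x y : Fin n} (hy : y ∈ S)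
    (hyx : pos χ y < pos χ x) : ∃ p, IsPred χ S x p := by
  obtain ⟨p, hp, hmax⟩ := Finset.exists_max_image (S.filter fun y => pos χ y < pos χ x) (pos χ)
    ⟨y, Finset.mem_filter.2 ⟨hy, hyx⟩⟩
  rw [Finset.mem_filter] at hp
  exact ⟨p, hp.1, hp.2, fun q hq hqx => hmax q (Finset.mem_filter.2 ⟨hq, hqx⟩)⟩

theorem exists_isSucc {χ : Fin n → Side} {S : Finset (Fin n)} {x y : Fin n} (hy : y ∈ S)
    (hyx : pos χ x < pos χ y) : ∃ p, IsSucc χ S x p := by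
  obtain ⟨p, hp, hmin⟩ := Finset.exists_min_image (S.filter fun y => pos χ x < pos χ y) (pos χ)
    ⟨y, Finset.mem_filter.2 ⟨hy, hyx⟩⟩
  rw [Finset.mem_filter] at hp
  exact ⟨p, hp.1, hp.2, fun q hq hqx => hmin q (Finset.mem_filter.2 ⟨hq, hqx⟩)⟩

/-- `V` is an interval in `S` for the order `≺_χ`. -/
def IsIntervalIn (χ : Fin n → Side) (S V : Finset (Fin n)) : Prop :=
  ∀ a ∈ V, ∀ b ∈ V, ∀ k ∈ S, pos χ a < pos χ k → pos χ k < pos χ b → k ∈ V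

/-- `V` is a union of blocks of `π` within `S`. -/
def IsSaturatedIn (π : Setoid (Fin n)) (S V : Finset (Fin n)) : Prop :=
  ∀ a ∈ V, ∀ b ∈ S, π a b → b ∈ V

/-- The restriction of `π` to `S` is non-crossing for `≺_χ`. -/
def IsNonCrossingOn (χ : Fin n → Side) (π : Setoid (Fin n)) (S : Finset (Fin n)) : Prop :=
  ∀ u₁ ∈ S, ∀ v₁ ∈ S, ∀ u₂ ∈ S, ∀ v₂ ∈ S, pos χ u₁ < pos χ v₁ → pos χ v₁ < pos χ u₂ →
    pos χ u₂ < pos χ v₂ → π u₁ u₂ → π v₁ v₂ → π u₁ v₁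

theorem IsNonCrossingOn.mono {χ : Fin n → Side} {π : Setoid (Fin n)} {S S' : Finset (Fin n)}
    (h : IsNonCrossingOn χ π S) (hS : S' ⊆ S) : IsNonCrossingOn χ π S' :=
  fun u₁ h₁ v₁ h₂ u₂ h₃ v₂ h₄ => h u₁ (hS h₁) v₁ (hS h₂) u₂ (hS h₃) v₂ (hS h₄)

theorem isBiNonCrossing_iff {χ : Fin n → Side} {π : Setoid (Fin n)} :
    IsBiNonCrossing χ π ↔ IsNonCrossingOn χ π Finset.univ := by
  simp [IsBiNonCrossing, IsNonCrossingOn, prec_iff]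

theorem BNC.isNonCrossingOn {χ : Fin n → Side} (π : BNC χ) (S : Finset (Fin n)) :
    IsNonCrossingOn χ π.1 S :=
  (isBiNonCrossing_iff.1 π.2).mono (Finset.subset_univ S)

/-- A node outside an interval lies on the same side of all its elements; otherwise it would be
enclosed by two of them. So the place of an interval can be described by any of its elements. -/
theorem IsIntervalIn.pos_lt_of_lt {χ : Fin n → Side} {S V : Finset (Fin n)}
    (hV : IsIntervalIn χ S V) {x y k : Fin n} (hx : x ∈ V) (hy : y ∈ V) (hk : k ∈ S) (hkV : k ∉ V)
    (h : pos χ k < pos χ x) : pos χ k < pos χ y := by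
  by_contra h'
  have : pos χ y < pos χ k := pos_lt_of_le_of_ne (by omega) (fun h => hkV (h ▸ hy))
  exact hkV (hV y hy x hx k hk this h)

theorem IsIntervalIn.lt_pos_of_lt {χ : Fin n → Side} {S V : Finset (Fin n)}
    (hV : IsIntervalIn χ S V) {x y k : Fin n} (hx : x ∈ V) (hy : y ∈ V) (hk : k ∈ S) (hkV : k ∉ V)
    (h : pos χ x < pos χ k) : pos χ y < pos χ k := by
  by_contra h'
  have : pos χ k < pos χ y := pos_lt_of_le_of_ne (by omega) (fun h => hkV (h ▸ hy))
  exact hkV (hV x hx y hy k hk h this)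

/-! ### The bimodule structure of the entries and insertion into gaps. -/

variable {B A : Type*} [Ring B] [Algebra ℂ B] [Ring A] [Algebra ℂ A]

namespace NCPS

variable {P : NCPS B A}

theorem L_add (b c : B) : P.L (b + c) = P.L b + P.L c := by
  simp [L, TensorProduct.add_tmul]

theorem R_add (b c : B) : P.R (b + c) = P.R b + P.R c := by
  simp [R, TensorProduct.tmul_add]

theorem L_smul (z : ℂ) (b : B) : P.L (z • b) = z • P.L b := by
  simp only [L, ← TensorProduct.smul_tmul', map_smul]

theorem R_smul (z : ℂ) (b : B) : P.R (z • b) = z • P.R b := by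
  simp [R]

theorem L_mul (b c : B) : P.L (b * c) = P.L b * P.L c := by
  simp [L, ← map_mul]

theorem R_mul (b c : B) : P.R (b * c) = P.R c * P.R b := by
  simp [R, ← map_mul]

theorem E_L_mul (b : B) (T : A) : P.E (P.L b * T) = b * P.E T := by
  simpa [L] using P.E_bimodule b 1 T

theorem E_R_mul (b : B) (T : A) : P.E (P.R b * T) = P.E T * b := by
  simpa [R] using P.E_bimodule 1 b T

theorem E_mul_L (b : B) (T : A) : P.E (T * P.L b) = P.E (T * P.R b) := P.E_right b T

theorem face_l_comm {X : A} (hX : X ∈ P.face .l) (b : B) : P.R b * X = X * P.R b :=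
  hX _ ⟨b, rfl⟩

theorem face_r_comm {X : A} (hX : X ∈ P.face .r) (b : B) : P.L b * X = X * P.L b :=
  hX _ ⟨b, rfl⟩

@[simp] theorem coe_bop_l (b : B) : (P.bop .l b : A) = P.L b := rfl
@[simp] theorem coe_bop_r (b : B) : (P.bop .r b : A) = P.R b := rfl

/-- Insertion after an entry is a right action of `B` on both faces: on the right face `R` is
antimultiplicative but acts from the left, and the two reversals cancel. -/
theorem insertAfter_mul (s : Side) (b c : B) (X : P.face s) :
    P.insertAfter c s (P.insertAfter b s X) = P.insertAfter (b * c) s X := by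
  cases s <;> ext <;> simp [insertAfter, L_mul, R_mul, mul_assoc]

theorem insertBefore_mul (s : Side) (b c : B) (X : P.face s) :
    P.insertBefore b s (P.insertBefore c s X) = P.insertBefore (b * c) s X := by
  cases s <;> ext <;> simp [insertBefore, L_mul, R_mul, mul_assoc]

/-- This is the bimodule axiom; the two insertions multiply on opposite sides of the entry. -/
theorem insertAfter_insertBefore (s : Side) (b c : B) (X : P.face s) :
    P.insertAfter b s (P.insertBefore c s X) = P.insertBefore c s (P.insertAfter b s X) := by
  cases s <;> ext <;> simp [insertAfter, insertBefore, mul_assoc]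

/-- Insertion after an entry, as a linear map in the inserted element of `B`. -/
theorem insertAfter_add (s : Side) (b c : B) (X : P.face s) :
    P.insertAfter (b + c) s X = P.insertAfter b s X + P.insertAfter c s X := by
  cases s <;> ext <;> simp [insertAfter, L_add, R_add, mul_add, add_mul]

theorem insertAfter_smul (s : Side) (z : ℂ) (b : B) (X : P.face s) :
    P.insertAfter (z • b) s X = z • P.insertAfter b s X := by
  cases s <;> ext <;> simp [insertAfter, L_smul, R_smul]

theorem insertAfter_add_right (s : Side) (b : B) (X Y : P.face s) :
    P.insertAfter b s (X + Y) = P.insertAfter b s X + P.insertAfter b s Y := by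
  cases s <;> ext <;> simp [insertAfter, mul_add, add_mul]

theorem insertAfter_smul_right (s : Side) (z : ℂ) (b : B) (X : P.face s) :
    P.insertAfter b s (z • X) = z • P.insertAfter b s X := by
  cases s <;> ext <;> simp [insertAfter]

namespace Entries

variable {χ : Fin n → Side}

/-- Insert `b` after the entry `p` with respect to `≺_χ`. -/
def after (T : P.Entries χ) (p : Fin n) (b : B) : P.Entries χ :=
  Function.update T p (P.insertAfter b _ (T p))

/-- Insert `b` before the entry `p` with respect to `≺_χ`. -/
def before (T : P.Entries χ) (p : Fin n) (b : B) : P.Entries χ :=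
  Function.update T p (P.insertBefore b _ (T p))

@[simp] theorem after_self (T : P.Entries χ) (p : Fin n) (b : B) :
    T.after p b p = P.insertAfter b _ (T p) := by simp [after]

theorem after_of_ne (T : P.Entries χ) {p k : Fin n} (h : k ≠ p) (b : B) :
    T.after p b k = T k := by simp [after, h]

theorem before_of_ne (T : P.Entries χ) {p k : Fin n} (h : k ≠ p) (b : B) :
    T.before p b k = T k := by simp [before, h]

theorem after_after (T : P.Entries χ) (p : Fin n) (b c : B) :
    (T.after p b).after p c = T.after p (b * c) := by
  simp [after, insertAfter_mul]

theorem before_before (T : P.Entries χ) (p : Fin n) (b c : B) :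
    (T.before p c).before p b = T.before p (b * c) := by
  simp [before, insertBefore_mul]

theorem after_comm (T : P.Entries χ) {p q : Fin n} (h : p ≠ q) (b c : B) :
    (T.after p b).after q c = (T.after q c).after p b := by
  rw [after, after_of_ne _ h.symm, after, after, after_of_ne _ h, after,
    Function.update_comm h]

theorem after_before (T : P.Entries χ) (p q : Fin n) (b c : B) :
    (T.after p b).before q c = (T.before q c).after p b := by
  by_cases h : p = q
  · subst h
    simp [after, before, insertAfter_insertBefore]
  · rw [before, after_of_ne _ (Ne.symm h), after, after, before_of_ne _ h, before,
      Function.update_comm h]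

theorem update_after_self (T : P.Entries χ) (p : Fin n) (b : B) (X : P.face (χ p)) :
    Entries.after (Function.update T p X : P.Entries χ) p b =
      Function.update T p (P.insertAfter b _ X) := by
  simp [after]

theorem update_after (T : P.Entries χ) {p q : Fin n} (h : p ≠ q) (b : B) (X : P.face (χ q)) :
    Entries.after (Function.update T q X : P.Entries χ) p b =
      Function.update (T.after p b) q X := by
  simp [after, h, Function.update_comm h]

end Entries

open Classical in
/-- The value of `f` with `b` inserted into `S` at the place of `x` (with respect to `≺_χ`). -/
def gapInsert {χ : Fin n → Side} (f : P.Entries χ → B) (S : Finset (Fin n)) (x : Fin n) (b : B)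
    (T : P.Entries χ) : B :=
  -- Without a predecessor the gap is in front of all entries, so `b` comes out on the left. A gap
  -- behind all entries needs no case of its own: balancedness turns it into right multiplication.
  if h : ∃ p, IsPred χ S x p then f (T.after h.choose b) else b * f T

section gapInsert

variable {χ : Fin n → Side} {f : P.Entries χ → B} {S : Finset (Fin n)} {x p : Fin n}

theorem gapInsert_of_isPred (h : IsPred χ S x p) (b : B) (T : P.Entries χ) :
    gapInsert f S x b T = f (T.after p b) := by
  have h' : ∃ p, IsPred χ S x p := ⟨p, h⟩
  rw [gapInsert, dif_pos h', h'.choose_spec.unique h]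

theorem gapInsert_of_forall (h : ∀ k ∈ S, pos χ x ≤ pos χ k) (b : B) (T : P.Entries χ) :
    gapInsert f S x b T = b * f T := by
  rw [gapInsert, dif_neg]
  rintro ⟨p, hp⟩
  exact absurd hp.2.1 (not_lt.2 (h p hp.1))

theorem exists_isPred_or_forall (χ : Fin n → Side) (S : Finset (Fin n)) (x : Fin n) :
    (∃ p, IsPred χ S x p) ∨ ∀ k ∈ S, pos χ x ≤ pos χ k := by
  by_cases h : ∀ k ∈ S, pos χ x ≤ pos χ k
  · exact Or.inr h
  · push Not at h
    obtain ⟨k, hk, hkx⟩ := h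
    exact Or.inl (exists_isPred hk hkx)

/-- Only the cut that `x` makes in `S` matters, so any element of a removed interval may serve as
the marker of its gap. -/
theorem gapInsert_congr_point {y : Fin n} (h : ∀ k ∈ S, pos χ k < pos χ x ↔ pos χ k < pos χ y)
    (b : B) (T : P.Entries χ) : gapInsert f S x b T = gapInsert f S y b T := by
  rcases exists_isPred_or_forall χ S x with ⟨p, hp⟩ | hx
  · rw [gapInsert_of_isPred hp, gapInsert_of_isPred (x := y)]
    exact ⟨hp.1, (h p hp.1).1 hp.2.1, fun q hq hqy => hp.2.2 q hq ((h q hq).2 hqy)⟩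
  · rw [gapInsert_of_forall hx, gapInsert_of_forall]
    intro k hk
    have := hx k hk
    have := h k hk
    omega

theorem gapInsert_congr (hf : ∀ T T' : P.Entries χ, (∀ k ∈ S, T k = T' k) → f T = f T') (b : B)
    {T T' : P.Entries χ} (h : ∀ k ∈ S, T k = T' k) :
    gapInsert f S x b T = gapInsert f S x b T' := by
  rcases exists_isPred_or_forall χ S x with ⟨p, hp⟩ | hx
  · rw [gapInsert_of_isPred hp, gapInsert_of_isPred hp]
    apply hf
    intro k hk
    by_cases hkp : k = p
    · subst hkp; simp [h k hk]
    · simp [Entries.after_of_ne _ hkp, h k hk]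
  · rw [gapInsert_of_forall hx, gapInsert_of_forall hx, hf T T' h]

theorem gapInsert_empty (b : B) (T : P.Entries χ) : gapInsert f ∅ x b T = b * f T :=
  gapInsert_of_forall (by simp) b T

end gapInsert

/-- `f` is balanced over `B` for the order `≺_χ` on the nodes in `S`. -/
structure IsBalanced (χ : Fin n → Side) (S : Finset (Fin n)) (f : P.Entries χ → B) : Prop where
  mid : ∀ (T : P.Entries χ) (b : B) (p q : Fin n), p ∈ S → q ∈ S → pos χ p < pos χ q →
    (∀ k ∈ S, pos χ p < pos χ k → pos χ q ≤ pos χ k) → f (T.after p b) = f (T.before q b)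
  first : ∀ (T : P.Entries χ) (b : B) (p : Fin n), p ∈ S → (∀ k ∈ S, pos χ p ≤ pos χ k) →
    f (T.before p b) = b * f T
  last : ∀ (T : P.Entries χ) (b : B) (p : Fin n), p ∈ S → (∀ k ∈ S, pos χ k ≤ pos χ p) →
    f (T.after p b) = f T * b

section balanced

variable {χ : Fin n → Side} {S : Finset (Fin n)}

/-- The predecessor and the successor of `x` are consecutive in `S` because `x ∉ S`, and
balancedness carries `b` across the gap. This makes the two descriptions in condition (iv)
interchangeable. -/
theorem IsBalanced.gapInsert_of_isSucc {f : P.Entries χ → B} (hf : IsBalanced χ S f) {x q : Fin n}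
    (hx : x ∉ S) (hq : IsSucc χ S x q) (b : B) (T : P.Entries χ) :
    gapInsert f S x b T = f (T.before q b) := by
  rcases exists_isPred_or_forall χ S x with ⟨p, hp⟩ | h
  · rw [gapInsert_of_isPred hp]
    refine hf.mid T b p q hp.1 hq.1 (hp.2.1.trans hq.2.1) fun k hk hpk => ?_
    refine hq.2.2 k hk (pos_lt_of_le_of_ne ?_ fun h => hx (h ▸ hk))
    by_contra hkx
    have := hp.2.2 k hk (by omega)
    omega
  · rw [gapInsert_of_forall h, hf.first T b q hq.1]
    exact fun k hk => hq.2.2 k hk (pos_lt_of_le_of_ne (h k hk) fun h => hx (h ▸ hk))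

/-- Nonemptiness is essential: for `S = ∅` the insertion is by definition a left multiplication. -/
theorem IsBalanced.gapInsert_of_forall_lt {f : P.Entries χ → B} (hf : IsBalanced χ S f)
    (hS : S.Nonempty) {x : Fin n} (hx : ∀ k ∈ S, pos χ k < pos χ x) (b : B) (T : P.Entries χ) :
    gapInsert f S x b T = f T * b := by
  obtain ⟨y, hy⟩ := hS
  obtain ⟨p, hp⟩ := exists_isPred hy (hx y hy)
  rw [gapInsert_of_isPred hp]
  exact hf.last T b p hp.1 fun k hk => hp.2.2 k hk (hx k hk)

end balanced

end NCPS

end BiFree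

end

/-! ### Balancedness and iterated insertions -/

noncomputable section

namespace BiFree

variable {n : ℕ}

variable {B A : Type*} [Ring B] [Algebra ℂ B] [Ring A] [Algebra ℂ A]

namespace NCPS

variable {P : NCPS B A}

/-- `f` depends only on the entries in `S`. -/
def DependsOnlyOn {χ : Fin n → Side} (S : Finset (Fin n)) (f : P.Entries χ → B) : Prop :=
  ∀ T T' : P.Entries χ, (∀ k ∈ S, T k = T' k) → f T = f T'

theorem DependsOnlyOn.after {χ : Fin n → Side} {S : Finset (Fin n)} {f : P.Entries χ → B}
    (hf : DependsOnlyOn S f) {p : Fin n} (hp : p ∉ S) (T : P.Entries χ) (b : B) :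
    f (T.after p b) = f T :=
  hf _ _ fun _ hk => T.after_of_ne (ne_of_mem_of_not_mem hk hp) b

theorem DependsOnlyOn.before {χ : Fin n → Side} {S : Finset (Fin n)} {f : P.Entries χ → B}
    (hf : DependsOnlyOn S f) {p : Fin n} (hp : p ∉ S) (T : P.Entries χ) (b : B) :
    f (T.before p b) = f T :=
  hf _ _ fun _ hk => T.before_of_ne (ne_of_mem_of_not_mem hk hp) b

theorem DependsOnlyOn.gapInsert_after {χ : Fin n → Side} {S : Finset (Fin n)}
    {f : P.Entries χ → B} (hf : DependsOnlyOn S f) {p : Fin n} (hp : p ∉ S) (x : Fin n)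
    (T : P.Entries χ) (b c : B) :
    gapInsert f S x c (T.after p b) = gapInsert f S x c T :=
  gapInsert_congr hf c fun _ hk => T.after_of_ne (ne_of_mem_of_not_mem hk hp) b

theorem DependsOnlyOn.gapInsert_before {χ : Fin n → Side} {S : Finset (Fin n)}
    {f : P.Entries χ → B} (hf : DependsOnlyOn S f) {p : Fin n} (hp : p ∉ S) (x : Fin n)
    (T : P.Entries χ) (b c : B) :
    gapInsert f S x c (T.before p b) = gapInsert f S x c T :=
  gapInsert_congr hf c fun _ hk => T.before_of_ne (ne_of_mem_of_not_mem hk hp) b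

section

variable {χ : Fin n → Side} {S : Finset (Fin n)} {f : P.Entries χ → B} {x p : Fin n}

/-- A factor at the right end of the inserted element can be absorbed by the entry after the gap;
the companion for the left end uses the entry before it. These move `b` across the boundary of a
removed interval. -/
theorem IsBalanced.gapInsert_mul_of_isSucc (hf : IsBalanced χ S f) (hx : x ∉ S) {q : Fin n}
    (hq : IsSucc χ S x q) (b c : B) (T : P.Entries χ) :
    gapInsert f S x (c * b) T = gapInsert f S x c (T.before q b) := by
  rw [hf.gapInsert_of_isSucc hx hq, hf.gapInsert_of_isSucc hx hq, Entries.before_before]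

theorem gapInsert_mul_of_isPred (hp : IsPred χ S x p) (b c : B) (T : P.Entries χ) :
    gapInsert f S x (b * c) T = gapInsert f S x c (T.after p b) := by
  rw [gapInsert_of_isPred hp, gapInsert_of_isPred hp, Entries.after_after]

end

/-- If the value on `S` is obtained by inserting the value on an interval `V` of `S` into the rest,
then it is balanced as soon as the values on `V` and on the rest are. -/
theorem isBalanced_of_gapInsert {χ : Fin n → Side} {S V : Finset (Fin n)} {x : Fin n}
    {f g h : P.Entries χ → B} (hVS : V ⊆ S) (hV : IsIntervalIn χ S V) (hx : x ∈ V)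
    (hW : (S \ V).Nonempty) (hg : DependsOnlyOn V g) (hh : DependsOnlyOn (S \ V) h)
    (hf : ∀ T, f T = gapInsert h (S \ V) x (g T) T) (hgb : IsBalanced χ V g)
    (hhb : IsBalanced χ (S \ V) h) : IsBalanced χ S f := by
  have hxW : x ∉ S \ V := by simp [hx]
  constructor
  · intro T b p q hp hq hpq hcons
    rw [hf, hf]
    -- A consecutive pair lies inside `V`, outside `V`, or across its boundary. Across the boundary,
    -- `b` leaves the value on `V` as an outer factor and is absorbed by the neighbouring entry of
    -- the rest.
    by_cases hpV : p ∈ V <;> by_cases hqV : q ∈ V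
    · rw [hgb.mid T b p q hpV hqV hpq fun k hk => hcons k (hVS hk),
        hh.gapInsert_after (by simp [hpV]), hh.gapInsert_before (by simp [hqV])]
    · have hqW : q ∈ S \ V := by simp [hq, hqV]
      have hqs : IsSucc χ (S \ V) x q := by
        refine ⟨hqW, hV.lt_pos_of_lt hpV hx hq hqV hpq, fun k hk hxk => ?_⟩
        rw [Finset.mem_sdiff] at hk
        exact hcons k hk.1 (hV.lt_pos_of_lt hx hpV hk.1 hk.2 hxk)
      rw [hh.gapInsert_after (by simp [hpV]), hg.before hqV,
        ← hhb.gapInsert_mul_of_isSucc hxW hqs, hgb.last T b p hpV]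
      intro k hk
      by_contra hkp
      have h1 := hcons k (hVS hk) (by omega)
      have h2 := hV.lt_pos_of_lt hpV hk hq hqV hpq
      omega
    · have hpW : p ∈ S \ V := by simp [hp, hpV]
      have hps : IsPred χ (S \ V) x p := by
        refine ⟨hpW, hV.pos_lt_of_lt hqV hx hp hpV hpq, fun k hk hkx => ?_⟩
        rw [Finset.mem_sdiff] at hk
        have := hV.pos_lt_of_lt hx hqV hk.1 hk.2 hkx
        by_contra hk'
        have := hcons k hk.1 (by omega)
        omega
      rw [hh.gapInsert_before (by simp [hqV]), hg.after hpV,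
        ← gapInsert_mul_of_isPred hps, hgb.first T b q hqV]
      intro k hk
      exact hcons k (hVS hk) (hV.pos_lt_of_lt hqV hk hp hpV hpq)
    · have hpW : p ∈ S \ V := by simp [hp, hpV]
      have hqW : q ∈ S \ V := by simp [hq, hqV]
      have hcW : ∀ k ∈ S \ V, pos χ p < pos χ k → pos χ q ≤ pos χ k :=
        fun k hk => hcons k (Finset.mem_sdiff.1 hk).1
      rw [hg.after hpV, hg.before hqV]
      rcases exists_isPred_or_forall χ (S \ V) x with ⟨r, hr⟩ | hr
      -- If `p` and `q` are consecutive and both outside `V`, the interval `V` is not between them.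
      -- So its value is not inserted after `p`, where it would not commute with `b`.
      · have hpr : p ≠ r := by
          rintro rfl
          have h1 := hcons x (hVS hx) hr.2.1
          have h2 : pos χ q < pos χ x := by
            by_contra h2
            have h3 : pos χ x = pos χ q := by omega
            exact hqV (pos_injective χ h3 ▸ hx)
          have := hr.2.2 q hqW h2
          omega
        rw [gapInsert_of_isPred hr, gapInsert_of_isPred hr, Entries.after_comm _ hpr,
          hhb.mid _ b p q hpW hqW hpq hcW, Entries.after_before]
      · rw [gapInsert_of_forall hr, gapInsert_of_forall hr, hhb.mid _ b p q hpW hqW hpq hcW]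
  · intro T b p hp hfirst
    rw [hf, hf]
    by_cases hpV : p ∈ V
    · have hr : ∀ k ∈ S \ V, pos χ x ≤ pos χ k := by
        intro k hk
        rw [Finset.mem_sdiff] at hk
        exact (hV.lt_pos_of_lt hpV hx hk.1 hk.2
          (pos_lt_of_le_of_ne (hfirst k hk.1) fun h => hk.2 (h ▸ hpV))).le
      rw [hh.gapInsert_before (by simp [hpV]), gapInsert_of_forall hr, gapInsert_of_forall hr,
        hgb.first T b p hpV fun k hk => hfirst k (hVS hk), mul_assoc]
    · have hpW : p ∈ S \ V := by simp [hp, hpV]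
      obtain ⟨r, hr⟩ := exists_isPred hpW
        (pos_lt_of_le_of_ne (hfirst x (hVS hx)) fun h => hpV (h ▸ hx))
      rw [hg.before hpV, gapInsert_of_isPred hr, gapInsert_of_isPred hr, ← Entries.after_before,
        hhb.first _ b p hpW fun k hk => hfirst k (Finset.mem_sdiff.1 hk).1]
  · intro T b p hp hlast
    rw [hf, hf]
    by_cases hpV : p ∈ V
    · have hr : ∀ k ∈ S \ V, pos χ k < pos χ x := by
        intro k hk
        rw [Finset.mem_sdiff] at hk
        exact (hV.pos_lt_of_lt hpV hx hk.1 hk.2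
          (pos_lt_of_le_of_ne (hlast k hk.1) fun h => hk.2 (h ▸ hpV)))
      rw [hh.gapInsert_after (by simp [hpV]), hhb.gapInsert_of_forall_lt hW hr,
        hhb.gapInsert_of_forall_lt hW hr, hgb.last T b p hpV fun k hk => hlast k (hVS hk),
        mul_assoc]
    · have hpW : p ∈ S \ V := by simp [hp, hpV]
      have hl : ∀ k ∈ S \ V, pos χ k ≤ pos χ p := fun k hk => hlast k (Finset.mem_sdiff.1 hk).1
      rw [hg.after hpV]
      rcases exists_isPred_or_forall χ (S \ V) x with ⟨r, hr⟩ | hr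
      · have hpr : p ≠ r := by
          rintro rfl
          have := hlast x (hVS hx)
          have := hr.2.1
          omega
        rw [gapInsert_of_isPred hr, gapInsert_of_isPred hr, Entries.after_comm _ hpr,
          hhb.last _ b p hpW hl]
      · rw [gapInsert_of_forall hr, gapInsert_of_forall hr, hhb.last _ b p hpW hl, mul_assoc]

/-- Two disjoint intervals `X` and `Y` (with `X` before `Y`) may be removed in either order. -/
theorem gapInsert_swap {χ : Fin n → Side} {R X Y : Finset (Fin n)} {x y : Fin n}
    (F : Finset (Fin n) → P.Entries χ → B) (hF : ∀ S, DependsOnlyOn S (F S))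
    (hX : IsIntervalIn χ (X ∪ Y ∪ R) X) (hY : IsIntervalIn χ (X ∪ Y ∪ R) Y)
    (hXR : Disjoint X R) (hYR : Disjoint Y R) (hXY : Disjoint X Y)
    (hx : x ∈ X) (hy : y ∈ Y) (hxy : pos χ x < pos χ y)
    (hXb : IsBalanced χ X (F X))
    (h₁ : ∀ T, F (X ∪ R) T = gapInsert (F R) R x (F X T) T)
    (h₂ : ∀ T, F (Y ∪ R) T = gapInsert (F R) R y (F Y T) T) (T : P.Entries χ) :
    gapInsert (F (X ∪ R)) (X ∪ R) y (F Y T) T = gapInsert (F (Y ∪ R)) (Y ∪ R) x (F X T) T := by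
  have dXR : ∀ {k}, k ∈ X → k ∉ R := fun h => Finset.disjoint_left.1 hXR h
  have dYR : ∀ {k}, k ∈ Y → k ∉ R := fun h => Finset.disjoint_left.1 hYR h
  have dXY : ∀ {k}, k ∈ X → k ∉ Y := fun h => Finset.disjoint_left.1 hXY h
  have hXy : ∀ k ∈ X, pos χ k < pos χ y := fun k hk =>
    hX.lt_pos_of_lt hx hk (by simp [hy]) (fun h => dXY h hy) hxy
  have hXltY : ∀ k ∈ X, ∀ l ∈ Y, pos χ k < pos χ l := fun k hk l hl =>
    hY.pos_lt_of_lt hy hl (by simp [hk]) (dXY hk) (hXy k hk)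
  have hxpred : ∀ {r}, IsPred χ R x r → IsPred χ (Y ∪ R) x r := by
    intro r hr
    refine ⟨Finset.mem_union_right _ hr.1, hr.2.1, fun k hk hkx => ?_⟩
    rcases Finset.mem_union.1 hk with hk | hk
    · have := hXltY x hx k hk
      omega
    · exact hr.2.2 k hk hkx
  have hxnone : (∀ k ∈ R, pos χ x ≤ pos χ k) → ∀ k ∈ Y ∪ R, pos χ x ≤ pos χ k := by
    intro h k hk
    rcases Finset.mem_union.1 hk with hk | hk
    · exact (hXltY x hx k hk).le
    · exact h k hk
  obtain ⟨p, hp⟩ := exists_isPred (S := X ∪ R) (Finset.mem_union_left _ hx) hxy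
  rw [gapInsert_of_isPred hp, h₁]
  -- Here `p` precedes `y` in `X ∪ R`. If `p ∈ X`, no element of `R` separates `X` from `Y`, and
  -- either order inserts the product of the two values into one gap of `R`. Otherwise `p ∈ R`
  -- separates them and the insertions concern different places.
  by_cases hpX : p ∈ X
  · have hlast : F X (T.after p (F Y T)) = F X T * F Y T :=
      hXb.last _ _ p hpX fun k hk => hp.2.2 k (Finset.mem_union_left _ hk) (hXy k hk)
    have hcut : ∀ k ∈ R, pos χ k < pos χ x ↔ pos χ k < pos χ y := by
      intro k hk
      refine ⟨fun h => h.trans hxy, fun h => ?_⟩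
      have := hp.2.2 k (Finset.mem_union_right _ hk) h
      exact hX.pos_lt_of_lt hpX hx (by simp [hk]) (fun h => dXR h hk)
        (pos_lt_of_le_of_ne this fun h => dXR (h ▸ hpX) hk)
    rw [hlast, (hF R).gapInsert_after (dXR hpX)]
    rcases exists_isPred_or_forall χ R x with ⟨r, hr⟩ | hr
    · have hr' : IsPred χ R y r :=
        ⟨hr.1, hr.2.1.trans hxy, fun k hk hky => hr.2.2 k hk ((hcut k hk).2 hky)⟩
      rw [gapInsert_of_isPred hr, gapInsert_of_isPred (hxpred hr), h₂, gapInsert_of_isPred hr',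
        Entries.after_after, (hF Y).after fun h => dYR h hr.1]
    · have hr' : ∀ k ∈ R, pos χ y ≤ pos χ k := by
        intro k hk
        have := hr k hk
        have := hcut k hk
        omega
      rw [gapInsert_of_forall hr, gapInsert_of_forall (hxnone hr), h₂, gapInsert_of_forall hr',
        mul_assoc]
  · have hpR : p ∈ R := (Finset.mem_union.1 hp.1).resolve_left hpX
    have hp' : IsPred χ R y p :=
      ⟨hpR, hp.2.1, fun k hk => hp.2.2 k (Finset.mem_union_right _ hk)⟩
    have hxp : pos χ x < pos χ p :=
      pos_lt_of_le_of_ne (hp.2.2 x (Finset.mem_union_left _ hx) hxy) fun h => hpX (h ▸ hx)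
    rw [(hF X).after hpX]
    rcases exists_isPred_or_forall χ R x with ⟨r, hr⟩ | hr
    · have hpr : p ≠ r := by
        rintro rfl
        have := hr.2.1
        omega
      rw [gapInsert_of_isPred hr, gapInsert_of_isPred (hxpred hr), h₂, gapInsert_of_isPred hp',
        Entries.after_comm _ hpr, (hF Y).after fun h => dYR h hr.1]
    · rw [gapInsert_of_forall hr, gapInsert_of_forall (hxnone hr), h₂, gapInsert_of_isPred hp']

/-- If an interval `V` inside an interval `U` of `S` can be removed from `S` and from `U`, and the
rest of `U` can be removed from the rest of `S`, then `U` can be removed from `S`. -/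
theorem gapInsert_trans {χ : Fin n → Side} {S U V : Finset (Fin n)} {v u : Fin n}
    (F : Finset (Fin n) → P.Entries χ → B) (hF : ∀ S, DependsOnlyOn S (F S))
    (hUS : U ⊆ S) (hVU : V ⊆ U) (hU : IsIntervalIn χ S U) (hv : v ∈ V) (hu : u ∈ U \ V)
    (h₁ : ∀ T, F S T = gapInsert (F (S \ V)) (S \ V) v (F V T) T)
    (h₂ : ∀ T, F U T = gapInsert (F (U \ V)) (U \ V) v (F V T) T)
    (h₃ : ∀ T, F (S \ V) T = gapInsert (F (S \ U)) (S \ U) u (F (U \ V) T) T) (T : P.Entries χ) :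
    F S T = gapInsert (F (S \ U)) (S \ U) u (F U T) T := by
  have hvU := hVU hv
  have huU := (Finset.mem_sdiff.1 hu).1
  have hcut : ∀ k ∈ S \ U, pos χ k < pos χ v ↔ pos χ k < pos χ u := by
    intro k hk
    rw [Finset.mem_sdiff] at hk
    exact ⟨hU.pos_lt_of_lt hvU huU hk.1 hk.2, hU.pos_lt_of_lt huU hvU hk.1 hk.2⟩
  rw [h₁, h₂]
  rcases exists_isPred_or_forall χ (S \ V) v with ⟨p, hp⟩ | hp
  · rw [gapInsert_of_isPred hp, h₃]
    have hpS := Finset.mem_sdiff.1 hp.1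
    -- If the entry before `V` is in `U`, both insertions take place inside `U`. If it is outside,
    -- `V` is the initial part of `U`, the value on `U` is a product, and its factors are inserted
    -- one after the other behind the same entry.
    by_cases hpU : p ∈ U
    · have hp' : IsPred χ (U \ V) v p := by
        refine ⟨by simp [hpU, hpS.2], hp.2.1, fun k hk => hp.2.2 k ?_⟩
        rw [Finset.mem_sdiff] at hk ⊢
        exact ⟨hUS hk.1, hk.2⟩
      rw [gapInsert_of_isPred hp', (hF _).gapInsert_after (by simp [hpU])]
    · have hpW : p ∈ S \ U := by simp [hpS.1, hpU]
      have hpu : IsPred χ (S \ U) u p := by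
        refine ⟨hpW, (hcut p hpW).1 hp.2.1, fun k hk hku => hp.2.2 k ?_ ((hcut k hk).2 hku)⟩
        rw [Finset.mem_sdiff] at hk ⊢
        exact ⟨hk.1, fun h => hk.2 (hVU h)⟩
      have hnone : ∀ k ∈ U \ V, pos χ v ≤ pos χ k := by
        intro k hk
        rw [Finset.mem_sdiff] at hk
        by_contra hkv
        have h1 := hp.2.2 k (by simp [hUS hk.1, hk.2]) (by omega)
        have h2 := hU.pos_lt_of_lt hvU hk.1 hpS.1 hpU hp.2.1
        omega
      rw [gapInsert_of_forall hnone, (hF (U \ V)).after (by simp [hpU]),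
        gapInsert_mul_of_isPred hpu]
  · have hnone : ∀ k ∈ U \ V, pos χ v ≤ pos χ k := by
      intro k hk
      rw [Finset.mem_sdiff] at hk
      exact hp k (by simp [hUS hk.1, hk.2])
    have hnone' : ∀ k ∈ S \ U, pos χ u ≤ pos χ k := by
      intro k hk
      have := hcut k hk
      rw [Finset.mem_sdiff] at hk
      have := hp k (Finset.mem_sdiff.2 ⟨hk.1, fun h => hk.2 (hVU h)⟩)
      omega
    rw [gapInsert_of_forall hp, h₃, gapInsert_of_forall hnone, gapInsert_of_forall hnone',
      gapInsert_of_forall hnone', mul_assoc]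

end NCPS

end BiFree

end

/-! ### The recursion for the moment function -/

noncomputable section

namespace BiFree

variable {n : ℕ}

namespace NCPS

section orderedProd

variable {A : Type*} [Ring A]

theorem orderedProd_congr {S : Finset (Fin n)} {T T' : Fin n → A} (h : ∀ k ∈ S, T k = T' k) :
    orderedProd S T = orderedProd S T' := by
  unfold orderedProd
  congr 1
  exact List.map_congr_left fun k hk => h k ((Finset.mem_sort _).1 hk)

theorem orderedProd_map {m : ℕ} (e : Fin m ↪o Fin n) (S : Finset (Fin m)) (T : Fin n → A) :
    orderedProd (S.map e.toEmbedding) T = orderedProd S fun k => T (e k) := by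
  unfold orderedProd
  rw [← Finset.map_sort e.toEmbedding S (· ≤ ·) (· ≤ ·) (by simp), List.map_map]
  rfl

theorem orderedProd_union {S S' : Finset (Fin n)} (h : ∀ a ∈ S, ∀ b ∈ S', a < b) (T : Fin n → A) :
    orderedProd (S ∪ S') T = orderedProd S T * orderedProd S' T := by
  unfold orderedProd
  rw [← List.prod_append, ← List.map_append]
  congr 2
  refine (Finset.sortedLT_sort _).eq_of_mem_iff ?_ (by simp)
  rw [List.sortedLT_iff_pairwise, List.pairwise_append]
  exact ⟨(Finset.sortedLT_sort S).pairwise, (Finset.sortedLT_sort S').pairwise, by simpa using h⟩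

@[simp] theorem orderedProd_singleton (k : Fin n) (T : Fin n → A) : orderedProd {k} T = T k := by
  simp [orderedProd]

@[simp] theorem orderedProd_empty (T : Fin n → A) : orderedProd ∅ T = 1 := by
  simp [orderedProd]

theorem orderedProd_insert_split {S : Finset (Fin n)} {k : Fin n} (hk : k ∉ S) (T : Fin n → A) :
    orderedProd (insert k S) T =
      orderedProd {j ∈ S | j < k} T * T k * orderedProd {j ∈ S | k < j} T := by
  have h : insert k S = ({j ∈ S | j < k} ∪ {k}) ∪ {j ∈ S | k < j} := by
    ext j
    simp only [Finset.mem_insert, Finset.mem_union, Finset.mem_filter, Finset.mem_singleton]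
    constructor
    · rintro (rfl | hj)
      · simp
      · rcases lt_trichotomy j k with h | h | h <;> simp [h, hj]
    · rintro ((h | h) | h) <;> simp [h]
  rw [h, orderedProd_union, orderedProd_union, orderedProd_singleton]
  · simp +contextual
  · intro a ha b hb
    simp only [Finset.mem_union, Finset.mem_filter, Finset.mem_singleton] at ha hb
    rcases ha with ha | rfl
    · exact ha.2.trans hb.2
    · exact hb.2

theorem orderedProd_split {S : Finset (Fin n)} {k : Fin n} (hk : k ∈ S) (T : Fin n → A) :
    orderedProd S T =
      orderedProd {j ∈ S | j < k} T * T k * orderedProd {j ∈ S | k < j} T := by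
  have := orderedProd_insert_split (Finset.notMem_erase k S) T
  rw [Finset.insert_erase hk] at this
  rw [this]
  congr 2
  · congr 1
    ext j
    simp only [Finset.mem_filter, Finset.mem_erase]
    exact ⟨fun h => ⟨h.1.2, h.2⟩, fun h => ⟨⟨h.2.ne, h.1⟩, h.2⟩⟩
  · ext j
    simp only [Finset.mem_filter, Finset.mem_erase]
    exact ⟨fun h => ⟨h.1.2, h.2⟩, fun h => ⟨⟨h.2.ne', h.1⟩, h.2⟩⟩

theorem orderedProd_commute {S : Finset (Fin n)} {T : Fin n → A} {X : A}
    (h : ∀ k ∈ S, Commute X (T k)) : Commute X (orderedProd S T) := by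
  unfold orderedProd
  apply Commute.list_prod_right
  intro x hx
  obtain ⟨k, hk, rfl⟩ := List.mem_map.1 hx
  exact h k ((Finset.mem_sort _).1 hk)

end orderedProd

variable {B A : Type*} [Ring B] [Algebra ℂ B] [Ring A] [Algebra ℂ A]

open Classical in
/-- The block of `v` within `S`. -/
def blockOf (π : Setoid (Fin n)) (S : Finset (Fin n)) (v : Fin n) : Finset (Fin n) :=
  S.filter fun j => π v j

@[simp] theorem mem_blockOf {π : Setoid (Fin n)} {S : Finset (Fin n)} {v j : Fin n} :
    j ∈ blockOf π S v ↔ j ∈ S ∧ π v j := by simp [blockOf]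

theorem mem_blockMins {π : Setoid (Fin n)} {S : Finset (Fin n)} {v : Fin n} :
    v ∈ blockMins π S ↔ v ∈ S ∧ ∀ j ∈ S, π v j → v ≤ j := by simp [blockMins]

/-- `v` is the largest minimum of a block of `π` within `S`. -/
def IsTopMin (π : Setoid (Fin n)) (S : Finset (Fin n)) (v : Fin n) : Prop :=
  IsGreatest (blockMins π S : Set (Fin n)) v

section IsTopMin

variable {π : Setoid (Fin n)} {S : Finset (Fin n)} {v : Fin n}

theorem exists_isTopMin (π : Setoid (Fin n)) (hS : S.Nonempty) : ∃ v, IsTopMin π S v :=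
  ⟨_, Finset.isGreatest_max' _ (blockMins_nonempty π hS)⟩

theorem IsTopMin.mem (h : IsTopMin π S v) : v ∈ S := (mem_blockMins.1 h.1).1

theorem IsTopMin.le_of_rel (h : IsTopMin π S v) {j : Fin n} (hj : j ∈ S) (hvj : π v j) : v ≤ j :=
  (mem_blockMins.1 h.1).2 j hj hvj

theorem exists_mem_blockMins {x : Fin n} (hx : x ∈ S) : ∃ u ∈ blockMins π S, π u x ∧ u ≤ x := by
  have hne : (blockOf π S x).Nonempty := ⟨x, by simp [hx]⟩
  have hm := mem_blockOf.1 ((blockOf π S x).min'_mem hne)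
  refine ⟨(blockOf π S x).min' hne, mem_blockMins.2 ⟨hm.1, fun j hj hjr => ?_⟩, π.symm hm.2, ?_⟩
  · exact Finset.min'_le _ _ (by simp [hj, π.trans hm.2 hjr])
  · exact Finset.min'_le _ _ (by simp [hx])

/-- Every other block has a smaller minimum, hence reaches above `v`. -/
theorem IsTopMin.exists_lt (h : IsTopMin π S v) {x : Fin n} (hx : x ∈ S) (hvx : ¬ π v x) :
    ∃ u ∈ S, u < v ∧ π u x := by
  obtain ⟨u, hu, hux, -⟩ := exists_mem_blockMins (π := π) hx
  refine ⟨u, (mem_blockMins.1 hu).1, lt_of_le_of_ne (h.2 hu) ?_, hux⟩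
  rintro rfl
  exact hvx hux

end IsTopMin

variable {P : NCPS B A} {χ : Fin n → Side} {π : Setoid (Fin n)} {S : Finset (Fin n)}
  {v w k : Fin n} {T : Fin n → A}

theorem isAdjacentSpine_unique {w' : Fin n} (h : IsAdjacentSpine χ π S v w)
    (h' : IsAdjacentSpine χ π S v w') : w = w' := by
  unfold IsAdjacentSpine at h h'
  cases hv : χ v <;> simp only [hv] at h h'
  · rcases h.2 _ h'.1 with h1 | h1
    · exact h1.symm
    · rcases h'.2 _ h.1 with h2 | h2
      · exact h2
      · rw [prec_iff] at h1 h2; omega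
  · rcases h.2 _ h'.1 with h1 | h1
    · exact h1.symm
    · rcases h'.2 _ h.1 with h2 | h2
      · exact h2
      · rw [prec_iff] at h1 h2; omega

theorem IsAdjacentSpine.mem (h : IsAdjacentSpine χ π S v w) : w ∈ S ∧ v < w ∧ ¬ π v w := by
  unfold IsAdjacentSpine at h
  cases hv : χ v <;> simp only [hv] at h <;> exact h.1

theorem isAdjacentSpine_l (hv : χ v = .l) : IsAdjacentSpine χ π S v w ↔
    (w ∈ S ∧ v < w ∧ ¬ π v w) ∧ ∀ j ∈ S, v < j → ¬ π v j → pos χ w ≤ pos χ j := by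
  simp only [IsAdjacentSpine, hv, IsPrecLeast, Set.mem_ofPred_eq, prec_iff]
  refine and_congr_right fun _ => ⟨fun h j hj hvj hr => ?_, fun h j hj => ?_⟩
  · rcases h j ⟨hj, hvj, hr⟩ with rfl | h
    · exact le_rfl
    · exact h.le
  · by_cases hjw : j = w
    · exact Or.inl hjw
    · exact Or.inr (pos_lt_of_le_of_ne (h j hj.1 hj.2.1 hj.2.2) (Ne.symm hjw))

theorem isAdjacentSpine_r (hv : χ v = .r) : IsAdjacentSpine χ π S v w ↔
    (w ∈ S ∧ v < w ∧ ¬ π v w) ∧ ∀ j ∈ S, v < j → ¬ π v j → pos χ j ≤ pos χ w := by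
  simp only [IsAdjacentSpine, hv, IsPrecGreatest, Set.mem_ofPred_eq, prec_iff]
  refine and_congr_right fun _ => ⟨fun h j hj hvj hr => ?_, fun h j hj => ?_⟩
  · rcases h j ⟨hj, hvj, hr⟩ with rfl | h
    · exact le_rfl
    · exact h.le
  · by_cases hjw : j = w
    · exact Or.inl hjw
    · exact Or.inr (pos_lt_of_le_of_ne (h j hj.1 hj.2.1 hj.2.2) hjw)

theorem exists_isAdjacentSpine (χ : Fin n → Side) {j : Fin n} (hj : j ∈ S) (hvj : v < j)
    (hr : ¬ π v j) : ∃ w, IsAdjacentSpine χ π S v w := by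
  classical
  have hne : (S.filter fun j => v < j ∧ ¬ π v j).Nonempty := ⟨j, by simp [*]⟩
  cases hv : χ v
  · obtain ⟨w, hw, hmin⟩ := Finset.exists_min_image _ (pos χ) hne
    refine ⟨w, (isAdjacentSpine_l hv).2 ⟨by simpa using hw, fun j hj hvj hr => ?_⟩⟩
    exact hmin j (by simp [*])
  · obtain ⟨w, hw, hmax⟩ := Finset.exists_max_image _ (pos χ) hne
    refine ⟨w, (isAdjacentSpine_r hv).2 ⟨by simpa using hw, fun j hj hvj hr => ?_⟩⟩
    exact hmax j (by simp [*])

theorem Epi_of_forall_rel (h : ∀ i ∈ S, ∀ j ∈ S, π i j) (T : Fin n → A) :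
    P.Epi χ π S T = P.E (orderedProd S T) := by
  rw [Epi, dif_pos h]

theorem coe_bop_congr {s s' : Side} (h : s = s') (b : B) : (P.bop s b : A) = P.bop s' b := by
  subst h
  rfl

/-- The recursion for `Epi` when the block that is removed consists of the last nodes. -/
theorem Epi_of_last (hS : ¬ ∀ i ∈ S, ∀ j ∈ S, π i j) (hv : IsTopMin π S v)
    (hl : ∀ j ∈ S, v < j → π v j) (hk : IsGreatest {j | j ∈ S ∧ j < v} k) (T : Fin n → A) :
    P.Epi χ π S T = P.Epi χ π (S \ blockOf π S v) (Function.update T k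
      (T k * (P.bop (χ v) (P.E (orderedProd (blockOf π S v) T)) : A))) := by
  rw [Epi, dif_neg hS]
  have hne : (blockMins π S).Nonempty := ⟨v, hv.1⟩
  obtain rfl := hv.unique (Finset.isGreatest_max' _ hne)
  dsimp only
  rw [if_pos (by simpa +contextual using hl)]
  unfold blockOf
  congr 1
  funext j
  by_cases hj : j = k
  · subst hj
    rw [if_pos hk, Function.update_self]
  · rw [if_neg (fun h => hj (h.unique hk)), Function.update_of_ne hj]

/-- The recursion for `Epi` when there is an adjacent spine. -/
theorem Epi_of_isAdjacentSpine (hS : ¬ ∀ i ∈ S, ∀ j ∈ S, π i j) (hv : IsTopMin π S v)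
    (hw : IsAdjacentSpine χ π S v w) (hk : IsLeast {j | j ∈ S ∧ π w j ∧ v < j} k) (T : Fin n → A) :
    P.Epi χ π S T = P.Epi χ π (S \ blockOf π S v) (Function.update T k
      ((P.bop (χ v) (P.E (orderedProd (blockOf π S v) T)) : A) * T k)) := by
  rw [Epi, dif_neg hS]
  have hne : (blockMins π S).Nonempty := ⟨v, hv.1⟩
  obtain rfl := hv.unique (Finset.isGreatest_max' _ hne)
  dsimp only
  rw [if_neg (by
    push Not
    exact ⟨w, hw.mem.1, hw.mem.2.1, by simpa using fun _ => hw.mem.2.2⟩)]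
  unfold blockOf
  congr 1
  funext j
  by_cases hj : j = k
  · subst hj
    rw [if_pos ⟨w, hw, hk⟩, Function.update_self]
  · rw [if_neg, Function.update_of_ne hj]
    rintro ⟨w', hw', hj'⟩
    obtain rfl := isAdjacentSpine_unique hw hw'
    exact hj (hj'.unique hk)

theorem exists_isGreatest_lt {y : Fin n} (hy : y ∈ S) (hyv : y < v) :
    ∃ k, IsGreatest {j | j ∈ S ∧ j < v} k := by
  have hne : (S.filter (· < v)).Nonempty := ⟨y, by simp [*]⟩
  have := (S.filter (· < v)).isGreatest_max' hne
  exact ⟨_, by simpa using this⟩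

theorem exists_isLeast_rel {y : Fin n} (hy : y ∈ S) (hwy : π w y) (hyv : v < y) :
    ∃ k, IsLeast {j | j ∈ S ∧ π w j ∧ v < j} k := by
  classical
  have hne : (S.filter fun j => π w j ∧ v < j).Nonempty := ⟨y, by simp [*]⟩
  have := (S.filter fun j => π w j ∧ v < j).isLeast_min' hne
  exact ⟨_, by simpa using this⟩

/-- The two cases of the recursion for `Epi`. -/
theorem exists_Epi_step (χ : Fin n → Side) (hS : ¬ ∀ i ∈ S, ∀ j ∈ S, π i j)
    (hv : IsTopMin π S v) :
    ((∀ j ∈ S, v < j → π v j) ∧ ∃ k, IsGreatest {j | j ∈ S ∧ j < v} k) ∨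
      ∃ w k, IsAdjacentSpine χ π S v w ∧ IsLeast {j | j ∈ S ∧ π w j ∧ v < j} k := by
  by_cases h : ∀ j ∈ S, v < j → π v j
  · refine Or.inl ⟨h, ?_⟩
    have : ∃ y ∈ S, ¬ π v y := by
      by_contra! hc
      exact hS fun i hi j hj => π.trans (π.symm (hc i hi)) (hc j hj)
    obtain ⟨y, hy, hvy⟩ := this
    obtain ⟨u, hu, huv, -⟩ := hv.exists_lt hy hvy
    exact exists_isGreatest_lt hu huv
  · push Not at h
    obtain ⟨j, hj, hvj, hr⟩ := h
    obtain ⟨w, hw⟩ := exists_isAdjacentSpine χ hj hvj hr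
    obtain ⟨k, hk⟩ := exists_isLeast_rel hw.mem.1 (π.refl w) hw.mem.2.1
    exact Or.inr ⟨w, k, hw, hk⟩

theorem card_sdiff_blockOf_lt (hv : v ∈ S) : (S \ blockOf π S v).card < S.card :=
  Finset.card_lt_card ⟨Finset.sdiff_subset, fun h =>
    (Finset.mem_sdiff.1 (h hv)).2 (by simp [hv])⟩

/-- `Epi` is compatible with order embeddings of the nodes. -/
theorem Epi_map {m : ℕ} (e : Fin m ↪o Fin n) (χ : Fin n → Side) (χ' : Fin m → Side)
    (π : Setoid (Fin n)) (π' : Setoid (Fin m)) :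
    ∀ (S : Finset (Fin m)) (T : Fin n → A) (T' : Fin m → A),
      (∀ i ∈ S, χ' i = χ (e i)) → (∀ i ∈ S, ∀ j ∈ S, π' i j ↔ π (e i) (e j)) →
      (∀ i ∈ S, T' i = T (e i)) → P.Epi χ' π' S T' = P.Epi χ π (S.map e.toEmbedding) T := by
  intro S
  induction h : S.card using Nat.strong_induction_on generalizing S with
  | _ c ih =>
  subst h
  intro T T' hχ hπ hT
  -- The numerical positions depend on the number of nodes, but their comparison goes through
  -- `Prec`, which sees only the sides and the order of the labels.
  have hpos : ∀ i ∈ S, ∀ j ∈ S, pos χ' i ≤ pos χ' j ↔ pos χ (e i) ≤ pos χ (e j) := by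
    intro i hi j hj
    rw [← not_lt, ← not_lt, ← prec_iff, ← prec_iff]
    unfold Prec
    rw [hχ i hi, hχ j hj]
    cases χ (e i) <;> cases χ (e j) <;> simp
  by_cases hS : ∀ i ∈ S, ∀ j ∈ S, π' i j
  · rw [Epi_of_forall_rel hS, Epi_of_forall_rel, orderedProd_map]
    · rw [orderedProd_congr hT]
    · simp only [Finset.mem_map, RelEmbedding.coe_toEmbedding]
      rintro _ ⟨i, hi, rfl⟩ _ ⟨j, hj, rfl⟩
      exact (hπ i hi j hj).1 (hS i hi j hj)
  · have hS' : ¬ ∀ i ∈ S.map e.toEmbedding, ∀ j ∈ S.map e.toEmbedding, π i j := by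
      intro hc
      exact hS fun i hi j hj => (hπ i hi j hj).2
        (hc _ (Finset.mem_map_of_mem _ hi) _ (Finset.mem_map_of_mem _ hj))
    have hne : S.Nonempty := by
      by_contra hne
      simp [Finset.not_nonempty_iff_eq_empty.1 hne] at hS
    obtain ⟨v, hv⟩ := exists_isTopMin π' hne
    have hvS := hv.mem
    have hmins : blockMins π (S.map e.toEmbedding) = (blockMins π' S).map e.toEmbedding := by
      ext x
      simp only [mem_blockMins, Finset.mem_map, RelEmbedding.coe_toEmbedding]
      constructor
      · rintro ⟨⟨i, hi, rfl⟩, h⟩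
        exact ⟨i, ⟨hi, fun j hj hij => e.le_iff_le.1 (h _ ⟨j, hj, rfl⟩ ((hπ i hi j hj).1 hij))⟩,
          rfl⟩
      · rintro ⟨i, ⟨hi, h⟩, rfl⟩
        refine ⟨⟨i, hi, rfl⟩, ?_⟩
        rintro _ ⟨j, hj, rfl⟩ hij
        exact e.le_iff_le.2 (h j hj ((hπ i hi j hj).2 hij))
    have hev : IsTopMin π (S.map e.toEmbedding) (e v) := by
      refine ⟨by rw [hmins]; exact Finset.mem_map_of_mem _ hv.1, ?_⟩
      rw [hmins]
      intro x hx
      obtain ⟨i, hi, rfl⟩ := Finset.mem_map.1 (Finset.mem_coe.1 hx)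
      exact e.le_iff_le.2 (hv.2 hi)
    have hblock : blockOf π (S.map e.toEmbedding) (e v) =
        (blockOf π' S v).map e.toEmbedding := by
      ext x
      simp only [mem_blockOf, Finset.mem_map, RelEmbedding.coe_toEmbedding]
      constructor
      · rintro ⟨⟨i, hi, rfl⟩, h⟩
        exact ⟨i, ⟨hi, (hπ v hvS i hi).2 h⟩, rfl⟩
      · rintro ⟨i, ⟨hi, h⟩, rfl⟩
        exact ⟨⟨i, hi, rfl⟩, (hπ v hvS i hi).1 h⟩
    have hb : P.E (orderedProd (blockOf π (S.map e.toEmbedding) (e v)) T) =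
        P.E (orderedProd (blockOf π' S v) T') := by
      rw [hblock, orderedProd_map]
      exact congrArg _ (orderedProd_congr fun k hk => (hT k (mem_blockOf.1 hk).1).symm)
    have hrest : S.map e.toEmbedding \ blockOf π (S.map e.toEmbedding) (e v) =
        (S \ blockOf π' S v).map e.toEmbedding := by
      rw [hblock, Finset.map_sdiff]
    have hsub : ∀ i ∈ S \ blockOf π' S v, i ∈ S := fun i hi => (Finset.mem_sdiff.1 hi).1
    rcases exists_Epi_step χ' hS hv with ⟨hl, k, hk⟩ | ⟨w, k, hw, hk⟩
    · have hk' : IsGreatest {j | j ∈ S.map e.toEmbedding ∧ j < e v} (e k) := by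
        refine ⟨⟨Finset.mem_map_of_mem _ hk.1.1, e.lt_iff_lt.2 hk.1.2⟩, ?_⟩
        rintro x ⟨hx, hxv⟩
        obtain ⟨i, hi, rfl⟩ := Finset.mem_map.1 hx
        exact e.le_iff_le.2 (hk.2 ⟨hi, e.lt_iff_lt.1 hxv⟩)
      have hl' : ∀ j ∈ S.map e.toEmbedding, e v < j → π (e v) j := by
        intro x hx hxv
        obtain ⟨i, hi, rfl⟩ := Finset.mem_map.1 hx
        exact (hπ v hvS i hi).1 (hl i hi (e.lt_iff_lt.1 hxv))
      rw [Epi_of_last hS hv hl hk, Epi_of_last hS' hev hl' hk', hrest, hb]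
      refine ih _ (card_sdiff_blockOf_lt hvS) _ rfl _ _ (fun i hi => hχ i (hsub i hi))
        (fun i hi j hj => hπ i (hsub i hi) j (hsub j hj)) fun i hi => ?_
      by_cases hik : i = k
      · subst hik
        simp only [Function.update_self, hT i hk.1.1, coe_bop_congr (hχ v hvS)]
      · rw [Function.update_of_ne hik, Function.update_of_ne (e.injective.ne hik),
          hT i (hsub i hi)]
    · have hwS := hw.mem
      have hw' : IsAdjacentSpine χ π (S.map e.toEmbedding) (e v) (e w) := by
        have h1 : e w ∈ S.map e.toEmbedding ∧ e v < e w ∧ ¬ π (e v) (e w) :=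
          ⟨Finset.mem_map_of_mem _ hwS.1, e.lt_iff_lt.2 hwS.2.1,
            fun h => hwS.2.2 ((hπ v hvS w hwS.1).2 h)⟩
        have hχv := hχ v hvS
        cases hs : χ' v
        · rw [isAdjacentSpine_l hs] at hw
          rw [isAdjacentSpine_l (hχv ▸ hs)]
          refine ⟨h1, fun j hj hvj hr => ?_⟩
          obtain ⟨i, hi, rfl⟩ := Finset.mem_map.1 hj
          exact (hpos w hwS.1 i hi).1
            (hw.2 i hi (e.lt_iff_lt.1 hvj) fun h => hr ((hπ v hvS i hi).1 h))
        · rw [isAdjacentSpine_r hs] at hw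
          rw [isAdjacentSpine_r (hχv ▸ hs)]
          refine ⟨h1, fun j hj hvj hr => ?_⟩
          obtain ⟨i, hi, rfl⟩ := Finset.mem_map.1 hj
          exact (hpos i hi w hwS.1).1
            (hw.2 i hi (e.lt_iff_lt.1 hvj) fun h => hr ((hπ v hvS i hi).1 h))
      have hk' : IsLeast {j | j ∈ S.map e.toEmbedding ∧ π (e w) j ∧ e v < j} (e k) := by
        refine ⟨⟨Finset.mem_map_of_mem _ hk.1.1, (hπ w hwS.1 k hk.1.1).1 hk.1.2.1,
          e.lt_iff_lt.2 hk.1.2.2⟩, ?_⟩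
        rintro x ⟨hx, hwx, hxv⟩
        obtain ⟨i, hi, rfl⟩ := Finset.mem_map.1 hx
        exact e.le_iff_le.2 (hk.2 ⟨hi, (hπ w hwS.1 i hi).2 hwx, e.lt_iff_lt.1 hxv⟩)
      rw [Epi_of_isAdjacentSpine hS hv hw hk, Epi_of_isAdjacentSpine hS' hev hw' hk', hrest, hb]
      refine ih _ (card_sdiff_blockOf_lt hvS) _ rfl _ _ (fun i hi => hχ i (hsub i hi))
        (fun i hi j hj => hπ i (hsub i hi) j (hsub j hj)) fun i hi => ?_
      by_cases hik : i = k
      · subst hik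
        simp only [Function.update_self, hT i hk.1.1, coe_bop_congr (hχ v hvS)]
      · rw [Function.update_of_ne hik, Function.update_of_ne (e.injective.ne hik),
          hT i (hsub i hi)]

theorem Epi_congr {π' : Setoid (Fin n)} {T' : Fin n → A} (hπ : ∀ i ∈ S, ∀ j ∈ S, π i j ↔ π' i j)
    (hT : ∀ i ∈ S, T i = T' i) : P.Epi χ π S T = P.Epi χ π' S T' := by
  have := Epi_map (P := P) (RelEmbedding.refl _) χ χ π' π S T' T (fun _ _ => rfl) hπ hT
  rw [this]
  congr 1
  exact Finset.map_refl

end NCPS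

end BiFree

end

/-! ### Nodes absorbed into a block -/

noncomputable section

namespace BiFree

variable {n : ℕ}

namespace NCPS

section orderedProd

variable {A : Type*} [Ring A]

theorem orderedProd_update_of_notMem {S : Finset (Fin n)} {k : Fin n} (hk : k ∉ S)
    (T : Fin n → A) (X : A) : orderedProd S (Function.update T k X) = orderedProd S T :=
  orderedProd_congr fun _ hj => Function.update_of_ne (ne_of_mem_of_not_mem hj hk) _ _

theorem orderedProd_update_least {S : Finset (Fin n)} {k : Fin n}
    (hk : IsLeast (S : Set (Fin n)) k) (T : Fin n → A) (C : A) :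
    orderedProd S (Function.update T k (C * T k)) = C * orderedProd S T := by
  have h : {j ∈ S | j < k} = ∅ := by
    ext j
    simp only [Finset.mem_filter, Finset.notMem_empty, iff_false, not_and, not_lt]
    exact fun hj => hk.2 hj
  rw [orderedProd_split hk.1, orderedProd_split hk.1, h, Function.update_self, orderedProd_empty,
    orderedProd_empty, orderedProd_update_of_notMem (by simp)]
  simp [mul_assoc]

theorem orderedProd_update_greatest {S : Finset (Fin n)} {k : Fin n}
    (hk : IsGreatest (S : Set (Fin n)) k) (T : Fin n → A) (C : A) :
    orderedProd S (Function.update T k (T k * C)) = orderedProd S T * C := by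
  have h : {j ∈ S | k < j} = ∅ := by
    ext j
    simp only [Finset.mem_filter, Finset.notMem_empty, iff_false, not_and, not_lt]
    exact fun hj => hk.2 hj
  rw [orderedProd_split hk.1, orderedProd_split hk.1, h, Function.update_self,
    orderedProd_update_of_notMem (by simp)]
  simp [mul_assoc]

theorem orderedProd_eq_lt_mul_gt {S : Finset (Fin n)} {v : Fin n} (hv : v ∉ S) (T : Fin n → A) :
    orderedProd S T = orderedProd {j ∈ S | j < v} T * orderedProd {j ∈ S | v < j} T := by
  rw [← orderedProd_union]
  · congr 1
    ext j
    simp only [Finset.mem_union, Finset.mem_filter, ← and_or_left]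
    exact ⟨fun hj => ⟨hj, lt_or_gt_of_ne (ne_of_mem_of_not_mem hj hv)⟩, fun h => h.1⟩
  · intro a ha b hb
    exact (Finset.mem_filter.1 ha).2.trans (Finset.mem_filter.1 hb).2

end orderedProd

/-- The partition obtained from `π` by moving `v` into the block of `w`. -/
def joinNode (π : Setoid (Fin n)) (v w : Fin n) : Setoid (Fin n) :=
  π.comap (Function.update id v w)

section joinNode

variable {π : Setoid (Fin n)} {v w a b : Fin n}

theorem joinNode_def : joinNode π v w a b ↔
    π (Function.update id v w a) (Function.update id v w b) := Iff.rfl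

theorem joinNode_of_ne (ha : a ≠ v) (hb : b ≠ v) : joinNode π v w a b ↔ π a b := by
  simp [joinNode_def, ha, hb]

theorem joinNode_left (hb : b ≠ v) : joinNode π v w v b ↔ π w b := by
  simp [joinNode_def, hb]

theorem joinNode_right (ha : a ≠ v) : joinNode π v w a v ↔ π a w := by
  simp [joinNode_def, ha]

end joinNode

section IsNodeAbsorbed

variable {A : Type*} [Ring A] {π : Setoid (Fin n)}

/-- `T'` arises from the entries `T` by multiplying `C` into the block of `w` at the height of the
node `v ∉ S`. -/
def IsNodeAbsorbed (π : Setoid (Fin n)) (S : Finset (Fin n)) (v w : Fin n) (C : A)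
    (T T' : Fin n → A) : Prop :=
  -- If the block of `w` continues below `v`, the factor goes to the left of its first such node; if
  -- the whole block is above `v`, it goes to the right of its last node.
  (∃ k, IsLeast {j | j ∈ S ∧ π w j ∧ v < j} k ∧ T' = Function.update T k (C * T k)) ∨
  ((∀ j ∈ S, π w j → j < v) ∧
    ∃ k, IsGreatest {j | j ∈ S ∧ π w j} k ∧ T' = Function.update T k (T k * C))

theorem IsNodeAbsorbed.of_not_rel {S : Finset (Fin n)} {v w : Fin n} {C : A} {T T' : Fin n → A}
    (h : IsNodeAbsorbed π S v w C T T') {j : Fin n} (hj : ¬ π w j) : T' j = T j := by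
  rcases h with ⟨k, hk, rfl⟩ | ⟨-, k, hk, rfl⟩
  · exact Function.update_of_ne (by rintro rfl; exact hj hk.1.2.1) _ _
  · exact Function.update_of_ne (by rintro rfl; exact hj hk.1.2) _ _

/-- In both cases of `IsNodeAbsorbed` the factor `C` ends up between the entries above `v` and those
below `v`, which is where an entry at `v` would stand. -/
theorem orderedProd_insert_node {S : Finset (Fin n)} {v w : Fin n} {C : A} {T T' : Fin n → A}
    (hv : v ∉ S) (h : IsNodeAbsorbed π S v w C T T') (hS : ∀ j ∈ S, π w j) :
    orderedProd S T' = orderedProd (insert v S) (Function.update T v C) := by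
  rw [orderedProd_insert_split hv, Function.update_self,
    orderedProd_update_of_notMem (by simp), orderedProd_update_of_notMem (by simp)]
  rcases h with ⟨k, hk, rfl⟩ | ⟨hl, k, hk, rfl⟩
  · rw [orderedProd_eq_lt_mul_gt hv, orderedProd_update_of_notMem, orderedProd_update_least,
      mul_assoc]
    · refine ⟨by simpa using ⟨hk.1.1, hk.1.2.2⟩, fun j hj => ?_⟩
      simp only [Finset.coe_filter, Set.mem_ofPred_eq] at hj
      exact hk.2 ⟨hj.1, hS j hj.1, hj.2⟩
    · simp [hk.1.2.2.le]
  · have h1 : {j ∈ S | j < v} = S := Finset.filter_true_of_mem fun j hj => hl j hj (hS j hj)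
    have h2 : {j ∈ S | v < j} = ∅ :=
      Finset.filter_false_of_mem fun j hj => (hl j hj (hS j hj)).le.not_gt
    rw [h1, h2, orderedProd_update_greatest]
    · simp
    · exact ⟨hk.1.1, fun j hj => hk.2 ⟨hj, hS j hj⟩⟩

/-- Multiplying by `1` changes nothing, so a joined node carrying the entry `1` may be dropped. -/
theorem IsNodeAbsorbed.one {S : Finset (Fin n)} {v w : Fin n} {C : A} {T T' : Fin n → A}
    (h : IsNodeAbsorbed π S v w C T T') (T₁ : Fin n → A) :
    IsNodeAbsorbed π S v w 1 T₁ T₁ := by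
  rcases h with ⟨k, hk, -⟩ | ⟨hl, k, hk, -⟩
  · exact Or.inl ⟨k, hk, by simp⟩
  · exact Or.inr ⟨hl, k, hk, by simp⟩

end IsNodeAbsorbed

variable {B A : Type*} [Ring B] [Algebra ℂ B] [Ring A] [Algebra ℂ A]

variable {P : NCPS B A} {χ : Fin n → Side} {π : Setoid (Fin n)}

/-- The spine adjacent to `u` does not change, up to the block it belongs to, when a node `v` is
added next to the node `w`. -/
theorem exists_isAdjacentSpine_insert {S : Finset (Fin n)} {u v w z : Fin n} (hvS : v ∉ S)
    (hwS : w ∈ S)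
    (hadj : ∀ x ∈ S, ¬ (pos χ v < pos χ x ∧ pos χ x < pos χ w) ∧
      ¬ (pos χ w < pos χ x ∧ pos χ x < pos χ v))
    (huv : u < v) (huw : u < w) (hr : ¬ π u w) (hz : IsAdjacentSpine χ π S u z) :
    IsAdjacentSpine χ (joinNode π v w) (insert v S) u z ∨
      (z = w ∧ IsAdjacentSpine χ (joinNode π v w) (insert v S) u v) := by
  have hu : u ≠ v := huv.ne
  have hzS := hz.mem
  have hzv : z ≠ v := ne_of_mem_of_not_mem hzS.1 hvS
  have hz1 : z ∈ insert v S ∧ u < z ∧ ¬ joinNode π v w u z :=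
    ⟨Finset.mem_insert_of_mem hzS.1, hzS.2.1, fun h => hzS.2.2 ((joinNode_of_ne hu hzv).1 h)⟩
  have hv1 : v ∈ insert v S ∧ u < v ∧ ¬ joinNode π v w u v :=
    ⟨Finset.mem_insert_self _ _, huv, fun h => hr ((joinNode_right hu).1 h)⟩
  have hjS : ∀ j ∈ insert v S, j ≠ v → ¬ joinNode π v w u j → j ∈ S ∧ ¬ π u j := by
    intro j hj hjv hjr
    exact ⟨(Finset.mem_insert.1 hj).resolve_left hjv,
      fun h => hjr ((joinNode_of_ne hu hjv).2 h)⟩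
  cases hs : χ u
  · rw [isAdjacentSpine_l hs] at hz
    rw [isAdjacentSpine_l hs, isAdjacentSpine_l hs]
    -- The node `v` takes over as extremal node only by overtaking `z`. Since `w` is also a
    -- candidate, `z` would then separate `v` from `w`, unless `z = w`.
    rcases lt_or_ge (pos χ v) (pos χ z) with h | h
    · refine Or.inr ⟨?_, hv1, fun j hj hlt hjr => ?_⟩
      · by_contra hne
        exact (hadj z hzS.1).1 ⟨h, pos_lt_of_le_of_ne (hz.2 w hwS huw hr) hne⟩
      · by_cases hjv : j = v
        · rw [hjv]
        · have := hjS j hj hjv hjr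
          exact h.le.trans (hz.2 j this.1 hlt this.2)
    · refine Or.inl ⟨hz1, fun j hj hlt hjr => ?_⟩
      by_cases hjv : j = v
      · rwa [hjv]
      · have := hjS j hj hjv hjr
        exact hz.2 j this.1 hlt this.2
  · rw [isAdjacentSpine_r hs] at hz
    rw [isAdjacentSpine_r hs, isAdjacentSpine_r hs]
    rcases lt_or_ge (pos χ z) (pos χ v) with h | h
    · refine Or.inr ⟨?_, hv1, fun j hj hlt hjr => ?_⟩
      · by_contra hne
        exact (hadj z hzS.1).2 ⟨pos_lt_of_le_of_ne (hz.2 w hwS huw hr) (Ne.symm hne), h⟩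
      · by_cases hjv : j = v
        · rw [hjv]
        · have := hjS j hj hjv hjr
          exact (hz.2 j this.1 hlt this.2).trans h.le
    · refine Or.inl ⟨hz1, fun j hj hlt hjr => ?_⟩
      by_cases hjv : j = v
      · rwa [hjv]
      · have := hjS j hj hjv hjr
        exact hz.2 j this.1 hlt this.2

theorem blockMins_sdiff_blockOf {S : Finset (Fin n)} {u x : Fin n}
    (hx : x ∈ blockMins π (S \ blockOf π S u)) : x ∈ blockMins π S ∧ ¬ π u x := by
  rw [mem_blockMins] at hx
  have hxS := Finset.mem_sdiff.1 hx.1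
  have hux : ¬ π u x := fun h => hxS.2 (mem_blockOf.2 ⟨hxS.1, h⟩)
  refine ⟨mem_blockMins.2 ⟨hxS.1, fun j hj hxj => hx.2 j ?_ hxj⟩, hux⟩
  exact Finset.mem_sdiff.2 ⟨hj, fun h => hux (π.trans (mem_blockOf.1 h).2 (π.symm hxj))⟩

/-- An element `C` multiplied into the block of `w` at the height of `v` may be regarded as the entry
of an additional node `v`, next to `w`, in this block. -/
theorem Epi_insert_node {v w : Fin n} :
    ∀ (S : Finset (Fin n)) (T T' : Fin n → A) (C : A), v ∉ S → w ∈ S →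
      (∀ x ∈ S, ¬ (pos χ v < pos χ x ∧ pos χ x < pos χ w) ∧
        ¬ (pos χ w < pos χ x ∧ pos χ x < pos χ v)) →
      (∀ u ∈ blockMins π S, u < v ∧ (¬ π u w → u < w)) →
      IsNodeAbsorbed π S v w C T T' →
      P.Epi χ π S T' = P.Epi χ (joinNode π v w) (insert v S) (Function.update T v C) := by
  intro S
  induction h : S.card using Nat.strong_induction_on generalizing S with
  | _ c ih =>
  subst h
  intro T T' C hvS hwS hadj hmin hT
  have hne : ∀ {j}, j ∈ S → j ≠ v := fun hj => ne_of_mem_of_not_mem hj hvS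
  by_cases hS : ∀ i ∈ S, ∀ j ∈ S, π i j
  · rw [Epi_of_forall_rel hS, Epi_of_forall_rel, orderedProd_insert_node hvS hT (hS w hwS)]
    intro i hi j hj
    rw [joinNode_def]
    refine hS _ ?_ _ ?_
    · by_cases h : i = v
      · simp [h, hwS]
      · simpa [h] using hi
    · by_cases h : j = v
      · simp [h, hwS]
      · simpa [h] using hj
  set π' := joinNode π v w
  have hS' : ¬ ∀ i ∈ insert v S, ∀ j ∈ insert v S, π' i j := fun hc => hS fun i hi j hj =>
    (joinNode_of_ne (hne hi) (hne hj)).1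
      (hc i (Finset.mem_insert_of_mem hi) j (Finset.mem_insert_of_mem hj))
  obtain ⟨u, hu⟩ := exists_isTopMin π ⟨w, hwS⟩
  have huS := hu.mem
  have huv : u < v := (hmin u hu.1).1
  -- All blocks, including that of `w`, start above `v`, so `v` is not a minimum and the recursion
  -- removes the block of the same `u` on both sides.
  have hmins : blockMins π' (insert v S) = blockMins π S := by
    ext x
    rw [mem_blockMins, mem_blockMins]
    constructor
    · rintro ⟨hx, hx'⟩
      have hxv : x ≠ v := by
        rintro rfl
        obtain ⟨y, hy, hyw, -⟩ := exists_mem_blockMins (π := π) hwS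
        have hy' := mem_blockMins.1 hy
        have := hx' y (Finset.mem_insert_of_mem hy'.1)
          ((joinNode_left (hne hy'.1)).2 (π.symm hyw))
        exact absurd (hmin y hy).1 (not_lt.2 this)
      have hxS := (Finset.mem_insert.1 hx).resolve_left hxv
      exact ⟨hxS, fun j hj hxj => hx' j (Finset.mem_insert_of_mem hj)
        ((joinNode_of_ne hxv (hne hj)).2 hxj)⟩
    · rintro ⟨hx, hx'⟩
      refine ⟨Finset.mem_insert_of_mem hx, fun j hj hxj => ?_⟩
      rcases Finset.mem_insert.1 hj with rfl | hj
      · exact ((hmin x (mem_blockMins.2 ⟨hx, hx'⟩)).1).le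
      · exact hx' j hj ((joinNode_of_ne (hne hx) (hne hj)).1 hxj)
  have hu' : IsTopMin π' (insert v S) u := by rw [IsTopMin, hmins]; exact hu
  by_cases huw : π u w
  · -- the block of `w` is the one that is removed
    have hblock : blockOf π' (insert v S) u = insert v (blockOf π S u) := by
      ext x
      simp only [mem_blockOf, Finset.mem_insert]
      by_cases hx : x = v
      · subst hx
        simp [joinNode_right (hne huS), huw]
      · simp [hx, joinNode_of_ne (hne huS) hx]
    have hrest : insert v S \ blockOf π' (insert v S) u = S \ blockOf π S u := by
      rw [hblock]
      ext x
      simp only [Finset.mem_sdiff, Finset.mem_insert, mem_blockOf]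
      by_cases hx : x = v
      · subst hx; simp [hvS]
      · simp [hx]
    have hwu : ∀ {j}, π w j ↔ π u j := ⟨fun h => π.trans huw h, fun h => π.trans (π.symm huw) h⟩
    have hb : orderedProd (blockOf π S u) T' =
        orderedProd (blockOf π' (insert v S) u) (Function.update T v C) := by
      rw [hblock]
      refine orderedProd_insert_node (π := π) (w := w) (by simp [hvS]) ?_
        (fun j hj => hwu.2 (mem_blockOf.1 hj).2)
      rcases hT with ⟨k, hk, rfl⟩ | ⟨hl, k, hk, rfl⟩
      · refine Or.inl ⟨k, ⟨⟨?_, hk.1.2⟩, fun j hj => hk.2 ?_⟩, rfl⟩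
        · exact mem_blockOf.2 ⟨hk.1.1, hwu.1 hk.1.2.1⟩
        · exact ⟨(mem_blockOf.1 hj.1).1, hj.2⟩
      · refine Or.inr ⟨fun j hj => hl j (mem_blockOf.1 hj).1, k, ⟨⟨?_, hk.1.2⟩,
          fun j hj => hk.2 ?_⟩, rfl⟩
        · exact mem_blockOf.2 ⟨hk.1.1, hwu.1 hk.1.2⟩
        · exact ⟨(mem_blockOf.1 hj.1).1, hj.2⟩
    have hπr : ∀ i ∈ S \ blockOf π S u, ∀ j ∈ S \ blockOf π S u, π i j ↔ π' i j :=
      fun i hi j hj => (joinNode_of_ne (hne (Finset.mem_sdiff.1 hi).1)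
        (hne (Finset.mem_sdiff.1 hj).1)).symm
    have hTr : ∀ i ∈ S \ blockOf π S u, T' i = Function.update T v C i := by
      intro i hi
      rw [Finset.mem_sdiff, mem_blockOf] at hi
      rw [Function.update_of_ne (hne hi.1),
        hT.of_not_rel fun h => hi.2 ⟨hi.1, hwu.1 h⟩]
    rcases exists_Epi_step χ hS hu with ⟨hl, k, hk⟩ | ⟨z, k, hz, hk⟩
    · rw [Epi_of_last hS hu hl hk, Epi_of_last (k := k) hS' hu', hrest, hb]
      · refine Epi_congr hπr fun i hi => ?_
        by_cases hik : i = k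
        · subst hik
          simp only [Function.update_self, hTr i hi]
        · rw [Function.update_of_ne hik, Function.update_of_ne hik, hTr i hi]
      · intro j hj hlt
        rcases Finset.mem_insert.1 hj with rfl | hj
        · exact (joinNode_right (hne huS)).2 huw
        · exact (joinNode_of_ne (hne huS) (hne hj)).2 (hl j hj hlt)
      · refine ⟨⟨Finset.mem_insert_of_mem hk.1.1, hk.1.2⟩, fun j hj => ?_⟩
        rcases Finset.mem_insert.1 hj.1 with rfl | hj'
        · exact absurd hj.2 huv.not_gt
        · exact hk.2 ⟨hj', hj.2⟩
    · have hzS := hz.mem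
      have hz' : IsAdjacentSpine χ π' (insert v S) u z := by
        have h1 : z ∈ insert v S ∧ u < z ∧ ¬ π' u z :=
          ⟨Finset.mem_insert_of_mem hzS.1, hzS.2.1,
            fun h => hzS.2.2 ((joinNode_of_ne (hne huS) (hne hzS.1)).1 h)⟩
        have h2 : ∀ j ∈ insert v S, ¬ π' u j → j ∈ S ∧ ¬ π u j := by
          intro j hj hr
          rcases Finset.mem_insert.1 hj with rfl | hj
          · exact absurd ((joinNode_right (hne huS)).2 huw) hr
          · exact ⟨hj, fun h => hr ((joinNode_of_ne (hne huS) (hne hj)).2 h)⟩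
        cases hs : χ u
        · rw [isAdjacentSpine_l hs] at hz ⊢
          exact ⟨h1, fun j hj hlt hr => hz.2 j (h2 j hj hr).1 hlt (h2 j hj hr).2⟩
        · rw [isAdjacentSpine_r hs] at hz ⊢
          exact ⟨h1, fun j hj hlt hr => hz.2 j (h2 j hj hr).1 hlt (h2 j hj hr).2⟩
      rw [Epi_of_isAdjacentSpine hS hu hz hk, Epi_of_isAdjacentSpine (k := k) hS' hu' hz', hrest,
        hb]
      · have hkr : k ∈ S \ blockOf π S u := by
          rw [Finset.mem_sdiff, mem_blockOf]
          exact ⟨hk.1.1, fun h => hzS.2.2 (π.trans h.2 (π.symm hk.1.2.1))⟩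
        refine Epi_congr hπr fun i hi => ?_
        by_cases hik : i = k
        · subst hik
          simp only [Function.update_self, hTr i hi]
        · rw [Function.update_of_ne hik, Function.update_of_ne hik, hTr i hi]
      · refine ⟨⟨Finset.mem_insert_of_mem hk.1.1,
          (joinNode_of_ne (hne hzS.1) (hne hk.1.1)).2 hk.1.2.1, hk.1.2.2⟩, fun j hj => ?_⟩
        rcases Finset.mem_insert.1 hj.1 with rfl | hj'
        · have h1 := (joinNode_right (hne hzS.1)).1 hj.2.1
          exact absurd (π.trans huw (π.symm h1)) hzS.2.2
        · exact hk.2 ⟨hj', (joinNode_of_ne (hne hzS.1) (hne hj')).1 hj.2.1, hj.2.2⟩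
  · -- another block is removed
    have huw' : u < w := (hmin u hu.1).2 huw
    have hnot : ¬ ∀ j ∈ S, u < j → π u j := fun hc => huw (hc w hwS huw')
    obtain ⟨z, k, hz, hk⟩ : ∃ z k, IsAdjacentSpine χ π S u z ∧
        IsLeast {j | j ∈ S ∧ π z j ∧ u < j} k :=
      (exists_Epi_step χ hS hu).resolve_left fun hc => hnot hc.1
    have hzS := hz.mem
    have hblock : blockOf π' (insert v S) u = blockOf π S u := by
      ext x
      simp only [mem_blockOf, Finset.mem_insert]
      by_cases hx : x = v
      · subst hx
        simp [joinNode_right (hne huS), huw, hvS]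
      · simp [hx, joinNode_of_ne (hne huS) hx]
    have hrest : insert v S \ blockOf π' (insert v S) u = insert v (S \ blockOf π S u) := by
      rw [hblock, Finset.insert_sdiff_of_notMem]
      simp [hvS]
    have hb : orderedProd (blockOf π' (insert v S) u) (Function.update T v C) =
        orderedProd (blockOf π S u) T' := by
      rw [hblock, orderedProd_update_of_notMem (by simp [hvS])]
      exact orderedProd_congr fun j hj => (hT.of_not_rel fun h =>
        huw (π.trans (mem_blockOf.1 hj).2 (π.symm h))).symm
    obtain ⟨z', hz', hzz'⟩ : ∃ z', IsAdjacentSpine χ π' (insert v S) u z' ∧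
        ∀ j ∈ S, π' z' j ↔ π z j := by
      rcases exists_isAdjacentSpine_insert hvS hwS hadj huv huw' huw hz with h | ⟨rfl, h⟩
      · exact ⟨z, h, fun j hj => joinNode_of_ne (hne hzS.1) (hne hj)⟩
      · exact ⟨v, h, fun j hj => joinNode_left (hne hj)⟩
    have hz'v : π' z' v ↔ π z w := by
      have h1 := hzz' w hwS
      have h2 : π' w v := (joinNode_right (hne hwS)).2 (π.refl w)
      exact ⟨fun h => h1.1 (π'.trans h (π'.symm h2)), fun h => π'.trans (h1.2 h) h2⟩
    set D : A := (P.bop (χ u) (P.E (orderedProd (blockOf π S u) T')) : A)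
    have hIH := ih (S \ blockOf π S u).card (card_sdiff_blockOf_lt huS) (S \ blockOf π S u) rfl
    have hwR : w ∈ S \ blockOf π S u := by simp [hwS, huw]
    have hmem : ∀ {j}, j ∈ S → π w j → j ∈ S \ blockOf π S u := fun hj hwj => by
      rw [Finset.mem_sdiff, mem_blockOf]
      exact ⟨hj, fun h => huw (π.trans h.2 (π.symm hwj))⟩
    have hsub : ∀ {j}, j ∈ S \ blockOf π S u → j ∈ S := fun h => (Finset.mem_sdiff.1 h).1
    have habs : ∀ {C' : A} {T₁ T₁' : Fin n → A}, IsNodeAbsorbed π S v w C' T₁ T₁' →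
        IsNodeAbsorbed π (S \ blockOf π S u) v w C' T₁ T₁' := by
      rintro C' T₁ T₁' (⟨k, hk, rfl⟩ | ⟨hl, k, hk, rfl⟩)
      · exact Or.inl ⟨k, ⟨⟨hmem hk.1.1 hk.1.2.1, hk.1.2⟩, fun j hj => hk.2 ⟨hsub hj.1, hj.2⟩⟩, rfl⟩
      · exact Or.inr ⟨fun j hj => hl j (hsub hj), k, ⟨⟨hmem hk.1.1 hk.1.2, hk.1.2⟩,
          fun j hj => hk.2 ⟨hsub hj.1, hj.2⟩⟩, rfl⟩
    have key : ∀ {C' : A} {T₁ T₁' : Fin n → A}, IsNodeAbsorbed π S v w C' T₁ T₁' →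
        P.Epi χ π (S \ blockOf π S u) T₁' =
          P.Epi χ π' (insert v (S \ blockOf π S u)) (Function.update T₁ v C') := fun h =>
      hIH _ _ _ (fun h => hvS (hsub h)) hwR (fun x hx => hadj x (hsub hx))
        (fun x hx => hmin x (blockMins_sdiff_blockOf hx).1) (habs h)
    rw [Epi_of_isAdjacentSpine hS hu hz hk]
    -- The value of the removed block is multiplied into the adjacent block at its first node below
    -- `u`. With the new node present, this first node is `v` exactly when the adjacent block is
    -- that of `w` and `v` comes before `k`; then `k` is also the node that has absorbed `C`, and
    -- associativity identifies the results.
    by_cases hcase : π z w ∧ v < k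
    · -- the new node `v` receives the inserted element
      have hk' : IsLeast {j | j ∈ insert v S ∧ π' z' j ∧ u < j} v := by
        refine ⟨⟨Finset.mem_insert_self _ _, hz'v.2 hcase.1, huv⟩, fun j hj => ?_⟩
        rcases Finset.mem_insert.1 hj.1 with rfl | hj'
        · exact le_rfl
        · exact hcase.2.le.trans (hk.2 ⟨hj', (hzz' j hj').1 hj.2.1, hj.2.2⟩)
      rw [Epi_of_isAdjacentSpine hS' hu' hz' hk', hrest, hb, Function.update_self,
        Function.update_idem]
      apply key
      have hwk : π w k := π.trans (π.symm hcase.1) hk.1.2.1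
      rcases hT with ⟨l, hl, rfl⟩ | ⟨hl, -⟩
      · have hlk : l = k := by
          refine le_antisymm (hl.2 ⟨hk.1.1, hwk, hcase.2⟩) (hk.2 ⟨hl.1.1, ?_, ?_⟩)
          · exact π.trans hcase.1 hl.1.2.1
          · exact huv.trans hl.1.2.2
        subst hlk
        refine Or.inl ⟨l, hl, ?_⟩
        rw [Function.update_self, Function.update_idem, mul_assoc]
      · exact absurd (hl k hk.1.1 hwk) hcase.2.not_gt
    · have hkv : k ≠ v := hne hk.1.1
      have hk' : IsLeast {j | j ∈ insert v S ∧ π' z' j ∧ u < j} k := by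
        refine ⟨⟨Finset.mem_insert_of_mem hk.1.1, (hzz' k hk.1.1).2 hk.1.2.1, hk.1.2.2⟩,
          fun j hj => ?_⟩
        rcases Finset.mem_insert.1 hj.1 with rfl | hj'
        · by_contra hc
          exact hcase ⟨hz'v.1 hj.2.1, not_le.1 hc⟩
        · exact hk.2 ⟨hj', (hzz' j hj').1 hj.2.1, hj.2.2⟩
      rw [Epi_of_isAdjacentSpine hS' hu' hz' hk', hrest, hb, Function.update_of_ne hkv,
        Function.update_comm hkv.symm]
      apply key
      rcases hT with ⟨l, hl, rfl⟩ | ⟨hl, l, hl', rfl⟩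
      · have hlk : k ≠ l := by
          rintro rfl
          exact hcase ⟨π.trans hk.1.2.1 (π.symm hl.1.2.1), hl.1.2.2⟩
        refine Or.inl ⟨l, hl, ?_⟩
        rw [Function.update_of_ne hlk, Function.update_of_ne hlk.symm,
          Function.update_comm hlk]
      · refine Or.inr ⟨hl, l, hl', ?_⟩
        by_cases hlk : k = l
        · subst hlk
          simp [mul_assoc]
        · rw [Function.update_of_ne hlk, Function.update_of_ne (Ne.symm hlk),
            Function.update_comm hlk]

end NCPS

end BiFree

end

/-! ### The expectation is balanced; removing the last block -/

noncomputable section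

namespace BiFree

variable {n : ℕ}

namespace NCPS

section orderedProd

variable {A : Type*} [Ring A] {S : Finset (Fin n)} {p q : Fin n} {T : Fin n → A} {X : A}

theorem orderedProd_update_mul_right (hp : p ∈ S) (h : ∀ k ∈ S, p < k → Commute X (T k)) :
    orderedProd S (Function.update T p (T p * X)) = orderedProd S T * X := by
  have hc : Commute X (orderedProd {j ∈ S | p < j} T) :=
    orderedProd_commute fun k hk => h k (Finset.mem_filter.1 hk).1 (Finset.mem_filter.1 hk).2
  rw [orderedProd_split hp, orderedProd_split hp T, Function.update_self,
    orderedProd_update_of_notMem (by simp), orderedProd_update_of_notMem (by simp)]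
  simp only [mul_assoc, hc.eq]

theorem orderedProd_update_mul_left (hp : p ∈ S) (h : ∀ k ∈ S, k < p → Commute X (T k)) :
    orderedProd S (Function.update T p (X * T p)) = X * orderedProd S T := by
  have hc : Commute X (orderedProd {j ∈ S | j < p} T) :=
    orderedProd_commute fun k hk => h k (Finset.mem_filter.1 hk).1 (Finset.mem_filter.1 hk).2
  rw [orderedProd_split hp, orderedProd_split hp T, Function.update_self,
    orderedProd_update_of_notMem (by simp), orderedProd_update_of_notMem (by simp)]
  simp only [← mul_assoc, hc.eq]

theorem orderedProd_update_mul_between (hp : p ∈ S) (hq : q ∈ S) (hpq : p < q)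
    (h : ∀ k ∈ S, p < k → k < q → Commute X (T k)) :
    orderedProd S (Function.update T p (T p * X)) =
      orderedProd S (Function.update T q (X * T q)) := by
  have hq' : q ∈ ({j ∈ S | p < j} : Finset (Fin n)) := by simp [hq, hpq]
  rw [orderedProd_split hp, orderedProd_split hp (Function.update T q (X * T q)),
    Function.update_self, Function.update_of_ne hpq.ne,
    orderedProd_update_of_notMem (by simp), orderedProd_update_of_notMem (by simp),
    orderedProd_update_of_notMem (by simp [hpq.le]), orderedProd_update_mul_left hq']
  · simp only [mul_assoc]
  · exact fun k hk hkq => h k (Finset.mem_filter.1 hk).1 (Finset.mem_filter.1 hk).2 hkq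

end orderedProd

variable {B A : Type*} [Ring B] [Algebra ℂ B] [Ring A] [Algebra ℂ A]

variable {P : NCPS B A} {χ : Fin n → Side} {π : Setoid (Fin n)} {S : Finset (Fin n)}

/-- The entries as elements of `A`. -/
def Entries.coe (T : P.Entries χ) : Fin n → A := fun k => (T k : A)

theorem Entries.coe_update (T : P.Entries χ) (p : Fin n) (X : P.face (χ p)) :
    Entries.coe (Function.update T p X : P.Entries χ) = Function.update T.coe p (X : A) := by
  funext k
  by_cases h : k = p
  · subst h; simp [Entries.coe]
  · simp [Entries.coe, h]

theorem coe_insertAfter_l {s : Side} (h : s = .l) (b : B) (X : P.face s) :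
    (P.insertAfter b s X : A) = X * P.L b := by
  subst h; rfl

theorem coe_insertAfter_r {s : Side} (h : s = .r) (b : B) (X : P.face s) :
    (P.insertAfter b s X : A) = P.R b * X := by
  subst h; rfl

theorem coe_insertBefore_l {s : Side} (h : s = .l) (b : B) (X : P.face s) :
    (P.insertBefore b s X : A) = P.L b * X := by
  subst h; rfl

theorem coe_insertBefore_r {s : Side} (h : s = .r) (b : B) (X : P.face s) :
    (P.insertBefore b s X : A) = X * P.R b := by
  subst h; rfl

theorem Entries.coe_after_l {p : Fin n} (h : χ p = .l) (T : P.Entries χ) (b : B) :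
    (T.after p b).coe = Function.update T.coe p (T.coe p * P.L b) := by
  rw [Entries.after, Entries.coe_update, coe_insertAfter_l h]; rfl

theorem Entries.coe_after_r {p : Fin n} (h : χ p = .r) (T : P.Entries χ) (b : B) :
    (T.after p b).coe = Function.update T.coe p (P.R b * T.coe p) := by
  rw [Entries.after, Entries.coe_update, coe_insertAfter_r h]; rfl

theorem Entries.coe_before_l {p : Fin n} (h : χ p = .l) (T : P.Entries χ) (b : B) :
    (T.before p b).coe = Function.update T.coe p (P.L b * T.coe p) := by
  rw [Entries.before, Entries.coe_update, coe_insertBefore_l h]; rfl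

theorem Entries.coe_before_r {p : Fin n} (h : χ p = .r) (T : P.Entries χ) (b : B) :
    (T.before p b).coe = Function.update T.coe p (T.coe p * P.R b) := by
  rw [Entries.before, Entries.coe_update, coe_insertBefore_r h]; rfl

theorem face_cases {s : Side} (X : P.face s) :
    (s = .l → ∀ b, Commute (P.R b) (X : A)) ∧ (s = .r → ∀ b, Commute (P.L b) (X : A)) := by
  cases s
  · exact ⟨fun _ b => face_l_comm X.2 b, by simp⟩
  · exact ⟨by simp, fun _ b => face_r_comm X.2 b⟩

theorem Entries.commute_L (T : P.Entries χ) {k : Fin n} (h : χ k = .r) (b : B) :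
    Commute (P.L b) (T.coe k) := (face_cases (T k)).2 h b

theorem Entries.commute_R (T : P.Entries χ) {k : Fin n} (h : χ k = .l) (b : B) :
    Commute (P.R b) (T.coe k) := (face_cases (T k)).1 h b

/-- The expectation of the ordered product is balanced. -/
theorem isBalanced_E_orderedProd (P : NCPS B A) (χ : Fin n → Side) (S : Finset (Fin n)) :
    IsBalanced χ S fun T : P.Entries χ => P.E (orderedProd S T.coe) := by
  constructor
  · intro T b p q hp hq hpq hcons
    have hside : ∀ k ∈ S, ¬ (pos χ p < pos χ k ∧ pos χ k < pos χ q) := fun k hk h =>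
      absurd (hcons k hk h.1) (by omega)
    rcases side_cases χ p with ⟨hps, hpp⟩ | ⟨hps, hpp⟩ <;>
      rcases side_cases χ q with ⟨hqs, hqp⟩ | ⟨hqs, hqp⟩
    -- Between consecutive left nodes only right entries occur in the product, and these commute
    -- with `L_b`. The case of two right nodes is symmetric.
    · rw [Entries.coe_after_l hps, Entries.coe_before_l hqs,
        orderedProd_update_mul_between hp hq (by omega)]
      intro k hk hpk hkq
      rcases side_cases χ k with ⟨hks, hkp⟩ | ⟨hks, hkp⟩
      · exact absurd ⟨by omega, by omega⟩ (hside k hk)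
      · exact T.commute_L hks b
    -- The passage from the left to the right nodes: `L_b` slides to the end of the product, becomes
    -- `R_b` under `E`, and slides back to `q`.
    · rw [Entries.coe_after_l hps, Entries.coe_before_r hqs, orderedProd_update_mul_right hp,
        orderedProd_update_mul_right hq, E_mul_L]
      · intro k hk hqk
        rcases side_cases χ k with ⟨hks, hkp⟩ | ⟨hks, hkp⟩
        · exact T.commute_R hks b
        · exact absurd ⟨by omega, by omega⟩ (hside k hk)
      · intro k hk hpk
        rcases side_cases χ k with ⟨hks, hkp⟩ | ⟨hks, hkp⟩
        · exact absurd ⟨by omega, by omega⟩ (hside k hk)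
        · exact T.commute_L hks b
    · omega
    · rw [Entries.coe_after_r hps, Entries.coe_before_r hqs,
        orderedProd_update_mul_between hq hp (by omega)]
      intro k hk hpk hkq
      rcases side_cases χ k with ⟨hks, hkp⟩ | ⟨hks, hkp⟩
      · exact T.commute_R hks b
      · exact absurd ⟨by omega, by omega⟩ (hside k hk)
  · intro T b p hp hfirst
    rcases side_cases χ p with ⟨hps, hpp⟩ | ⟨hps, hpp⟩
    · rw [Entries.coe_before_l hps, orderedProd_update_mul_left hp, E_L_mul]
      intro k hk hkp
      rcases side_cases χ k with ⟨hks, hkp'⟩ | ⟨hks, -⟩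
      · have := hfirst k hk
        omega
      · exact T.commute_L hks b
    · have hr : ∀ k ∈ S, χ k = .r ∧ k ≤ p := by
        intro k hk
        have := hfirst k hk
        rcases side_cases χ k with ⟨hks, hkp'⟩ | ⟨hks, hkp'⟩
        · omega
        · exact ⟨hks, by omega⟩
      -- There are only right entries, so after `R_b` at the end is exchanged for `L_b`, the latter
      -- commutes through the whole product to the front.
      rw [Entries.coe_before_r hps, orderedProd_update_mul_right hp, ← E_mul_L,
        ← (orderedProd_commute fun k hk => T.commute_L (hr k hk).1 b).eq, E_L_mul]
      exact fun k hk hpk => absurd (hr k hk).2 (not_le.2 hpk)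
  · intro T b p hp hlast
    rcases side_cases χ p with ⟨hps, hpp⟩ | ⟨hps, hpp⟩
    · have hl : ∀ k ∈ S, χ k = .l ∧ k ≤ p := by
        intro k hk
        have := hlast k hk
        rcases side_cases χ k with ⟨hks, hkp'⟩ | ⟨hks, hkp'⟩
        · exact ⟨hks, by omega⟩
        · omega
      rw [Entries.coe_after_l hps, orderedProd_update_mul_right hp, E_mul_L,
        ← (orderedProd_commute fun k hk => T.commute_R (hl k hk).1 b).eq, E_R_mul]
      exact fun k hk hpk => absurd (hl k hk).2 (not_le.2 hpk)
    · rw [Entries.coe_after_r hps, orderedProd_update_mul_left hp, E_R_mul]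
      intro k hk hkp
      rcases side_cases χ k with ⟨hks, hkp'⟩ | ⟨hks, hkp'⟩
      · exact T.commute_R hks b
      · have := hlast k hk
        omega

/-- The block of the largest block minimum is an interval for `≺_χ`. -/
theorem isIntervalIn_blockOf {v : Fin n} (hπ : IsNonCrossingOn χ π S) (hv : IsTopMin π S v) :
    IsIntervalIn χ S (blockOf π S v) := by
  intro a ha b hb k hk hak hkb
  rw [mem_blockOf] at ha hb
  by_contra hkV
  have hvk : ¬ π v k := fun h => hkV (mem_blockOf.2 ⟨hk, h⟩)
  obtain ⟨u, hu, huv, huk⟩ := hv.exists_lt hk hvk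
  have hva := hv.le_of_rel ha.1 ha.2
  have hvb := hv.le_of_rel hb.1 hb.2
  have hab : π a b := π.trans (π.symm ha.2) hb.2
  -- The node `u`, in the block of `k`, is above all nodes of the block of `v`. Hence it comes
  -- before `a` if it is on the left and after `b` if it is on the right; either way the two blocks
  -- would cross.
  rcases side_cases χ u with ⟨-, hup⟩ | ⟨-, hup⟩
  · have hua : pos χ u < pos χ a := by
      rcases side_cases χ a with ⟨-, h⟩ | ⟨-, h⟩ <;> omega
    have := hπ u hu a ha.1 k hk b hb.1 hua hak hkb huk hab
    exact hvk (π.trans ha.2 (π.trans (π.symm this) huk))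
  · have hbu : pos χ b < pos χ u := by
      rcases side_cases χ b with ⟨-, h⟩ | ⟨-, h⟩ <;> omega
    have := hπ a ha.1 k hk b hb.1 u hu hak hkb hbu hab (π.symm huk)
    exact hvk (π.trans ha.2 this)

/-- Collapsing `v` to `w` is weakly monotone for `≺_χ`, as no node of `S` lies between them. A
crossing is therefore mapped to a crossing of `π` or to a degenerate configuration in which two
consecutive points coincide. -/
theorem isNonCrossingOn_joinNode {v w : Fin n} (hvS : v ∉ S) (hwS : w ∈ S)
    (hadj : ∀ x ∈ S, ¬ (pos χ v < pos χ x ∧ pos χ x < pos χ w) ∧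
      ¬ (pos χ w < pos χ x ∧ pos χ x < pos χ v))
    (hπ : IsNonCrossingOn χ π S) : IsNonCrossingOn χ (joinNode π v w) (insert v S) := by
  set f := Function.update (id : Fin n → Fin n) v w with hf
  have hfS : ∀ x ∈ insert v S, f x ∈ S := by
    intro x hx
    by_cases h : x = v
    · simp [hf, h, hwS]
    · simpa [hf, h] using hx
  have hmono : ∀ x ∈ insert v S, ∀ y ∈ insert v S, pos χ x < pos χ y →
      pos χ (f x) < pos χ (f y) ∨ f x = f y := by
    intro x hx y hy hxy
    by_cases hxv : x = v
    · subst hxv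
      have hyx : y ≠ x := by rintro rfl; omega
      have hyS := (Finset.mem_insert.1 hy).resolve_left hyx
      simp only [hf, Function.update_self, Function.update_of_ne hyx, id]
      by_cases hyw : w = y
      · exact Or.inr hyw
      · refine Or.inl (pos_lt_of_le_of_ne ?_ hyw)
        by_contra h
        exact (hadj y hyS).1 ⟨hxy, by omega⟩
    · have hxS := (Finset.mem_insert.1 hx).resolve_left hxv
      by_cases hyv : y = v
      · subst hyv
        simp only [hf, Function.update_self, Function.update_of_ne hxv, id]
        by_cases hxw : x = w
        · exact Or.inr hxw
        · refine Or.inl (pos_lt_of_le_of_ne ?_ hxw)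
          by_contra h
          exact (hadj x hxS).2 ⟨by omega, hxy⟩
      · simp only [hf, Function.update_of_ne hyv, Function.update_of_ne hxv, id]
        exact Or.inl hxy
  intro u₁ h₁ v₁ h₂ u₂ h₃ v₂ h₄ h12 h23 h34 hu hv
  rw [joinNode_def] at hu hv ⊢
  rw [← hf] at hu hv ⊢
  rcases hmono _ h₁ _ h₂ h12 with k12 | k12
  · rcases hmono _ h₂ _ h₃ h23 with k23 | k23
    · rcases hmono _ h₃ _ h₄ h34 with k34 | k34
      · exact hπ _ (hfS _ h₁) _ (hfS _ h₂) _ (hfS _ h₃) _ (hfS _ h₄) k12 k23 k34 hu hv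
      · exact π.trans hu (k34 ▸ π.symm hv)
    · exact k23 ▸ hu
  · exact k12 ▸ π.refl _

/-- In the recursive step for `Epi`, the value of the removed block is multiplied into the block of
a node `w` next to the removed block, at the height of the minimum of the removed block. -/
theorem exists_isNodeAbsorbed {v : Fin n} (χ : Fin n → Side) (hS : ¬ ∀ i ∈ S, ∀ j ∈ S, π i j)
    (hv : IsTopMin π S v) : ∃ w ∈ S \ blockOf π S v,
      (∀ x ∈ S \ blockOf π S v, ¬ (pos χ v < pos χ x ∧ pos χ x < pos χ w) ∧
        ¬ (pos χ w < pos χ x ∧ pos χ x < pos χ v)) ∧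
      (∀ u ∈ blockMins π (S \ blockOf π S v), u < v ∧ (¬ π u w → u < w)) ∧
      ∀ T : Fin n → A, ∃ T' : Fin n → A,
        P.Epi χ π S T = P.Epi χ π (S \ blockOf π S v) T' ∧
        IsNodeAbsorbed π (S \ blockOf π S v) v w
          (P.bop (χ v) (P.E (orderedProd (blockOf π S v) T)) : A) T T' := by
  have hmem : ∀ {j}, j ∈ S \ blockOf π S v ↔ j ∈ S ∧ ¬ π v j := by
    intro j
    rw [Finset.mem_sdiff, mem_blockOf]
    tauto
  have hminv : ∀ u ∈ blockMins π (S \ blockOf π S v), u ∈ S ∧ u < v := by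
    intro u hu
    obtain ⟨hu, hvu⟩ := blockMins_sdiff_blockOf hu
    refine ⟨(mem_blockMins.1 hu).1, lt_of_le_of_ne (hv.2 hu) ?_⟩
    rintro rfl
    exact hvu (π.refl _)
  rcases exists_Epi_step χ hS hv with ⟨hl, k, hk⟩ | ⟨w, k, hw, hk⟩
  · have hlt : ∀ x ∈ S \ blockOf π S v, x < v ∧ x ≤ k := by
      intro x hx
      rw [hmem] at hx
      have h1 : x < v := by
        by_contra h
        have hne : v ≠ x := by rintro rfl; exact hx.2 (π.refl _)
        exact hx.2 (hl x hx.1 (lt_of_le_of_ne (not_lt.1 h) hne))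
      exact ⟨h1, hk.2 ⟨hx.1, h1⟩⟩
    have hkS : k ∈ S \ blockOf π S v :=
      hmem.2 ⟨hk.1.1, fun h => absurd (hv.le_of_rel hk.1.1 h) (not_le.2 hk.1.2)⟩
    -- All remaining nodes have labels at most `k < v`, so none is between `k` and `v` for `≺_χ`: on
    -- the same side these are neighbours, and on opposite sides they enclose the passage from left
    -- to right.
    refine ⟨k, hkS, ?_, ?_, ?_⟩
    · intro x hx
      have h1 := hlt x hx
      have h2 := hk.1.2
      rcases side_cases χ x with ⟨-, hx'⟩ | ⟨-, hx'⟩ <;>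
        rcases side_cases χ v with ⟨-, hv'⟩ | ⟨-, hv'⟩ <;>
        rcases side_cases χ k with ⟨-, hk'⟩ | ⟨-, hk'⟩ <;> omega
    · intro u hu
      have h1 := hminv u hu
      refine ⟨h1.2, fun hr => lt_of_le_of_ne (hk.2 h1) ?_⟩
      rintro rfl
      exact hr (π.refl _)
    · intro T
      refine ⟨_, Epi_of_last hS hv hl hk T, Or.inr ⟨fun j hj _ => (hlt j hj).1, k, ?_, rfl⟩⟩
      exact ⟨⟨hkS, π.refl k⟩, fun j hj => (hlt j hj.1).2⟩
  · have hwS := hw.mem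
    refine ⟨w, hmem.2 ⟨hwS.1, hwS.2.2⟩, ?_, ?_, ?_⟩
    · intro x hx
      rw [hmem] at hx
      have hvx : v ≠ x := by rintro rfl; exact hx.2 (π.refl _)
      have hvw := hwS.2.1
      rcases side_cases χ v with ⟨hvs, hv'⟩ | ⟨hvs, hv'⟩
      · rw [isAdjacentSpine_l hvs] at hw
        rcases lt_or_gt_of_ne hvx with h | h
        · have h1 := hw.2 x hx.1 h hx.2
          rcases side_cases χ x with ⟨-, hx'⟩ | ⟨-, hx'⟩ <;>
            rcases side_cases χ w with ⟨-, hw'⟩ | ⟨-, hw'⟩ <;> omega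
        · rcases side_cases χ x with ⟨-, hx'⟩ | ⟨-, hx'⟩ <;>
            rcases side_cases χ w with ⟨-, hw'⟩ | ⟨-, hw'⟩ <;> omega
      · rw [isAdjacentSpine_r hvs] at hw
        rcases lt_or_gt_of_ne hvx with h | h
        · have h1 := hw.2 x hx.1 h hx.2
          rcases side_cases χ x with ⟨-, hx'⟩ | ⟨-, hx'⟩ <;>
            rcases side_cases χ w with ⟨-, hw'⟩ | ⟨-, hw'⟩ <;> omega
        · rcases side_cases χ x with ⟨-, hx'⟩ | ⟨-, hx'⟩ <;>
            rcases side_cases χ w with ⟨-, hw'⟩ | ⟨-, hw'⟩ <;> omega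
    · intro u hu
      have h1 := hminv u hu
      exact ⟨h1.2, fun _ => h1.2.trans hwS.2.1⟩
    · intro T
      refine ⟨_, Epi_of_isAdjacentSpine hS hv hw hk T, Or.inl ⟨k, ?_, rfl⟩⟩
      refine ⟨⟨hmem.2 ⟨hk.1.1, fun h => hwS.2.2 (π.trans h (π.symm hk.1.2.1))⟩, hk.1.2⟩,
        fun j hj => hk.2 ⟨(hmem.1 hj.1).1, hj.2⟩⟩

open Classical in
/-- The values `Epi` on the subsets of the nodes, with value `1` on the empty set. -/
def epiSys (P : NCPS B A) (χ : Fin n → Side) (π : Setoid (Fin n)) (S : Finset (Fin n))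
    (T : P.Entries χ) : B :=
  if S = ∅ then 1 else P.Epi χ π S T.coe

theorem epiSys_of_nonempty (hS : S.Nonempty) (T : P.Entries χ) :
    epiSys P χ π S T = P.Epi χ π S T.coe := if_neg hS.ne_empty

theorem epiSys_empty (T : P.Entries χ) : epiSys P χ π ∅ T = 1 := if_pos rfl

theorem epiSys_of_forall_rel (hS : S.Nonempty) (h : ∀ i ∈ S, ∀ j ∈ S, π i j) :
    epiSys P χ π S = fun T : P.Entries χ => P.E (orderedProd S T.coe) := by
  funext T
  rw [epiSys_of_nonempty hS, Epi_of_forall_rel h]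

theorem dependsOnlyOn_epiSys (P : NCPS B A) (χ : Fin n → Side) (π : Setoid (Fin n))
    (S : Finset (Fin n)) : DependsOnlyOn S (epiSys P χ π S) := by
  intro T T' h
  unfold epiSys
  split_ifs
  · rfl
  · exact Epi_congr (fun _ _ _ _ => Iff.rfl) fun k hk => by rw [Entries.coe, Entries.coe, h k hk]

theorem insertBefore_one (s : Side) (b : B) : P.insertBefore b s 1 = P.bop s b := by
  cases s <;> ext <;> simp [insertBefore]

theorem rel_blockOf {v : Fin n} : ∀ i ∈ blockOf π S v, ∀ j ∈ blockOf π S v, π i j :=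
  fun _ hi _ hj => π.trans (π.symm (mem_blockOf.1 hi).2) (mem_blockOf.1 hj).2

/-- The value `b` of the removed block is put at an extra node `v` in the block of `w`, as the
insertion of `b` before the entry `1`. Balancedness of this smaller system, which is the hypothesis
`hbal`, moves `b` to the `≺_χ`-predecessor of `v` or out on the left. -/
theorem epiSys_eq_gapInsert_of_isTopMin {v : Fin n} (hπ : IsNonCrossingOn χ π S)
    (hS : ¬ ∀ i ∈ S, ∀ j ∈ S, π i j) (hv : IsTopMin π S v)
    (hbal : ∀ π' S', IsNonCrossingOn χ π' S' →
      (blockMins π' S').card < (blockMins π S).card → IsBalanced χ S' (epiSys P χ π' S'))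
    (T : P.Entries χ) :
    epiSys P χ π S T = gapInsert (epiSys P χ π (S \ blockOf π S v)) (S \ blockOf π S v) v
      (epiSys P χ π (blockOf π S v) T) T := by
  obtain ⟨w, hw, hadj, hmin, hT⟩ := exists_isNodeAbsorbed (P := P) χ hS hv
  have hvV : v ∈ blockOf π S v := mem_blockOf.2 ⟨hv.mem, π.refl v⟩
  have hvS : v ∉ S \ blockOf π S v := by simp [hvV]
  set S₁ := S \ blockOf π S v with hS₁
  set π' := joinNode π v w with hπ'
  obtain ⟨T', hE, hT'⟩ := hT T.coe
  set b := P.E (orderedProd (blockOf π S v) T.coe) with hb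
  -- The number of nodes need not drop, as the removed block may be `{v}`. The number of block
  -- minima does, because `v` is no longer one.
  have hbal' : IsBalanced χ (insert v S₁) (epiSys P χ π' (insert v S₁)) := by
    refine hbal _ _ (isNonCrossingOn_joinNode hvS hw hadj (hπ.mono Finset.sdiff_subset)) ?_
    refine Finset.card_lt_card ⟨fun x hx => ?_, fun h => ?_⟩
    · rw [mem_blockMins] at hx
      have hxv : x ≠ v := by
        rintro rfl
        obtain ⟨y, hy, hyw, -⟩ := exists_mem_blockMins (π := π) hw
        have hyS := (mem_blockMins.1 hy).1
        have := hx.2 y (Finset.mem_insert_of_mem hyS)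
          ((joinNode_left (ne_of_mem_of_not_mem hyS hvS)).2 (π.symm hyw))
        exact absurd (hmin y hy).1 (not_lt.2 this)
      have hxS := (Finset.mem_insert.1 hx.1).resolve_left hxv
      rw [hS₁, Finset.mem_sdiff, mem_blockOf] at hxS
      refine mem_blockMins.2 ⟨hxS.1, fun j hj hxj => ?_⟩
      have hjS : j ∈ S₁ := by
        rw [hS₁, Finset.mem_sdiff, mem_blockOf]
        exact ⟨hj, fun h => hxS.2 ⟨hxS.1, π.trans h.2 (π.symm hxj)⟩⟩
      exact hx.2 j (Finset.mem_insert_of_mem hjS)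
        ((joinNode_of_ne hxv (ne_of_mem_of_not_mem hjS hvS)).2 hxj)
    · have hvm := (mem_blockMins.1 (h hv.1)).2
      obtain ⟨y, hy, hyw, -⟩ := exists_mem_blockMins (π := π) hw
      have hyS := (mem_blockMins.1 hy).1
      have := hvm y (Finset.mem_insert_of_mem hyS)
        ((joinNode_left (ne_of_mem_of_not_mem hyS hvS)).2 (π.symm hyw))
      exact absurd (hmin y hy).1 (not_lt.2 this)
  -- Absorbing the factor `1` is absorbing nothing, whatever the other entries are; this removes the
  -- auxiliary node in the end.
  have hunit : ∀ T₁ : P.Entries χ, epiSys P χ π' (insert v S₁) (Function.update T₁ v 1) =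
      epiSys P χ π S₁ T₁ := by
    intro T₁
    rw [epiSys_of_nonempty ⟨v, by simp⟩, epiSys_of_nonempty ⟨w, hw⟩, Entries.coe_update]
    exact (Epi_insert_node S₁ T₁.coe T₁.coe 1 hvS hw hadj hmin (hT'.one _)).symm
  have hV : epiSys P χ π (blockOf π S v) T = b := by
    rw [epiSys_of_forall_rel ⟨v, hvV⟩ rel_blockOf]
  have hmain : epiSys P χ π S T = epiSys P χ π' (insert v S₁)
      (Entries.before (Function.update T v 1 : P.Entries χ) v b) := by
    rw [epiSys_of_nonempty ⟨v, hv.mem⟩, hE, Epi_insert_node S₁ T.coe T' _ hvS hw hadj hmin hT',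
      epiSys_of_nonempty ⟨v, by simp⟩, Entries.before, Function.update_self, insertBefore_one,
      Entries.coe_update, Entries.coe_update, Function.update_idem]
  rw [hmain, hV]
  rcases exists_isPred_or_forall χ S₁ v with ⟨p, hp⟩ | hnone
  · have hpv : p ≠ v := ne_of_mem_of_not_mem hp.1 hvS
    rw [gapInsert_of_isPred hp, ← hbal'.mid _ _ p v (Finset.mem_insert_of_mem hp.1)
      (Finset.mem_insert_self _ _) hp.2.1, Entries.update_after _ hpv, hunit]
    intro k hk hpk
    rcases Finset.mem_insert.1 hk with rfl | hk
    · exact le_rfl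
    · by_contra hkv
      have := hp.2.2 k hk (by omega)
      omega
  · rw [gapInsert_of_forall hnone, hbal'.first _ _ v (Finset.mem_insert_self _ _), hunit]
    intro k hk
    rcases Finset.mem_insert.1 hk with rfl | hk
    · exact le_rfl
    · exact hnone k hk

end NCPS

end BiFree

end

/-! ### The moment function is multiplicative -/

noncomputable section

namespace BiFree

variable {n : ℕ}

section saturated

variable {χ : Fin n → Side} {π : Setoid (Fin n)} {S U V : Finset (Fin n)}

theorem IsSaturatedIn.sdiff (hU : IsSaturatedIn π S U) : IsSaturatedIn π S (S \ U) := by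
  intro a ha b hb hab
  rw [Finset.mem_sdiff] at ha ⊢
  exact ⟨hb, fun h => ha.2 (hU b h a ha.1 (π.symm hab))⟩

theorem IsSaturatedIn.mono (hU : IsSaturatedIn π S U) {S' : Finset (Fin n)} (hS : S' ⊆ S) :
    IsSaturatedIn π S' U :=
  fun a ha b hb => hU a ha b (hS hb)

theorem IsIntervalIn.mono (hU : IsIntervalIn χ S U) {S' : Finset (Fin n)} (hS : S' ⊆ S) :
    IsIntervalIn χ S' U :=
  fun a ha b hb k hk => hU a ha b hb k (hS hk)

theorem IsSaturatedIn.blockMins_subset (hU : IsSaturatedIn π S U) (hUS : U ⊆ S) :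
    NCPS.blockMins π U ⊆ NCPS.blockMins π S := by
  intro x hx
  rw [NCPS.mem_blockMins] at hx ⊢
  exact ⟨hUS hx.1, fun j hj hxj => hx.2 j (hU x hx.1 j hj hxj) hxj⟩

/-- Counting block minima counts blocks; this is the measure for the induction below. -/
theorem IsSaturatedIn.card_blockMins_lt (hU : IsSaturatedIn π S U) (hUS : U ⊆ S) (hne : U ≠ S) :
    (NCPS.blockMins π U).card < (NCPS.blockMins π S).card := by
  refine Finset.card_lt_card ⟨hU.blockMins_subset hUS, fun h => hne ?_⟩
  refine Finset.Subset.antisymm hUS fun x hx => ?_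
  obtain ⟨u, hu, hux, -⟩ := NCPS.exists_mem_blockMins (π := π) hx
  exact hU u (NCPS.mem_blockMins.1 (h hu)).1 x hx hux

theorem isSaturatedIn_blockOf (π : Setoid (Fin n)) (S : Finset (Fin n)) (v : Fin n) :
    IsSaturatedIn π S (NCPS.blockOf π S v) := by
  intro a ha b hb hab
  rw [NCPS.mem_blockOf] at ha ⊢
  exact ⟨hb, π.trans ha.2 hab⟩

theorem NCPS.blockOf_subset {v : Fin n} : NCPS.blockOf π S v ⊆ S :=
  fun _ h => (NCPS.mem_blockOf.1 h).1

end saturated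

variable {B A : Type*} [Ring B] [Algebra ℂ B] [Ring A] [Algebra ℂ A]

namespace NCPS

variable {P : NCPS B A} {χ : Fin n → Side} {π : Setoid (Fin n)}

/-- A union `U` of blocks that is an interval of `S` can be removed from `S`. -/
def Removes (π : Setoid (Fin n)) (F : Finset (Fin n) → P.Entries χ → B) (S : Finset (Fin n)) :
    Prop :=
  ∀ U ⊆ S, IsSaturatedIn π S U → IsIntervalIn χ S U → ∀ u ∈ U, ∀ T,
    F S T = gapInsert (F (S \ U)) (S \ U) u (F U T) T

/-- The degenerate removal of everything; it holds because of the convention that the value on the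
empty set is `1`. -/
theorem removes_self (F : Finset (Fin n) → P.Entries χ → B) (hF : ∀ T, F ∅ T = 1)
    (S : Finset (Fin n)) (u : Fin n) (T : P.Entries χ) :
    F S T = gapInsert (F (S \ S)) (S \ S) u (F S T) T := by
  rw [Finset.sdiff_self, gapInsert_empty, hF, mul_one]

/-- The family of the values `Epi` is balanced, and unions of blocks which are intervals can be
removed. -/
theorem isBalanced_and_removes_epiSys (P : NCPS B A) (χ : Fin n → Side) :
    ∀ (π : Setoid (Fin n)) (S : Finset (Fin n)), IsNonCrossingOn χ π S →
      IsBalanced χ S (epiSys P χ π S) ∧ Removes π (epiSys P χ π) S := by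
  intro π S
  -- Both `π` and `S` vary, since the removal of the top block passes through a system with an extra
  -- node and a modified partition.
  induction h : (blockMins π S).card using Nat.strong_induction_on generalizing π S with
  | _ c ih =>
  subst h
  intro hπ
  have hdep := dependsOnlyOn_epiSys P χ π
  rcases S.eq_empty_or_nonempty with rfl | hne
  · refine ⟨⟨by simp, by simp, by simp⟩, fun U hU _ _ u hu => ?_⟩
    exact absurd (hU hu) (Finset.notMem_empty u)
  by_cases hS : ∀ i ∈ S, ∀ j ∈ S, π i j
  · rw [epiSys_of_forall_rel hne hS]
    refine ⟨isBalanced_E_orderedProd P χ S, fun U hU hsat _ u hu T => ?_⟩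
    obtain rfl : U = S := Finset.Subset.antisymm hU fun x hx => hsat u hu x hx (hS u (hU hu) x hx)
    exact removes_self _ (fun T => epiSys_empty T) U u T
  obtain ⟨v, hv⟩ := exists_isTopMin π hne
  have hvV : v ∈ blockOf π S v := mem_blockOf.2 ⟨hv.mem, π.refl v⟩
  have hVint := isIntervalIn_blockOf hπ hv
  have hVsat := isSaturatedIn_blockOf π S v
  have hVS : blockOf π S v ⊆ S := blockOf_subset
  have hVrem := epiSys_eq_gapInsert_of_isTopMin (P := P) hπ hS hv
    fun π' S' h h' => (ih _ h' π' S' rfl h).1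
  have hVne : blockOf π S v ≠ S := fun h => hS (h ▸ rel_blockOf)
  have hRne : (S \ blockOf π S v).Nonempty := by
    rw [Finset.sdiff_nonempty]
    exact fun h => hVne (Finset.Subset.antisymm hVS h)
  have hsub : ∀ S' ⊆ S, IsSaturatedIn π S S' → S' ≠ S →
      IsBalanced χ S' (epiSys P χ π S') ∧ Removes π (epiSys P χ π) S' := fun S' h h' hne' =>
    ih _ (h'.card_blockMins_lt h hne') π S' rfl (hπ.mono h)
  have hsdiff : ∀ U ⊆ S, U.Nonempty → S \ U ≠ S := by
    rintro U hU ⟨u, hu⟩ h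
    rw [← h] at hU
    exact (Finset.mem_sdiff.1 (hU hu)).2 hu
  have hR := hsub _ Finset.sdiff_subset hVsat.sdiff (hsdiff _ hVS ⟨v, hvV⟩)
  refine ⟨isBalanced_of_gapInsert hVS hVint hvV hRne (hdep _) (hdep _) hVrem
    (hsub _ hVS hVsat hVne).1 hR.1, ?_⟩
  intro U hUS hUsat hUint u hu T
  by_cases hUeq : U = S
  · subst hUeq
    exact removes_self _ (fun T => epiSys_empty T) U u T
  have hUb := hsub U hUS hUsat hUeq
  have hcut : ∀ x ∈ U, ∀ y ∈ U, ∀ k ∈ S \ U, pos χ k < pos χ x ↔ pos χ k < pos χ y := by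
    intro x hx y hy k hk
    rw [Finset.mem_sdiff] at hk
    exact ⟨hUint.pos_lt_of_lt hx hy hk.1 hk.2, hUint.pos_lt_of_lt hy hx hk.1 hk.2⟩
  -- The block `V` of the largest minimum is already known to be removable. If it lies in `U`, it is
  -- removed first and then the rest of `U`; otherwise it is disjoint from `U` and the two removals
  -- are exchanged.
  by_cases hvU : v ∈ U
  · have hVU : blockOf π S v ⊆ U := fun x hx =>
      hUsat v hvU x (mem_blockOf.1 hx).1 (mem_blockOf.1 hx).2
    by_cases hUV : U = blockOf π S v
    · rw [gapInsert_congr_point (hcut u hu v hvU), hVrem, hUV]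
    · obtain ⟨u', hu'⟩ : (U \ blockOf π S v).Nonempty := by
        rw [Finset.sdiff_nonempty]
        exact fun h => hUV (Finset.Subset.antisymm h hVU)
      rw [gapInsert_congr_point (hcut u hu u' (Finset.mem_sdiff.1 hu').1)]
      refine gapInsert_trans (epiSys P χ π) hdep hUS hVU hUint hvV hu' hVrem ?_ ?_ T
      · exact hUb.2 _ hVU (hVsat.mono hUS) (hVint.mono hUS) v hvV
      · intro T
        have h1 : (S \ blockOf π S v) \ (U \ blockOf π S v) = S \ U := by
          ext x
          simp only [Finset.mem_sdiff]
          constructor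
          · rintro ⟨⟨h1, h2⟩, h3⟩
            exact ⟨h1, fun h => h3 ⟨h, h2⟩⟩
          · rintro ⟨h1, h2⟩
            exact ⟨⟨h1, fun h => h2 (hVU h)⟩, fun h => h2 h.1⟩
        rw [hR.2 (U \ blockOf π S v) (Finset.sdiff_subset_sdiff hUS subset_rfl) ?_ ?_ u' hu' T, h1]
        · intro a ha b hb hab
          rw [Finset.mem_sdiff] at ha hb ⊢
          exact ⟨hUsat a ha.1 b hb.1 hab, hb.2⟩
        · intro a ha b hb k hk hak hkb
          rw [Finset.mem_sdiff] at ha hb hk ⊢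
          exact ⟨hUint a ha.1 b hb.1 k hk.1 hak hkb, hk.2⟩
  · have hdisj : ∀ {x}, x ∈ U → x ∉ blockOf π S v := fun hx h =>
      hvU (hUsat _ hx v hv.mem (π.symm (mem_blockOf.1 h).2))
    set V := blockOf π S v with hV
    set R := (S \ V) \ U with hRdef
    have hUR : S \ V = U ∪ R := by
      rw [hRdef, Finset.union_sdiff_of_subset]
      exact fun x hx => Finset.mem_sdiff.2 ⟨hUS hx, hdisj hx⟩
    have hVR : S \ U = V ∪ R := by
      rw [hRdef, sdiff_right_comm, Finset.union_sdiff_of_subset]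
      exact fun x hx => Finset.mem_sdiff.2 ⟨hVS hx, fun h => hdisj h hx⟩
    have hUVd : Disjoint U V := Finset.disjoint_left.2 fun x hx => hdisj hx
    have hURd : Disjoint U R := Finset.disjoint_sdiff
    have hVRd : Disjoint V R := by
      rw [hRdef]
      exact Finset.disjoint_of_subset_right Finset.sdiff_subset Finset.disjoint_sdiff
    have hall : ∀ {X}, X = U ∪ V ∪ R ∨ X = V ∪ U ∪ R → X ⊆ S := by
      intro X hX x hx
      have : x ∈ U ∨ x ∈ V ∨ x ∈ R := by
        rcases hX with rfl | rfl <;> simp only [Finset.mem_union] at hx <;> tauto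
      rcases this with h | h | h
      · exact hUS h
      · exact hVS h
      · exact (Finset.mem_sdiff.1 (Finset.mem_sdiff.1 h).1).1
    have hSU := hsub _ Finset.sdiff_subset hUsat.sdiff (hsdiff _ hUS ⟨u, hu⟩)
    have h₁ : ∀ T, epiSys P χ π (U ∪ R) T =
        gapInsert (epiSys P χ π R) R u (epiSys P χ π U T) T := by
      intro T
      have hUSV : U ⊆ S \ V := hUR ▸ Finset.subset_union_left
      rw [← hUR]
      exact hR.2 U hUSV (hUsat.mono Finset.sdiff_subset) (hUint.mono Finset.sdiff_subset) u hu T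
    have h₂ : ∀ T, epiSys P χ π (V ∪ R) T =
        gapInsert (epiSys P χ π R) R v (epiSys P χ π V T) T := by
      intro T
      have hVSU : V ⊆ S \ U := hVR ▸ Finset.subset_union_left
      have hR' : R = (S \ U) \ V := by rw [hRdef, sdiff_right_comm]
      rw [← hVR, hR']
      exact hSU.2 V hVSU (hVsat.mono Finset.sdiff_subset) (hVint.mono Finset.sdiff_subset) v hvV T
    have hne' : u ≠ v := by rintro rfl; exact hvU hu
    rw [hVrem, hUR, hVR]
    -- `gapInsert_swap` needs to know which of the two intervals comes first.
    rcases lt_or_gt_of_ne (fun h => hne' (pos_injective χ h)) with huv | huv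
    · exact gapInsert_swap (epiSys P χ π) hdep (hUint.mono (hall (Or.inl rfl)))
        (hVint.mono (hall (Or.inl rfl))) hURd hVRd hUVd hu hvV huv hUb.1 h₁ h₂ T
    · exact (gapInsert_swap (epiSys P χ π) hdep (hVint.mono (hall (Or.inr rfl)))
        (hUint.mono (hall (Or.inr rfl))) hVRd hURd hUVd.symm hvV hu huv
        (hsub _ hVS hVsat hVne).1 h₂ h₁ T).symm

end NCPS

end BiFree

end

/-! ### Restriction to sets of nodes -/

noncomputable section

namespace BiFree

variable {n : ℕ}

theorem pos_resSide_lt_iff (χ : Fin n → Side) (S : Finset (Fin n)) {i j : Fin S.card} :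
    pos (resSide χ S) i < pos (resSide χ S) j ↔ pos χ (enum S i) < pos χ (enum S j) := by
  rw [← prec_iff, ← prec_iff]
  unfold Prec
  simp only [resSide, OrderEmbedding.lt_iff_lt]

theorem pos_resSide_le_iff (χ : Fin n → Side) (S : Finset (Fin n)) {i j : Fin S.card} :
    pos (resSide χ S) i ≤ pos (resSide χ S) j ↔ pos χ (enum S i) ≤ pos χ (enum S j) := by
  rw [← not_lt, ← not_lt, pos_resSide_lt_iff]

theorem enum_mem (S : Finset (Fin n)) (i : Fin S.card) : enum S i ∈ S :=
  S.orderEmbOfFin_mem rfl i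

theorem exists_enum_eq {S : Finset (Fin n)} {k : Fin n} (hk : k ∈ S) : ∃ i, enum S i = k := by
  have : k ∈ Set.range (S.orderEmbOfFin rfl) := by rw [S.range_orderEmbOfFin rfl]; exact hk
  exact this

theorem enum_eq_orderEmbOfFin {S : Finset (Fin n)} {c : ℕ} (h : S.card = c) (i : Fin S.card) :
    enum S i = S.orderEmbOfFin h (Fin.cast h i) := by
  subst h; rfl

theorem enum_map {m : ℕ} (e : Fin m ↪o Fin n) (S : Finset (Fin m))
    (i : Fin (S.map e.toEmbedding).card) :
    enum (S.map e.toEmbedding) i = e (enum S (Fin.cast (Finset.card_map _) i)) := by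
  rw [enum_eq_orderEmbOfFin (Finset.card_map _) i]
  refine (congrFun (Finset.orderEmbOfFin_unique (f := fun i => e (enum S i)) _ ?_ ?_) _).symm
  · exact fun i => Finset.mem_map_of_mem _ (enum_mem S i)
  · exact e.strictMono.comp (enum S).strictMono

theorem enum_univ (i : Fin (Finset.univ : Finset (Fin n)).card) :
    enum Finset.univ i = Fin.cast (Finset.card_fin n) i := by
  rw [enum_eq_orderEmbOfFin (Finset.card_fin n) i]
  exact (congrFun (Finset.orderEmbOfFin_unique (f := fun i => i) (Finset.card_fin n) (by simp)
    strictMono_id) _).symm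

theorem map_enum_univ (S : Finset (Fin n)) : Finset.univ.map (enum S).toEmbedding = S := by
  ext k
  simp only [Finset.mem_map, Finset.mem_univ, true_and, RelEmbedding.coe_toEmbedding]
  exact ⟨fun ⟨i, hi⟩ => hi ▸ enum_mem S i, exists_enum_eq⟩

theorem exists_map_enum_eq {S U : Finset (Fin n)} (h : U ⊆ S) :
    ∃ U' : Finset (Fin S.card), U'.map (enum S).toEmbedding = U := by
  classical
  refine ⟨Finset.univ.filter fun i => enum S i ∈ U, ?_⟩
  ext k
  simp only [Finset.mem_map, Finset.mem_filter, Finset.mem_univ, true_and,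
    RelEmbedding.coe_toEmbedding]
  constructor
  · rintro ⟨i, hi, rfl⟩
    exact hi
  · intro hk
    obtain ⟨i, rfl⟩ := exists_enum_eq (h hk)
    exact ⟨i, hk, rfl⟩

theorem enum_mem_map_iff {S : Finset (Fin n)} {U : Finset (Fin S.card)} {i : Fin S.card} :
    enum S i ∈ U.map (enum S).toEmbedding ↔ i ∈ U := by
  simp

variable {B A : Type*} [Ring B] [Algebra ℂ B] [Ring A] [Algebra ℂ A]

namespace NCPS

variable {P : NCPS B A}

/-- The index sets `Fin m` and `Fin n` are only propositionally equal, so the data are compared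
pointwise after a cast, and the entries in `A` rather than in the faces. -/
theorem BNCFun.congr_cast (Φ : P.BNCFun) {m n : ℕ} (h : m = n) {χ : Fin m → Side}
    {χ' : Fin n → Side} {π : BNC χ} {π' : BNC χ'} {T : P.Entries χ} {T' : P.Entries χ'}
    (hχ : ∀ i, χ i = χ' (Fin.cast h i))
    (hπ : ∀ i j, π.1 i j ↔ π'.1 (Fin.cast h i) (Fin.cast h j))
    (hT : ∀ i, T.coe i = T'.coe (Fin.cast h i)) : Φ χ π T = Φ χ' π' T' := by
  subst h
  obtain rfl : χ = χ' := funext hχ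
  obtain rfl : π = π' := Subtype.ext (Setoid.ext hπ)
  obtain rfl : T = T' := funext fun i => Subtype.ext (hT i)
  rfl

open Classical in
/-- The values `Φ_{π|_S}((T_1, …, T_n)|_S)`, with value `1` for `S = ∅`. -/
def BNCFun.sys (Φ : P.BNCFun) {χ : Fin n → Side} (π : BNC χ) (S : Finset (Fin n))
    (T : P.Entries χ) : B :=
  if S = ∅ then 1 else Φ _ (π.restrict S) (T.restrict S)

theorem BNCFun.sys_empty (Φ : P.BNCFun) {χ : Fin n → Side} (π : BNC χ) (T : P.Entries χ) :
    Φ.sys π ∅ T = 1 := if_pos rfl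

theorem BNCFun.sys_of_nonempty (Φ : P.BNCFun) {χ : Fin n → Side} (π : BNC χ)
    {S : Finset (Fin n)} (hS : S.Nonempty) (T : P.Entries χ) :
    Φ.sys π S T = Φ _ (π.restrict S) (T.restrict S) := if_neg hS.ne_empty

theorem BNCFun.sys_map (Φ : P.BNCFun) {m n : ℕ} (e : Fin m ↪o Fin n) {χ' : Fin m → Side}
    {χ : Fin n → Side} {π' : BNC χ'} {π : BNC χ} {S : Finset (Fin m)} {T' : P.Entries χ'}
    {T : P.Entries χ} (hχ : ∀ i ∈ S, χ' i = χ (e i))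
    (hπ : ∀ i ∈ S, ∀ j ∈ S, π'.1 i j ↔ π.1 (e i) (e j))
    (hT : ∀ i ∈ S, T'.coe i = T.coe (e i)) :
    Φ.sys π' S T' = Φ.sys π (S.map e.toEmbedding) T := by
  rcases S.eq_empty_or_nonempty with rfl | hS
  · rw [Finset.map_empty, sys_empty, sys_empty]
  · rw [sys_of_nonempty _ _ hS, sys_of_nonempty _ _ (hS.map)]
    symm
    refine Φ.congr_cast (Finset.card_map _) (fun i => ?_) (fun i j => ?_) fun i => ?_
    · rw [resSide, resSide, hχ _ (enum_mem _ _), enum_map]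
    · change π.1 _ _ ↔ π'.1 _ _
      rw [hπ _ (enum_mem _ _) _ (enum_mem _ _), enum_map, enum_map]
    · change T.coe (enum _ i) = T'.coe (enum _ _)
      rw [hT _ (enum_mem _ _), enum_map]

theorem BNCFun.sys_congr (Φ : P.BNCFun) {χ : Fin n → Side} {π' π : BNC χ} {S : Finset (Fin n)}
    {T' T : P.Entries χ} (hπ : ∀ i ∈ S, ∀ j ∈ S, π'.1 i j ↔ π.1 i j)
    (hT : ∀ i ∈ S, T' i = T i) : Φ.sys π' S T' = Φ.sys π S T := by
  have := Φ.sys_map (RelEmbedding.refl _) (S := S) (fun _ _ => rfl) hπ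
    (fun i hi => congrArg Subtype.val (hT i hi))
  rw [this]
  congr 1
  exact Finset.map_refl

theorem BNCFun.dependsOnlyOn_sys (Φ : P.BNCFun) {χ : Fin n → Side} (π : BNC χ)
    (S : Finset (Fin n)) : DependsOnlyOn S (Φ.sys π S) :=
  fun _ _ h => Φ.sys_congr (fun _ _ _ _ => Iff.rfl) h

theorem BNCFun.sys_univ (Φ : P.BNCFun) (hn : 0 < n) {χ : Fin n → Side} (π : BNC χ)
    (T : P.Entries χ) : Φ.sys π Finset.univ T = Φ χ π T := by
  have : Nonempty (Fin n) := ⟨⟨0, hn⟩⟩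
  rw [sys_of_nonempty _ _ Finset.univ_nonempty]
  refine Φ.congr_cast (Finset.card_fin n) (fun i => ?_) (fun i j => ?_) fun i => ?_
  · rw [resSide, enum_univ]
  · change π.1 _ _ ↔ π.1 _ _
    rw [enum_univ, enum_univ]
  · change T.coe (enum _ i) = _
    rw [enum_univ]

theorem BNCFun.sys_restrict (Φ : P.BNCFun) {χ : Fin n → Side} (π : BNC χ) (S : Finset (Fin n))
    (S' : Finset (Fin S.card)) (T : P.Entries χ) :
    Φ.sys (π.restrict S) S' (T.restrict S) = Φ.sys π (S'.map (enum S).toEmbedding) T :=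
  Φ.sys_map (enum S) (fun _ _ => rfl) (fun _ _ _ _ => Iff.rfl) fun _ _ => rfl

theorem BNCFun.sys_restrict_univ (Φ : P.BNCFun) {χ : Fin n → Side} (π : BNC χ)
    (S : Finset (Fin n)) (T : P.Entries χ) :
    Φ.sys (π.restrict S) Finset.univ (T.restrict S) = Φ.sys π S T := by
  rw [Φ.sys_restrict, map_enum_univ]

theorem Entries.restrict_update {χ : Fin n → Side} (T : P.Entries χ) (S : Finset (Fin n))
    (i : Fin S.card) (X : P.face (χ (enum S i))) :
    Entries.restrict (Function.update T (enum S i) X : P.Entries χ) S =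
      Function.update (T.restrict S) i X := by
  funext j
  by_cases h : j = i
  · subst h
    simp [Entries.restrict]
  · simp [Entries.restrict, h]

theorem Entries.restrict_after {χ : Fin n → Side} (T : P.Entries χ) (S : Finset (Fin n))
    (i : Fin S.card) (b : B) :
    (T.after (enum S i) b).restrict S = (T.restrict S).after i b :=
  T.restrict_update S i _

theorem Entries.restrict_before {χ : Fin n → Side} (T : P.Entries χ) (S : Finset (Fin n))
    (i : Fin S.card) (b : B) :
    (T.before (enum S i) b).restrict S = (T.restrict S).before i b :=
  T.restrict_update S i _

/-- The relabelling of `S` preserves `≺_χ`, so properties stated for full sets of nodes pass to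
every subset. This is why `IsMultiplicative` mentions only `Finset.univ`. -/
theorem BNCFun.isBalanced_sys (Φ : P.BNCFun) {χ : Fin n → Side} (π : BNC χ) (S : Finset (Fin n))
    (h : IsBalanced (resSide χ S) Finset.univ (Φ.sys (π.restrict S) Finset.univ)) :
    IsBalanced χ S (Φ.sys π S) := by
  constructor
  · intro T b p q hp hq hpq hcons
    obtain ⟨p, rfl⟩ := exists_enum_eq hp
    obtain ⟨q, rfl⟩ := exists_enum_eq hq
    rw [← Φ.sys_restrict_univ π S (T.after _ _), ← Φ.sys_restrict_univ π S (T.before _ _),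
      Entries.restrict_after, Entries.restrict_before]
    refine h.mid _ _ _ _ (Finset.mem_univ _) (Finset.mem_univ _)
      ((pos_resSide_lt_iff χ S).2 hpq) fun k _ hpk => ?_
    rw [pos_resSide_lt_iff] at hpk
    rw [pos_resSide_le_iff]
    exact hcons _ (enum_mem S k) hpk
  · intro T b p hp hfirst
    obtain ⟨p, rfl⟩ := exists_enum_eq hp
    rw [← Φ.sys_restrict_univ π S (T.before _ _), ← Φ.sys_restrict_univ π S T,
      Entries.restrict_before]
    refine h.first _ _ _ (Finset.mem_univ _) fun k _ => ?_
    rw [pos_resSide_le_iff]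
    exact hfirst _ (enum_mem S k)
  · intro T b p hp hlast
    obtain ⟨p, rfl⟩ := exists_enum_eq hp
    rw [← Φ.sys_restrict_univ π S (T.after _ _), ← Φ.sys_restrict_univ π S T,
      Entries.restrict_after]
    refine h.last _ _ _ (Finset.mem_univ _) fun k _ => ?_
    rw [pos_resSide_le_iff]
    exact hlast _ (enum_mem S k)

theorem BNCFun.gapInsert_sys_restrict (Φ : P.BNCFun) {χ : Fin n → Side} (π : BNC χ)
    (S : Finset (Fin n)) (R : Finset (Fin S.card)) (x : Fin S.card) (b : B) (T : P.Entries χ) :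
    gapInsert (Φ.sys (π.restrict S) R) R x b (T.restrict S) =
      gapInsert (Φ.sys π (R.map (enum S).toEmbedding)) (R.map (enum S).toEmbedding) (enum S x) b
        T := by
  rcases exists_isPred_or_forall (resSide χ S) R x with ⟨p, hp⟩ | h
  · have hp' : IsPred χ (R.map (enum S).toEmbedding) (enum S x) (enum S p) := by
      refine ⟨enum_mem_map_iff.2 hp.1, (pos_resSide_lt_iff χ S).1 hp.2.1, fun q hq hqx => ?_⟩
      obtain ⟨q, hqR, rfl⟩ := Finset.mem_map.1 hq
      exact (pos_resSide_le_iff χ S).1 (hp.2.2 q hqR ((pos_resSide_lt_iff χ S).2 hqx))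
    rw [gapInsert_of_isPred hp, gapInsert_of_isPred hp', ← Entries.restrict_after, Φ.sys_restrict]
  · rw [gapInsert_of_forall h, gapInsert_of_forall, Φ.sys_restrict]
    intro k hk
    obtain ⟨k, hkR, rfl⟩ := Finset.mem_map.1 hk
    exact (pos_resSide_le_iff χ S).1 (h k hkR)

theorem BNCFun.removes_sys (Φ : P.BNCFun) {χ : Fin n → Side} (π : BNC χ) (S : Finset (Fin n))
    (h : Removes (π.restrict S).1 (Φ.sys (π.restrict S)) Finset.univ) :
    Removes π.1 (Φ.sys π) S := by
  intro U hUS hsat hint u hu T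
  obtain ⟨U, rfl⟩ := exists_map_enum_eq hUS
  obtain ⟨u, huU, rfl⟩ := Finset.mem_map.1 hu
  have h1 : S \ U.map (enum S).toEmbedding = (Finset.univ \ U).map (enum S).toEmbedding := by
    rw [Finset.map_sdiff, map_enum_univ]
  rw [h1]
  change _ = gapInsert _ _ (enum S u) _ T
  rw [← Φ.sys_restrict_univ, ← Φ.gapInsert_sys_restrict, ← Φ.sys_restrict]
  refine h U (Finset.subset_univ _) ?_ ?_ u huU _
  · intro a ha b _ hab
    exact enum_mem_map_iff.1 (hsat _ (enum_mem_map_iff.2 ha) _ (enum_mem S b) hab)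
  · intro a ha b hb k _ hak hkb
    exact enum_mem_map_iff.1 (hint _ (enum_mem_map_iff.2 ha) _ (enum_mem_map_iff.2 hb) _
      (enum_mem S k) ((pos_resSide_lt_iff χ S).1 hak) ((pos_resSide_lt_iff χ S).1 hkb))

/-! ### Linearity in the entries and the reformulated multiplicativity. -/

/-- `f` is linear in each of the entries in `S`. -/
def IsLinearOn {χ : Fin n → Side} (S : Finset (Fin n)) (f : P.Entries χ → B) : Prop :=
  ∀ (T : P.Entries χ), ∀ k ∈ S, ∀ (c : ℂ) (x y : P.face (χ k)),
    f (Function.update T k (c • x + y)) = c • f (Function.update T k x) + f (Function.update T k y)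

theorem isLinearOn_univ_iff {χ : Fin n → Side} {f : P.Entries χ → B} :
    IsLinearOn Finset.univ f ↔
      ∃ M : MultilinearMap ℂ (fun k => P.face (χ k)) B, ∀ T, f T = M T := by
  constructor
  · intro h
    have hadd : ∀ (T : P.Entries χ) (k : Fin n) (x y : P.face (χ k)),
        f (Function.update T k (x + y)) = f (Function.update T k x) + f (Function.update T k y) :=
      fun T k x y => by simpa using h T k (Finset.mem_univ k) 1 x y
    have hzero : ∀ (T : P.Entries χ) (k : Fin n), f (Function.update T k 0) = 0 := fun T k => by
      simpa using hadd T k 0 0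
    refine ⟨MultilinearMap.mk' f hadd fun T k c x => ?_, fun T => rfl⟩
    simpa [hzero] using h T k (Finset.mem_univ k) c x 0
  · rintro ⟨M, hM⟩ T k - c x y
    rw [hM, hM, hM, M.map_update_add, M.map_update_smul]

theorem IsLinearOn.map_add_after {χ : Fin n → Side} {S : Finset (Fin n)} {f : P.Entries χ → B}
    (hf : IsLinearOn S f) {p : Fin n} (hp : p ∈ S) (T : P.Entries χ) (c : ℂ) (b b' : B) :
    f (T.after p (c • b + b')) = c • f (T.after p b) + f (T.after p b') := by
  unfold Entries.after
  rw [insertAfter_add, insertAfter_smul, hf T p hp]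

theorem IsLinearOn.gapInsert {χ : Fin n → Side} {S : Finset (Fin n)} {f : P.Entries χ → B}
    (hf : IsLinearOn S f) (x : Fin n) (T : P.Entries χ) (c : ℂ) (b b' : B) :
    gapInsert f S x (c • b + b') T = c • gapInsert f S x b T + gapInsert f S x b' T := by
  rcases exists_isPred_or_forall χ S x with ⟨p, hp⟩ | h
  · rw [gapInsert_of_isPred hp, gapInsert_of_isPred hp, gapInsert_of_isPred hp,
      hf.map_add_after hp.1]
  · rw [gapInsert_of_forall h, gapInsert_of_forall h, gapInsert_of_forall h, add_mul,
      smul_mul_assoc]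

theorem BNCFun.isLinearOn_sys (Φ : P.BNCFun) {χ : Fin n → Side} (π : BNC χ) (S : Finset (Fin n))
    (h : IsLinearOn Finset.univ (Φ _ (π.restrict S))) : IsLinearOn S (Φ.sys π S) := by
  intro T k hk c x y
  have hS : S.Nonempty := ⟨k, hk⟩
  obtain ⟨k, rfl⟩ := exists_enum_eq hk
  simp only [Φ.sys_of_nonempty π hS, Entries.restrict_update]
  exact h _ k (Finset.mem_univ k) c x y

/-- A reformulation of bi-multiplicativity in terms of the order `≺_χ`. -/
structure IsMultiplicative (Φ : P.BNCFun) : Prop where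
  linear : ∀ {n : ℕ} (χ : Fin n → Side) (π : BNC χ), IsLinearOn Finset.univ (Φ χ π)
  balanced : ∀ {n : ℕ} (χ : Fin n → Side) (π : BNC χ),
    IsBalanced χ Finset.univ (Φ.sys π Finset.univ)
  removes : ∀ {n : ℕ} (χ : Fin n → Side) (π : BNC χ), Removes π.1 (Φ.sys π) Finset.univ

end NCPS

end BiFree

end

/-! ### Bi-multiplicativity in terms of the order `≺_χ` -/

noncomputable section

namespace BiFree

variable {n : ℕ}

variable {B A : Type*} [Ring B] [Algebra ℂ B] [Ring A] [Algebra ℂ A]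

namespace NCPS

variable {P : NCPS B A}

theorem IsMultiplicative.balanced_sys {Φ : P.BNCFun} (h : IsMultiplicative Φ) {χ : Fin n → Side}
    (π : BNC χ) (S : Finset (Fin n)) : IsBalanced χ S (Φ.sys π S) :=
  Φ.isBalanced_sys π S (h.balanced _ _)

theorem IsMultiplicative.removes_sys {Φ : P.BNCFun} (h : IsMultiplicative Φ) {χ : Fin n → Side}
    (π : BNC χ) (S : Finset (Fin n)) : Removes π.1 (Φ.sys π) S :=
  Φ.removes_sys π S (h.removes _ _)

theorem IsMultiplicative.linear_sys {Φ : P.BNCFun} (h : IsMultiplicative Φ) {χ : Fin n → Side}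
    (π : BNC χ) (S : Finset (Fin n)) : IsLinearOn S (Φ.sys π S) :=
  Φ.isLinearOn_sys π S (h.linear _ _)

section insertions

theorem insertAfter_l {s : Side} (h : s = .l) (b : B) (X : P.face s) :
    P.insertAfter b s X = X * P.bop s b := by subst h; rfl

theorem insertAfter_r {s : Side} (h : s = .r) (b : B) (X : P.face s) :
    P.insertAfter b s X = P.bop s b * X := by subst h; rfl

theorem insertBefore_l {s : Side} (h : s = .l) (b : B) (X : P.face s) :
    P.insertBefore b s X = P.bop s b * X := by subst h; rfl

theorem insertBefore_r {s : Side} (h : s = .r) (b : B) (X : P.face s) :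
    P.insertBefore b s X = X * P.bop s b := by subst h; rfl

variable {χ : Fin n → Side} {p : Fin n}

theorem Entries.after_l (h : χ p = .l) (T : P.Entries χ) (b : B) :
    T.after p b = Function.update T p (T p * P.bop _ b) := by
  rw [Entries.after, insertAfter_l h]

theorem Entries.after_r (h : χ p = .r) (T : P.Entries χ) (b : B) :
    T.after p b = Function.update T p (P.bop _ b * T p) := by
  rw [Entries.after, insertAfter_r h]

theorem Entries.before_l (h : χ p = .l) (T : P.Entries χ) (b : B) :
    T.before p b = Function.update T p (P.bop _ b * T p) := by
  rw [Entries.before, insertBefore_l h]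

theorem Entries.before_r (h : χ p = .r) (T : P.Entries χ) (b : B) :
    T.before p b = Function.update T p (T p * P.bop _ b) := by
  rw [Entries.before, insertBefore_r h]

end insertions

theorem side_ne_l {s : Side} (h : s ≠ .l) : s = .r := by cases s <;> simp_all

theorem side_ne_r {s : Side} (h : s ≠ .r) : s = .l := by cases s <;> simp_all

/-- The conditions on the one-block partitions say that the function is balanced. -/
theorem IsBiMultiplicative.isBalanced_one {Φ : P.BNCFun} (h : IsBiMultiplicative Φ)
    (χ : Fin n → Side) : IsBalanced χ Finset.univ (Φ χ (.one χ)) := by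
  constructor
  · intro T b p q _ _ hpq hcons
    have hcons' : ∀ k, ¬ (pos χ p < pos χ k ∧ pos χ k < pos χ q) := fun k hk =>
      absurd (hcons k (Finset.mem_univ k) hk.1) (by omega)
    rcases side_cases χ p with ⟨hps, hpp⟩ | ⟨hps, hpp⟩ <;>
      rcases side_cases χ q with ⟨hqs, hqp⟩ | ⟨hqs, hqp⟩
    · rw [Entries.after_l hps, Entries.before_l hqs]
      refine (h.left_move χ T b q p ⟨⟨by rw [hps, hqs], by omega⟩, ?_⟩).symm
      rintro k ⟨hk, hkq⟩
      by_contra hkp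
      rw [hqs] at hk
      have := pos_l hk
      exact hcons' k ⟨by omega, by omega⟩
    · obtain ⟨m, rfl⟩ : ∃ m, n = m + 1 := ⟨n - 1, by have := p.2; omega⟩
      -- Here `p` is the last left node and `q` the right node of largest label, so one of them is
      -- the last node of all, which is where condition (i) applies.
      rcases side_cases χ (Fin.last m) with ⟨hls, hlp⟩ | ⟨hls, hlp⟩
      · obtain rfl : p = Fin.last m := by
          by_contra hne
          have h1 : p < Fin.last m := Fin.lt_last_iff_ne_last.2 hne
          exact hcons' (Fin.last m) ⟨by omega, by omega⟩
        rw [Entries.after_l hps, Entries.before_r hqs]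
        refine h.last_move χ T b q ⟨by simp [hps, hqs], fun k hk => ?_⟩
        have hkr : χ k = .r := side_ne_l (hps ▸ hk)
        have := pos_r hkr
        by_contra hkq
        exact hcons' k ⟨by omega, by omega⟩
      · obtain rfl : q = Fin.last m := by
          by_contra hne
          have h1 : q < Fin.last m := Fin.lt_last_iff_ne_last.2 hne
          have h2 := Fin.val_last m
          exact hcons' (Fin.last m) ⟨by omega, by omega⟩
        rw [Entries.after_l hps, Entries.before_r hqs]
        refine (h.last_move χ T b p ⟨by simp [hps, hqs], fun k hk => ?_⟩).symm
        have hkl : χ k = .l := side_ne_r (hqs ▸ hk)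
        have := pos_l hkl
        by_contra hkq
        exact hcons' k ⟨by omega, by omega⟩
    · omega
    · rw [Entries.after_r hps, Entries.before_r hqs]
      refine h.left_move χ T b p q ⟨⟨by rw [hps, hqs], by omega⟩, ?_⟩
      rintro k ⟨hk, hkp⟩
      by_contra hkq
      rw [hps] at hk
      have := pos_r hk
      exact hcons' k ⟨by omega, by omega⟩
  · intro T b p _ hfirst
    rcases side_cases χ p with ⟨hps, hpp⟩ | ⟨hps, hpp⟩
    · rw [Entries.before_l hps, h.left_out χ T b p, hps]
      intro k hkp hk
      have := hfirst k (Finset.mem_univ k)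
      have := pos_l (hk.trans hps)
      omega
    · obtain ⟨m, rfl⟩ : ∃ m, n = m + 1 := ⟨n - 1, by have := p.2; omega⟩
      have hall : ∀ k, χ k = .r ∧ k ≤ p := by
        intro k
        have := hfirst k (Finset.mem_univ k)
        rcases side_cases χ k with ⟨hks, hkp⟩ | ⟨hks, hkp⟩
        · omega
        · exact ⟨hks, by omega⟩
      obtain rfl : p = Fin.last m := le_antisymm (Fin.le_last p) (hall _).2
      rw [Entries.before_r hps, h.last_out χ T b fun k => by rw [(hall k).1, hps], hps]
  · intro T b p _ hlast
    rcases side_cases χ p with ⟨hps, hpp⟩ | ⟨hps, hpp⟩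
    · obtain ⟨m, rfl⟩ : ∃ m, n = m + 1 := ⟨n - 1, by have := p.2; omega⟩
      have hall : ∀ k, χ k = .l ∧ k ≤ p := by
        intro k
        have := hlast k (Finset.mem_univ k)
        rcases side_cases χ k with ⟨hks, hkp⟩ | ⟨hks, hkp⟩
        · exact ⟨hks, by omega⟩
        · omega
      obtain rfl : p = Fin.last m := le_antisymm (Fin.le_last p) (hall _).2
      rw [Entries.after_l hps, h.last_out χ T b fun k => by rw [(hall k).1, hps], hps]
    · rw [Entries.after_r hps, h.left_out χ T b p, hps]
      intro k hkp hk
      have := hlast k (Finset.mem_univ k)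
      have := pos_r (hk.trans hps)
      omega

theorem isPrecLeast_iff {χ : Fin n → Side} {S : Set (Fin n)} {x : Fin n} :
    IsPrecLeast χ S x ↔ x ∈ S ∧ ∀ y ∈ S, pos χ x ≤ pos χ y := by
  refine and_congr_right fun _ => forall₂_congr fun y _ => ?_
  rw [prec_iff]
  constructor
  · rintro (rfl | h)
    · exact le_rfl
    · exact h.le
  · intro h
    by_cases hyx : y = x
    · exact Or.inl hyx
    · exact Or.inr (pos_lt_of_le_of_ne h (Ne.symm hyx))

theorem isPrecGreatest_iff {χ : Fin n → Side} {S : Set (Fin n)} {x : Fin n} :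
    IsPrecGreatest χ S x ↔ x ∈ S ∧ ∀ y ∈ S, pos χ y ≤ pos χ x := by
  refine and_congr_right fun _ => forall₂_congr fun y _ => ?_
  rw [prec_iff]
  constructor
  · rintro (rfl | h)
    · exact le_rfl
    · exact h.le
  · intro h
    by_cases hyx : y = x
    · exact Or.inl hyx
    · exact Or.inr (pos_lt_of_le_of_ne h hyx)

theorem exists_isPrecLeast (χ : Fin n → Side) {S : Finset (Fin n)} (hS : S.Nonempty) :
    ∃ x, IsPrecLeast χ S x := by
  obtain ⟨x, hx, hmin⟩ := Finset.exists_min_image S (pos χ) hS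
  exact ⟨x, isPrecLeast_iff.2 ⟨hx, hmin⟩⟩

theorem exists_isPrecGreatest (χ : Fin n → Side) {S : Finset (Fin n)} (hS : S.Nonempty) :
    ∃ x, IsPrecGreatest χ S x := by
  obtain ⟨x, hx, hmax⟩ := Finset.exists_max_image S (pos χ) hS
  exact ⟨x, isPrecGreatest_iff.2 ⟨hx, hmax⟩⟩

theorem isChiInterval_iff {χ : Fin n → Side} {V : Finset (Fin n)} :
    IsChiInterval χ V ↔ IsIntervalIn χ Finset.univ V := by
  simp [IsChiInterval, IsIntervalIn, prec_iff]

theorem isUnionOfBlocks_iff {π : Setoid (Fin n)} {V : Finset (Fin n)} :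
    IsUnionOfBlocks π V ↔ IsSaturatedIn π Finset.univ V :=
  ⟨fun h a ha b _ hab => h a b hab ha, fun h a b hab ha => h a ha b (Finset.mem_univ b) hab⟩

/-- If `V` is followed by the rest `W` of the nodes, the value is the product of the values on `V`
and on `W`. -/
theorem IsBiMultiplicative.eq_mul {Φ : P.BNCFun} (h : IsBiMultiplicative Φ) {χ : Fin n → Side}
    (T : P.Entries χ) (π : BNC χ) {V W : Finset (Fin n)} (hV : V.Nonempty) (hW : W.Nonempty)
    (hVW : W = Vᶜ) (hπ : IsUnionOfBlocks π.1 V) (hlt : ∀ a ∈ V, ∀ b ∈ W, pos χ a < pos χ b) :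
    Φ χ π T = Φ.sys π V T * Φ.sys π W T := by
  have hn : 0 < n := by
    obtain ⟨x, -⟩ := hV
    exact x.pos
  have hmem : ∀ {k}, k ∈ W ↔ k ∉ V := by simp [hVW]
  rw [h.prod_intervals χ T π ![V, W] hn]
  · rw [Φ.sys_of_nonempty π hV, Φ.sys_of_nonempty π hW]
    simp
  · simpa [Fin.forall_fin_two] using ⟨hV, hW⟩
  · intro k
    by_cases hk : k ∈ V
    · refine ⟨0, hk, fun i hi => ?_⟩
      fin_cases i
      · rfl
      · exact absurd hk (hmem.1 hi)
    · refine ⟨1, hmem.2 hk, fun i hi => ?_⟩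
      fin_cases i
      · exact absurd hi hk
      · rfl
  · simp only [Fin.forall_fin_two, isChiInterval_iff]
    constructor
    · intro a ha b hb k _ hak hkb
      by_contra hk
      exact absurd (hlt b hb k (hmem.2 hk)) (not_lt.2 hkb.le)
    · intro a ha b hb k _ hak hkb
      refine hmem.2 fun hk => ?_
      exact absurd (hlt k hk a ha) (not_lt.2 hak.le)
  · simp only [Fin.forall_fin_two]
    refine ⟨hπ, fun a b hab ha => ?_⟩
    exact hmem.2 fun hb => hmem.1 ha (hπ b a (π.1.symm hab) hb)
  · intro i j hij a ha b hb
    fin_cases i <;> fin_cases j <;> simp at hij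
    exact prec_iff.2 (hlt a ha b hb)

/-- Removal of a proper interval is condition (iii) with two intervals if it is initial or final,
and condition (iv) if it is inner. Balancedness is (i) and (ii) for one block; for more blocks it
follows by removing the block of the largest minimum, as both pieces have fewer nodes and are
balanced by induction. -/
theorem IsBiMultiplicative.isMultiplicative {Φ : P.BNCFun} (h : IsBiMultiplicative Φ) :
    IsMultiplicative Φ := by
  suffices key : ∀ (n : ℕ) (χ : Fin n → Side) (π : BNC χ),
      IsBalanced χ Finset.univ (Φ.sys π Finset.univ) ∧ Removes π.1 (Φ.sys π) Finset.univ from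
    ⟨fun χ π => isLinearOn_univ_iff.2 (h.linear χ π), fun χ π => (key _ χ π).1,
      fun χ π => (key _ χ π).2⟩
  intro n
  induction n using Nat.strong_induction_on with
  | _ n ih =>
  intro χ π
  have hdep := Φ.dependsOnlyOn_sys π
  have hsub : ∀ S : Finset (Fin n), S ≠ Finset.univ →
      IsBalanced χ S (Φ.sys π S) ∧ Removes π.1 (Φ.sys π) S := by
    intro S hS
    have hlt : S.card < n := by
      simpa using Finset.card_lt_univ_of_notMem
        (Classical.not_forall.1 (mt Finset.eq_univ_iff_forall.2 hS)).choose_spec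
    exact ⟨Φ.isBalanced_sys π S (ih _ hlt _ _).1, Φ.removes_sys π S (ih _ hlt _ _).2⟩
  have hrem : Removes π.1 (Φ.sys π) Finset.univ := by
    intro U _ hsat hint u hu T
    by_cases hU : U = Finset.univ
    · rw [hU]
      exact removes_self _ (Φ.sys_empty π) _ u T
    have hne : (Finset.univ \ U).Nonempty := by
      rw [Finset.sdiff_nonempty]
      exact fun h => hU (Finset.univ_subset_iff.1 h)
    have hc : Finset.univ \ U = Uᶜ := (Finset.compl_eq_univ_sdiff U).symm
    have hn : 0 < n := u.pos
    have hmem : ∀ {k}, k ∈ Finset.univ \ U ↔ k ∉ U := by simp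
    have hWb := (hsub (Finset.univ \ U) (by
      intro h
      exact hmem.1 (h.symm.subset (Finset.mem_univ u)) hu)).1
    rw [Φ.sys_univ hn]
    by_cases hpred : ∀ k ∈ Finset.univ \ U, pos χ u ≤ pos χ k
    · rw [gapInsert_of_forall hpred]
      refine h.eq_mul T π ⟨u, hu⟩ hne hc (isUnionOfBlocks_iff.2 hsat) fun a ha b hb => ?_
      refine hint.lt_pos_of_lt hu ha (Finset.mem_univ b) (hmem.1 hb)
        (pos_lt_of_le_of_ne (hpred b hb) ?_)
      rintro rfl
      exact hmem.1 hb hu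
    · push Not at hpred
      obtain ⟨y, hy, hyu⟩ := hpred
      by_cases hsucc : ∀ k ∈ Finset.univ \ U, pos χ k < pos χ u
      · rw [hWb.gapInsert_of_forall_lt hne hsucc]
        refine h.eq_mul T π hne ⟨u, hu⟩ (by rw [hc, compl_compl]) ?_ fun a ha b hb => ?_
        · exact isUnionOfBlocks_iff.2 hsat.sdiff
        · exact hint.pos_lt_of_lt hu hb (Finset.mem_univ a) (hmem.1 ha) (hsucc a ha)
      · push Not at hsucc
        obtain ⟨z, hz, huz⟩ := hsucc
        have huz' : pos χ u < pos χ z := pos_lt_of_le_of_ne huz (by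
          rintro rfl
          exact hmem.1 hz hu)
        obtain ⟨v₀, hv₀⟩ := exists_isPrecLeast χ ⟨u, hu⟩
        obtain ⟨v₁, hv₁⟩ := exists_isPrecGreatest χ ⟨u, hu⟩
        obtain ⟨x₀, hx₀⟩ := exists_isPrecLeast χ (S := Finset.univ) ⟨u, Finset.mem_univ u⟩
        obtain ⟨x₁, hx₁⟩ := exists_isPrecGreatest χ (S := Finset.univ) ⟨u, Finset.mem_univ u⟩
        rw [Finset.coe_univ] at hx₀ hx₁
        obtain ⟨θ, hθ⟩ := exists_isPred hy hyu
        obtain ⟨γ, hγ⟩ := exists_isSucc hz huz'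
        have hv₀' := isPrecLeast_iff.1 hv₀
        have hv₁' := isPrecGreatest_iff.1 hv₁
        have hbefore : ∀ {k}, k ∈ Uᶜ → (pos χ k < pos χ v₀ ↔ pos χ k < pos χ u) := fun hk =>
          ⟨hint.pos_lt_of_lt hv₀'.1 hu (Finset.mem_univ _) (by simpa using hk),
            hint.pos_lt_of_lt hu hv₀'.1 (Finset.mem_univ _) (by simpa using hk)⟩
        have hafter : ∀ {k}, k ∈ Uᶜ → (pos χ v₁ < pos χ k ↔ pos χ u < pos χ k) := fun hk =>
          ⟨hint.lt_pos_of_lt hv₁'.1 hu (Finset.mem_univ _) (by simpa using hk),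
            hint.lt_pos_of_lt hu hv₁'.1 (Finset.mem_univ _) (by simpa using hk)⟩
        rw [gapInsert_of_isPred hθ, Φ.sys_of_nonempty π hne, Φ.sys_of_nonempty π ⟨u, hu⟩]
        rw [hc] at hθ hγ hy hz ⊢
        refine (h.nested χ T π U v₀ v₁ x₀ x₁ θ γ (isChiInterval_iff.2 hint)
          (isUnionOfBlocks_iff.2 hsat) hv₀ hv₁ hx₀ hx₁ ?_ ?_ ?_ ?_).1
        · rw [Finset.mem_compl]
          intro hx
          have h1 := (isPrecLeast_iff.1 hx₀).2 y trivial
          have h2 := hv₀'.2 x₀ hx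
          have h3 := (hbefore hy).2 hyu
          omega
        · rw [Finset.mem_compl]
          intro hx
          have h1 := (isPrecGreatest_iff.1 hx₁).2 z trivial
          have h2 := hv₁'.2 x₁ hx
          have h3 := (hafter hz).2 huz'
          omega
        · refine isPrecGreatest_iff.2 ⟨⟨hθ.1, prec_iff.2 ((hbefore hθ.1).2 hθ.2.1)⟩, ?_⟩
          rintro k ⟨hk, hkv⟩
          exact hθ.2.2 k hk ((hbefore hk).1 (prec_iff.1 hkv))
        · refine isPrecLeast_iff.2 ⟨⟨hγ.1, prec_iff.2 ((hafter hγ.1).2 hγ.2.1)⟩, ?_⟩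
          rintro k ⟨hk, hkv⟩
          exact hγ.2.2 k hk ((hafter hk).1 (prec_iff.1 hkv))
  refine ⟨?_, hrem⟩
  rcases Nat.eq_zero_or_pos n with rfl | hn
  · exact ⟨fun _ _ p => p.elim0, fun _ _ p => p.elim0, fun _ _ p => p.elim0⟩
  by_cases hone : ∀ i j, π.1 i j
  · obtain rfl : π = .one χ := Subtype.ext (Setoid.ext fun i j => iff_of_true (hone i j) trivial)
    have : Φ.sys (.one χ) Finset.univ = Φ χ (.one χ) := funext fun T => Φ.sys_univ hn _ T
    rw [this]
    exact h.isBalanced_one χ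
  · have hne : (Finset.univ : Finset (Fin n)).Nonempty := ⟨⟨0, hn⟩, Finset.mem_univ _⟩
    obtain ⟨v, hv⟩ := exists_isTopMin π.1 hne
    have hvV : v ∈ blockOf π.1 Finset.univ v := mem_blockOf.2 ⟨hv.mem, π.1.refl v⟩
    have hint := isIntervalIn_blockOf (π.isNonCrossingOn Finset.univ) hv
    have hVne : blockOf π.1 Finset.univ v ≠ Finset.univ := fun hV => hone fun i j =>
      rel_blockOf (S := Finset.univ) (v := v) i (hV.symm.subset (Finset.mem_univ i)) j
        (hV.symm.subset (Finset.mem_univ j))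
    refine isBalanced_of_gapInsert (Finset.subset_univ _) hint hvV ?_ (hdep _) (hdep _)
      (hrem _ (Finset.subset_univ _) (isSaturatedIn_blockOf _ _ _) hint v hvV) (hsub _ hVne).1
      (hsub _ ?_).1
    · rw [Finset.sdiff_nonempty]
      exact fun h => hVne (Finset.univ_subset_iff.1 h)
    · intro h
      exact (Finset.mem_sdiff.1 (h ▸ Finset.mem_univ v)).2 hvV

/-- The first interval has no predecessor in the rest, so its removal splits off a left factor. -/
theorem IsMultiplicative.sys_eq_prod {Φ : P.BNCFun} (h : IsMultiplicative Φ) {χ : Fin n → Side}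
    (π : BNC χ) (T : P.Entries χ) : ∀ (m : ℕ) (S : Finset (Fin n)) (V : Fin m → Finset (Fin n)),
    (∀ i, (V i).Nonempty) → (∀ k, k ∈ S ↔ ∃ i, k ∈ V i) → (∀ i, IsUnionOfBlocks π.1 (V i)) →
    (∀ i j, i < j → ∀ a ∈ V i, ∀ b ∈ V j, pos χ a < pos χ b) →
    Φ.sys π S T = (List.ofFn fun i => Φ.sys π (V i) T).prod := by
  intro m
  induction m with
  | zero =>
    intro S V _ hS _ _
    obtain rfl : S = ∅ := by
      ext k
      simp [hS]
    simp [Φ.sys_empty]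
  | succ m ih =>
    intro S V hne hS hsat hlt
    obtain ⟨x, hx⟩ := hne 0
    have hlt0 : ∀ a ∈ V 0, ∀ k ∈ S \ V 0, pos χ a < pos χ k := by
      intro a ha k hk
      rw [Finset.mem_sdiff, hS] at hk
      obtain ⟨⟨i, hi⟩, hk0⟩ := hk
      refine hlt 0 i (Fin.pos_of_ne_zero ?_) a ha k hi
      rintro rfl
      exact hk0 hi
    rw [List.ofFn_succ, List.prod_cons,
      h.removes_sys π S (V 0) (fun k hk => (hS k).2 ⟨0, hk⟩)
        ((isUnionOfBlocks_iff.1 (hsat 0)).mono (Finset.subset_univ _)) ?_ x hx T,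
      gapInsert_of_forall fun k hk => (hlt0 x hx k hk).le]
    · congr 1
      refine ih _ (fun i => V i.succ) (fun i => hne _) (fun k => ?_) (fun i => hsat _)
        fun i j hij => hlt _ _ (Fin.succ_lt_succ_iff.2 hij)
      rw [Finset.mem_sdiff, hS]
      constructor
      · rintro ⟨⟨i, hi⟩, hk0⟩
        refine Fin.cases (fun h0 => absurd h0 hk0) (fun j hj => ⟨j, hj⟩) i hi
      · rintro ⟨i, hi⟩
        refine ⟨⟨_, hi⟩, fun h0 => ?_⟩
        exact absurd (hlt 0 i.succ (Fin.succ_pos i) k h0 k hi) (lt_irrefl _)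
    · intro a ha b hb k hk hak hkb
      by_contra hk0
      exact absurd (hlt0 b hb k (Finset.mem_sdiff.2 ⟨hk, hk0⟩)) (not_lt.2 hkb.le)

/-- In (i) and (ii) the nodes involved are consecutive or extremal for `≺_χ`, so the rules are
instances of balancedness. The second form of (iv) is the first one with the inserted value carried
across the gap. -/
theorem IsMultiplicative.isBiMultiplicative {Φ : P.BNCFun} (h : IsMultiplicative Φ) :
    IsBiMultiplicative Φ := by
  have hbal : ∀ {n : ℕ} (hn : 0 < n) (χ : Fin n → Side) (π : BNC χ),
      IsBalanced χ Finset.univ (Φ χ π) := by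
    intro n hn χ π
    have := h.balanced χ π
    rwa [show Φ.sys π Finset.univ = Φ χ π from funext fun T => Φ.sys_univ hn _ T] at this
  constructor
  · exact fun χ π => isLinearOn_univ_iff.1 (h.linear χ π)
  · intro m χ T b q hq
    have hb := hbal (Nat.succ_pos m) χ (.one χ)
    have hql := hq.1
    have hlt : q < Fin.last m := Fin.lt_last_iff_ne_last.2 (by rintro rfl; exact hql rfl)
    have hl2 := Fin.val_last m
    rcases side_cases χ (Fin.last m) with ⟨hls, hlp⟩ | ⟨hls, hlp⟩
    · have hqs : χ q = .r := side_ne_l (hls ▸ hql)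
      have hqp := pos_r hqs
      rw [← Entries.after_l hls, ← Entries.before_r hqs]
      refine hb.mid T b _ q (Finset.mem_univ _) (Finset.mem_univ _) (by omega) fun k _ hk => ?_
      rcases side_cases χ k with ⟨hks, hkp⟩ | ⟨hks, hkp⟩
      · have := Fin.le_last k
        omega
      · have : k ≤ q := hq.2 (by simp [hls, hks])
        omega
    · have hqs : χ q = .l := side_ne_r (hls ▸ hql)
      have hqp := pos_l hqs
      rw [← Entries.before_r hls, ← Entries.after_l hqs]
      refine (hb.mid T b q _ (Finset.mem_univ _) (Finset.mem_univ _) (by omega)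
        fun k _ hk => ?_).symm
      rcases side_cases χ k with ⟨hks, hkp⟩ | ⟨hks, hkp⟩
      · have : k ≤ q := hq.2 (by simp [hls, hks])
        omega
      · have := Fin.le_last k
        omega
  · intro m χ T b hall
    have hb := hbal (Nat.succ_pos m) χ (.one χ)
    rcases side_cases χ (Fin.last m) with ⟨hls, hlp⟩ | ⟨hls, hlp⟩
    · rw [← Entries.after_l hls, hb.last T b _ (Finset.mem_univ _), hls]
      intro k _
      have := pos_l ((hall k).trans hls)
      have := Fin.le_last k
      omega
    · rw [← Entries.before_r hls, hb.first T b _ (Finset.mem_univ _), hls]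
      intro k _
      have := pos_r ((hall k).trans hls)
      have := Fin.le_last k
      omega
  · intro n χ T b p q hq
    have hb := hbal p.pos χ (.one χ)
    have hqp := hq.1.2
    rcases side_cases χ p with ⟨hps, hpp⟩ | ⟨hps, hpp⟩
    · have hqs : χ q = .l := hq.1.1.trans hps
      have hqpos := pos_l hqs
      rw [← Entries.before_l hps, ← Entries.after_l hqs]
      refine (hb.mid T b q p (Finset.mem_univ _) (Finset.mem_univ _) (by omega)
        fun k _ hk => ?_).symm
      rcases side_cases χ k with ⟨hks, hkp⟩ | ⟨hks, hkp⟩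
      · by_contra hc
        have : k ≤ q := hq.2 ⟨by rw [hks, hps], by omega⟩
        omega
      · omega
    · have hqs : χ q = .r := hq.1.1.trans hps
      have hqpos := pos_r hqs
      rw [← Entries.after_r hps, ← Entries.before_r hqs]
      refine hb.mid T b p q (Finset.mem_univ _) (Finset.mem_univ _) (by omega) fun k _ hk => ?_
      rcases side_cases χ k with ⟨hks, hkp⟩ | ⟨hks, hkp⟩
      · omega
      · by_contra hc
        have : k ≤ q := hq.2 ⟨by rw [hks, hps], by omega⟩
        omega
  · intro n χ T b p hall
    have hb := hbal p.pos χ (.one χ)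
    have hall' : ∀ k, χ k = χ p → p ≤ k := fun k hk => not_lt.1 fun hlt => hall k hlt hk
    rcases side_cases χ p with ⟨hps, hpp⟩ | ⟨hps, hpp⟩
    · rw [← Entries.before_l hps, hb.first T b _ (Finset.mem_univ _), hps]
      intro k _
      rcases side_cases χ k with ⟨hks, hkp⟩ | ⟨hks, hkp⟩
      · have := hall' k (by rw [hks, hps])
        omega
      · omega
    · rw [← Entries.after_r hps, hb.last T b _ (Finset.mem_univ _), hps]
      intro k _
      rcases side_cases χ k with ⟨hks, hkp⟩ | ⟨hks, hkp⟩
      · omega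
      · have := hall' k (by rw [hks, hps])
        omega
  · intro n m χ T π V hn hne hpart hint hsat hlt
    rw [← Φ.sys_univ hn, h.sys_eq_prod π T m Finset.univ V hne
      (fun k => iff_of_true (Finset.mem_univ k) (hpart k).exists) hsat
      fun i j hij a ha b hb => prec_iff.1 (hlt i j hij a ha b hb)]
    simp only [fun i => Φ.sys_of_nonempty π (hne i) T]
  · intro n χ T π V v₀ v₁ x₀ x₁ θ γ hint hsat hv₀ hv₁ hx₀ hx₁ hx₀V hx₁V hθ hγ
    rw [isPrecLeast_iff] at hv₀ hγ
    rw [isPrecGreatest_iff] at hv₁ hθ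
    have hint' := isChiInterval_iff.1 hint
    have hsat' := isUnionOfBlocks_iff.1 hsat
    have hc : Finset.univ \ V = Vᶜ := (Finset.compl_eq_univ_sdiff V).symm
    have hθ1 : IsPred χ Vᶜ v₀ θ := by
      refine ⟨hθ.1.1, prec_iff.1 hθ.1.2, fun k hk hkv => hθ.2 k ⟨hk, prec_iff.2 hkv⟩⟩
    have hγ1 : IsSucc χ Vᶜ v₁ γ := by
      refine ⟨hγ.1.1, prec_iff.1 hγ.1.2, fun k hk hkv => hγ.2 k ⟨hk, prec_iff.2 hkv⟩⟩
    have hW : Vᶜ.Nonempty := ⟨θ, hθ1.1⟩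
    have hrem := h.removes χ π V (Finset.subset_univ _) hsat' hint'
    simp only [hc] at hrem
    constructor
    · rw [← Φ.sys_univ x₀.pos, hrem v₀ hv₀.1 T, gapInsert_of_isPred hθ1, Φ.sys_of_nonempty π hW,
        Φ.sys_of_nonempty π ⟨v₀, hv₀.1⟩]
      rfl
    · rw [← Φ.sys_univ x₀.pos, hrem v₁ hv₁.1 T,
        (h.balanced_sys π Vᶜ).gapInsert_of_isSucc
          (by rw [Finset.mem_compl, not_not]; exact hv₁.1) hγ1,
        Φ.sys_of_nonempty π hW, Φ.sys_of_nonempty π ⟨v₀, hv₀.1⟩]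
      rfl

end NCPS

end BiFree

end

/-! ### The moment function is a bi-moment function -/

noncomputable section

namespace BiFree

variable {n : ℕ}

theorem prec_comp_iff {m : ℕ} (χ : Fin n → Side) (e : Fin m ↪o Fin n) {i j : Fin m} :
    Prec (fun k => χ (e k)) i j ↔ Prec χ (e i) (e j) := by
  unfold Prec
  simp only [OrderEmbedding.lt_iff_lt]

/-- The partition of the nodes other than `q` induced by `π`. -/
def BNC.delete {χ : Fin (n + 1) → Side} (π : BNC χ) (q : Fin (n + 1)) :
    BNC (fun i => χ (q.succAbove i)) :=
  ⟨π.1.comap q.succAbove, fun _ _ _ _ h₁ h₂ h₃ h₄ h₅ =>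
    π.2 _ _ _ _ ((prec_comp_iff χ (Fin.succAboveOrderEmb q)).1 h₁)
      ((prec_comp_iff χ (Fin.succAboveOrderEmb q)).1 h₂)
      ((prec_comp_iff χ (Fin.succAboveOrderEmb q)).1 h₃) h₄ h₅⟩

theorem map_succAbove_univ (q : Fin (n + 1)) :
    Finset.univ.map (Fin.succAboveOrderEmb q).toEmbedding = Finset.univ \ {q} := by
  ext k
  simp only [Finset.mem_map, Finset.mem_univ, true_and, RelEmbedding.coe_toEmbedding,
    Fin.succAboveOrderEmb_apply, Finset.mem_sdiff, Finset.mem_singleton]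
  exact Fin.exists_succAbove_eq_iff

open NCPS in
theorem NCPS.orderedProd_mulInto {A : Type*} [Ring A] {S : Finset (Fin n)} {a b : Fin n}
    (ha : a ∈ S) (hb : b ∈ S) (hab : a < b) (hcons : ∀ k ∈ S, a < k → b ≤ k) (T : Fin n → A) :
    orderedProd (S \ {a}) (Function.update T b (T a * T b)) = orderedProd S T := by
  have haS : a ∉ S \ {a} := by simp
  rw [orderedProd_eq_lt_mul_gt haS, orderedProd_update_of_notMem (by simp [hab.le]),
    orderedProd_update_least, ← mul_assoc, ← orderedProd_insert_split haS, ← Finset.erase_eq,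
    Finset.insert_erase ha]
  refine ⟨by simp [hb, hab, hab.ne'], fun k hk => ?_⟩
  simp only [Finset.coe_filter, Finset.mem_sdiff, Finset.mem_singleton, Set.mem_ofPred_eq] at hk
  exact hcons k hk.1.1 hk.2

variable {B A : Type*} [Ring B] [Algebra ℂ B] [Ring A] [Algebra ℂ A]

namespace NCPS

variable {P : NCPS B A}

/-- The tuple with `T_b` replaced by `T_a T_b`, for nodes `a`, `b` on the same side. -/
def Entries.mulInto {χ : Fin n → Side} (T : P.Entries χ) (a b : Fin n) (h : χ a = χ b) :
    P.Entries χ :=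
  Function.update T b ⟨(T a : A) * (T b : A), mul_mem (h ▸ (T a).2) (T b).2⟩

theorem Entries.coe_mulInto {χ : Fin n → Side} (T : P.Entries χ) (a b : Fin n) (h : χ a = χ b) :
    (T.mulInto a b h).coe = Function.update T.coe b (T.coe a * T.coe b) := by
  rw [Entries.mulInto, Entries.coe_update]
  rfl

theorem Entries.coe_merge {χ : Fin (n + 1) → Side} (T : P.Entries χ) (q : Fin n)
    (h : χ q.castSucc = χ q.succ) (i : Fin n) :
    (T.merge q h).coe i = (T.mulInto q.castSucc q.succ h).coe (q.castSucc.succAbove i) := by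
  rw [Entries.coe_mulInto]
  have h1 : q.castSucc.succAbove q = q.succ := Fin.succAbove_castSucc_self q
  by_cases hi : i = q
  · subst hi
    simp [Entries.coe, Entries.merge]
  · have h2 : q.castSucc.succAbove i ≠ q.succ := fun h =>
      hi (Fin.succAbove_right_injective (h.trans h1.symm))
    simp [Entries.coe, Entries.merge, hi, h2]

/-- The value at the merged tuple, in terms of the original nodes. -/
theorem BNCFun.delete_merge (Φ : P.BNCFun) {χ : Fin (n + 1) → Side} (π : BNC χ) (q : Fin n)
    (h : χ q.castSucc = χ q.succ) (T : P.Entries χ) :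
    Φ _ (π.delete q.castSucc) (T.merge q h) =
      Φ.sys π (Finset.univ \ {q.castSucc}) (T.mulInto q.castSucc q.succ h) := by
  rw [← Φ.sys_univ q.pos, ← map_succAbove_univ]
  exact Φ.sys_map _ (fun _ _ => rfl) (fun _ _ _ _ => Iff.rfl) fun i _ => T.coe_merge q h i

/-- The recursion is invariant under relabelling (`Epi_map`), so restricting and then evaluating
agrees with running the recursion on a subset of the nodes. -/
theorem momentFun_sys {χ : Fin n → Side} (π : BNC χ) (S : Finset (Fin n)) :
    P.momentFun.sys π S = epiSys P χ π.1 S := by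
  funext T
  rcases S.eq_empty_or_nonempty with rfl | hS
  · rw [BNCFun.sys_empty, epiSys_empty]
  · rw [BNCFun.sys_of_nonempty _ _ hS, epiSys_of_nonempty hS]
    conv_rhs => rw [← map_enum_univ S]
    exact Epi_map (enum S) χ _ π.1 _ Finset.univ T.coe _ (fun _ _ => rfl)
      (fun _ _ _ _ => Iff.rfl) fun _ _ => rfl

/-- An entry of `V` acts through the inserted element, on which `gapInsert` depends linearly; an
entry outside acts on `h`, possibly at the very node that receives the insertion, which is linear in
that entry too. -/
theorem IsLinearOn.of_gapInsert {χ : Fin n → Side} {S V : Finset (Fin n)} {x : Fin n}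
    {f g h : P.Entries χ → B} (hg : DependsOnlyOn V g) (hh : DependsOnlyOn (S \ V) h)
    (hf : ∀ T, f T = NCPS.gapInsert h (S \ V) x (g T) T)
    (hgl : IsLinearOn V g) (hhl : IsLinearOn (S \ V) h) : IsLinearOn S f := by
  intro T k hk c y z
  rw [hf, hf, hf]
  by_cases hkV : k ∈ V
  · have hkW : k ∉ S \ V := by simp [hkV]
    have hT : ∀ (X : P.face (χ k)) (b : B),
        NCPS.gapInsert h (S \ V) x b (Function.update T k X) = NCPS.gapInsert h (S \ V) x b T :=
      fun X b => gapInsert_congr hh b fun j hj =>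
        Function.update_of_ne (ne_of_mem_of_not_mem hj hkW) _ _
    rw [hT, hT, hT, hgl T k hkV, hhl.gapInsert]
  · have hkW : k ∈ S \ V := by simp [hk, hkV]
    have hT : ∀ X : P.face (χ k), g (Function.update T k X) = g T := fun X =>
      hg _ _ fun j hj => Function.update_of_ne (ne_of_mem_of_not_mem hj hkV) _ _
    rw [hT, hT, hT]
    rcases exists_isPred_or_forall χ (S \ V) x with ⟨p, hp⟩ | hn
    · rw [gapInsert_of_isPred hp, gapInsert_of_isPred hp, gapInsert_of_isPred hp]
      by_cases hpk : p = k
      · subst hpk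
        simp only [Entries.update_after_self, insertAfter_add_right, insertAfter_smul_right]
        exact hhl T p hkW c _ _
      · simp only [Entries.update_after T hpk]
        exact hhl _ k hkW c _ _
    · rw [gapInsert_of_forall hn, gapInsert_of_forall hn, gapInsert_of_forall hn, hhl T k hkW,
        mul_add, mul_smul_comm]

theorem isLinearOn_E_orderedProd (P : NCPS B A) (χ : Fin n → Side) (S : Finset (Fin n)) :
    IsLinearOn S fun T : P.Entries χ => P.E (orderedProd S T.coe) := by
  intro T k hk c x y
  have key : ∀ X : P.face (χ k), orderedProd S (Entries.coe (Function.update T k X)) =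
      orderedProd {j ∈ S | j < k} T.coe * X * orderedProd {j ∈ S | k < j} T.coe := by
    intro X
    rw [Entries.coe_update, orderedProd_split hk, Function.update_self,
      orderedProd_update_of_notMem (by simp), orderedProd_update_of_notMem (by simp)]
  simp only [key]
  rw [← map_smul, ← map_add]
  congr 1
  simp [mul_add, add_mul]

theorem isLinearOn_epiSys {χ : Fin n → Side} {π : Setoid (Fin n)} :
    ∀ S : Finset (Fin n), IsNonCrossingOn χ π S → IsLinearOn S (epiSys P χ π S) := by
  intro S
  induction S using Finset.strongInduction with
  | _ S ih =>
  intro hπ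
  rcases S.eq_empty_or_nonempty with rfl | hne
  · intro T k hk
    exact absurd hk (Finset.notMem_empty k)
  obtain ⟨v, hv⟩ := exists_isTopMin π hne
  have hvV : v ∈ blockOf π S v := mem_blockOf.2 ⟨hv.mem, π.refl v⟩
  have hdep := dependsOnlyOn_epiSys P χ π
  refine IsLinearOn.of_gapInsert (hdep _) (hdep _)
    ((isBalanced_and_removes_epiSys P χ π S hπ).2 _ blockOf_subset (isSaturatedIn_blockOf π S v)
      (isIntervalIn_blockOf hπ hv) v hvV) ?_ ?_
  · rw [epiSys_of_forall_rel ⟨v, hvV⟩ rel_blockOf]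
    exact isLinearOn_E_orderedProd P χ _
  · exact ih _ (Finset.sdiff_ssubset blockOf_subset ⟨v, hvV⟩) (hπ.mono Finset.sdiff_subset)

theorem isMultiplicative_momentFun (P : NCPS B A) : IsMultiplicative P.momentFun := by
  constructor
  · intro n χ π
    rcases Nat.eq_zero_or_pos n with rfl | hn
    · exact fun _ k => k.elim0
    · have : P.momentFun χ π = epiSys P χ π.1 Finset.univ := by
        rw [← momentFun_sys]
        exact funext fun T => (P.momentFun.sys_univ hn π T).symm
      rw [this]
      exact isLinearOn_epiSys _ (π.isNonCrossingOn _)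
  · intro n χ π
    rw [momentFun_sys]
    exact (isBalanced_and_removes_epiSys P χ π.1 _ (π.isNonCrossingOn _)).1
  · intro n χ π
    have : P.momentFun.sys π = epiSys P χ π.1 := funext (momentFun_sys π)
    rw [this]
    exact (isBalanced_and_removes_epiSys P χ π.1 _ (π.isNonCrossingOn _)).2

/-- The operator-valued bi-free moment function is a bi-moment function. -/
theorem isBiMoment_momentFun (P : NCPS B A) : IsBiMoment P.momentFun := by
  refine ⟨(isMultiplicative_momentFun P).isBiMultiplicative, ?_⟩
  intro n χ q h T
  refine Eq.trans ?_ (P.momentFun.delete_merge (.one χ) q h T).symm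
  rw [← P.momentFun.sys_univ (Nat.succ_pos n),
    momentFun_sys, momentFun_sys, epiSys_of_forall_rel, epiSys_of_forall_rel]
  · dsimp only
    rw [Entries.coe_mulInto]
    refine congrArg _ (orderedProd_mulInto (Finset.mem_univ _) (Finset.mem_univ _)
      (Fin.castSucc_lt_succ) (fun k _ hk => ?_) _).symm
    exact Fin.castSucc_lt_iff_succ_le.1 hk
  · exact ⟨q.succ, by simp [Fin.ext_iff]⟩
  · exact fun _ _ _ _ => trivial
  · exact ⟨q.succ, Finset.mem_univ _⟩
  · exact fun _ _ _ _ => trivial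

end NCPS

end BiFree

end

/-! ### Convolution -/

noncomputable section

namespace BiFree

variable {n : ℕ}

variable {B A : Type*} [Ring B] [Algebra ℂ B] [Ring A] [Algebra ℂ A]

theorem BNC.le_iff {χ : Fin n → Side} {σ π : BNC χ} : σ ≤ π ↔ ∀ i j, σ.1 i j → π.1 i j :=
  ⟨fun h _ _ hij => h hij, fun h i j hij => h i j hij⟩

/-- A partition of `U` and a partition of its complement, both finer than `π`, are the restrictions
of a bi-non-crossing partition finer than `π`, if `U` is a union of blocks of `π`. -/
theorem BNC.exists_glue {χ : Fin n → Side} (π : BNC χ) {U : Finset (Fin n)}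
    (hU : IsSaturatedIn π.1 Finset.univ U) (σ₁ : BNC (resSide χ U))
    (σ₂ : BNC (resSide χ (Finset.univ \ U))) (h₁ : σ₁ ≤ π.restrict U)
    (h₂ : σ₂ ≤ π.restrict (Finset.univ \ U)) :
    ∃ σ : BNC χ, σ ≤ π ∧ σ.restrict U = σ₁ ∧ σ.restrict (Finset.univ \ U) = σ₂ := by
  let r : Fin n → Fin n → Prop := fun x y =>
    (∃ i j, enum U i = x ∧ enum U j = y ∧ σ₁.1 i j) ∨
      ∃ i j, enum (Finset.univ \ U) i = x ∧ enum (Finset.univ \ U) j = y ∧ σ₂.1 i j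
  have hne : ∀ i j, enum U i ≠ enum (Finset.univ \ U) j := fun i j h =>
    (Finset.mem_sdiff.1 (enum_mem _ j)).2 (h ▸ enum_mem U i)
  have hr₁ : ∀ i j, r (enum U i) (enum U j) ↔ σ₁.1 i j := by
    intro i j
    constructor
    · rintro (⟨i', j', hi, hj, h⟩ | ⟨i', j', hi, hj, h⟩)
      · rw [(enum U).injective hi, (enum U).injective hj] at h
        exact h
      · exact absurd hi.symm (hne _ _)
    · exact fun h => Or.inl ⟨i, j, rfl, rfl, h⟩
  have hr₂ : ∀ i j, r (enum (Finset.univ \ U) i) (enum (Finset.univ \ U) j) ↔ σ₂.1 i j := by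
    intro i j
    constructor
    · rintro (⟨i', j', hi, hj, h⟩ | ⟨i', j', hi, hj, h⟩)
      · exact absurd hi (hne _ _)
      · rw [(enum _).injective hi, (enum _).injective hj] at h
        exact h
    · exact fun h => Or.inr ⟨i, j, rfl, rfl, h⟩
  have hcase : ∀ x, (∃ i, enum U i = x) ∨ ∃ i, enum (Finset.univ \ U) i = x := by
    intro x
    by_cases hx : x ∈ U
    · exact Or.inl (exists_enum_eq hx)
    · exact Or.inr (exists_enum_eq (by simp [hx]))
  have hrefl : ∀ x, r x x := by
    intro x
    rcases hcase x with ⟨i, rfl⟩ | ⟨i, rfl⟩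
    · exact (hr₁ i i).2 (σ₁.1.refl i)
    · exact (hr₂ i i).2 (σ₂.1.refl i)
  have hsymm : ∀ {x y}, r x y → r y x := by
    rintro x y (⟨i, j, rfl, rfl, h⟩ | ⟨i, j, rfl, rfl, h⟩)
    · exact (hr₁ j i).2 (σ₁.1.symm h)
    · exact (hr₂ j i).2 (σ₂.1.symm h)
  have htrans : ∀ {x y z}, r x y → r y z → r x z := by
    rintro x y z (⟨i, j, rfl, rfl, h⟩ | ⟨i, j, rfl, rfl, h⟩) hyz
    · rcases hcase z with ⟨k, rfl⟩ | ⟨k, rfl⟩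
      · exact (hr₁ i k).2 (σ₁.1.trans h ((hr₁ j k).1 hyz))
      · rcases hyz with ⟨_, _, _, hk, _⟩ | ⟨_, _, hj, _, _⟩
        · exact absurd hk (hne _ _)
        · exact absurd hj.symm (hne _ _)
    · rcases hcase z with ⟨k, rfl⟩ | ⟨k, rfl⟩
      · rcases hyz with ⟨_, _, hj, _, _⟩ | ⟨_, _, _, hk, _⟩
        · exact absurd hj (hne _ _)
        · exact absurd hk.symm (hne _ _)
      · exact (hr₂ i k).2 (σ₂.1.trans h ((hr₂ j k).1 hyz))
  have hle : ∀ {x y}, r x y → π.1 x y := by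
    rintro x y (⟨i, j, rfl, rfl, h⟩ | ⟨i, j, rfl, rfl, h⟩)
    · exact h₁ h
    · exact h₂ h
  have hsame : ∀ {x y}, π.1 x y → (x ∈ U ↔ y ∈ U) := fun h =>
    ⟨fun hx => hU _ hx _ (Finset.mem_univ _) h,
      fun hy => hU _ hy _ (Finset.mem_univ _) (π.1.symm h)⟩
  refine ⟨⟨⟨r, hrefl, hsymm, htrans⟩, ?_⟩, BNC.le_iff.2 fun _ _ => hle,
    Subtype.ext (Setoid.ext hr₁), Subtype.ext (Setoid.ext hr₂)⟩
  intro u₁ v₁ u₂ v₂ h12 h23 h34 hu hv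
  -- Because `π` is non-crossing, four nodes in crossing position lie in one block of `π`, hence all
  -- in `U` or all outside. There the partition is one of the two given ones.
  have huv := π.2 u₁ v₁ u₂ v₂ h12 h23 h34 (hle hu) (hle hv)
  have hu' := hsame (hle hu)
  have hv' := hsame (hle hv)
  have huv' := hsame huv
  by_cases hx : u₁ ∈ U
  · obtain ⟨i, rfl⟩ := exists_enum_eq hx
    obtain ⟨j, rfl⟩ := exists_enum_eq (hu'.1 hx)
    obtain ⟨k, rfl⟩ := exists_enum_eq (huv'.1 hx)
    obtain ⟨l, rfl⟩ := exists_enum_eq (hv'.1 (huv'.1 hx))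
    exact (hr₁ _ _).2 (σ₁.2 i k j l ((prec_comp_iff χ (enum U)).2 h12)
      ((prec_comp_iff χ (enum U)).2 h23) ((prec_comp_iff χ (enum U)).2 h34)
      ((hr₁ _ _).1 hu) ((hr₁ _ _).1 hv))
  · have hmem : ∀ {y}, (u₁ ∈ U ↔ y ∈ U) → y ∈ Finset.univ \ U := fun hy => by
      rw [Finset.mem_sdiff, ← hy]
      exact ⟨Finset.mem_univ _, hx⟩
    obtain ⟨i, rfl⟩ := exists_enum_eq (hmem Iff.rfl)
    obtain ⟨j, rfl⟩ := exists_enum_eq (hmem hu')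
    obtain ⟨k, rfl⟩ := exists_enum_eq (hmem huv')
    obtain ⟨l, rfl⟩ := exists_enum_eq (hmem (huv'.trans hv'))
    exact (hr₂ _ _).2 (σ₂.2 i k j l ((prec_comp_iff χ (enum _)).2 h12)
      ((prec_comp_iff χ (enum _)).2 h23) ((prec_comp_iff χ (enum _)).2 h34)
      ((hr₂ _ _).1 hu) ((hr₂ _ _).1 hv))

theorem IsSaturatedIn.mono_rel {σ π : Setoid (Fin n)} {S U : Finset (Fin n)}
    (hU : IsSaturatedIn π S U) (h : σ ≤ π) : IsSaturatedIn σ S U :=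
  fun a ha b hb hab => hU a ha b hb (h hab)

theorem BNC.restrict_mono {χ : Fin n → Side} {σ π : BNC χ} (h : σ ≤ π) (U : Finset (Fin n)) :
    σ.restrict U ≤ π.restrict U := fun _ _ hij => h hij

theorem BNC.restrict_eq_iff {χ : Fin n → Side} {σ π : BNC χ} {U : Finset (Fin n)} :
    σ.restrict U = π.restrict U ↔ ∀ x ∈ U, ∀ y ∈ U, σ.1 x y ↔ π.1 x y := by
  constructor
  · intro h x hx y hy
    obtain ⟨i, rfl⟩ := exists_enum_eq hx
    obtain ⟨j, rfl⟩ := exists_enum_eq hy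
    have := congrArg (fun ρ : BNC (resSide χ U) => ρ.1 i j) h
    exact iff_of_eq this
  · exact fun h => Subtype.ext (Setoid.ext fun i j => h _ (enum_mem U i) _ (enum_mem U j))

/-- A partition finer than `π` is determined by its restrictions to a union of blocks of `π` and to
the complement. -/
theorem BNC.eq_of_restrict_eq {χ : Fin n → Side} {π σ σ' : BNC χ} {U : Finset (Fin n)}
    (hU : IsSaturatedIn π.1 Finset.univ U) (hσ : σ ≤ π) (hσ' : σ' ≤ π)
    (h₁ : σ.restrict U = σ'.restrict U)
    (h₂ : σ.restrict (Finset.univ \ U) = σ'.restrict (Finset.univ \ U)) : σ = σ' := by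
  rw [BNC.restrict_eq_iff] at h₁ h₂
  refine Subtype.ext (Setoid.ext fun x y => ?_)
  by_cases hx : x ∈ U <;> by_cases hy : y ∈ U
  · exact h₁ x hx y hy
  · exact iff_of_false (fun h => hy (hU x hx y (Finset.mem_univ y) (hσ h)))
      fun h => hy (hU x hx y (Finset.mem_univ y) (hσ' h))
  · exact iff_of_false (fun h => hx (hU y hy x (Finset.mem_univ x) (hσ (σ.1.symm h))))
      fun h => hx (hU y hy x (Finset.mem_univ x) (hσ' (σ'.1.symm h)))
  · exact h₂ x (by simp [hx]) y (by simp [hy])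

namespace NCPS

variable {P : NCPS B A}

theorem BNCFun.conv_apply (Φ : P.BNCFun) (f : IA) {χ : Fin n → Side} (π : BNC χ)
    (T : P.Entries χ) [DecidablePred fun σ : BNC χ => σ ≤ π] :
    Φ.conv f χ π T = ∑ σ : BNC χ with σ ≤ π, f χ σ π • Φ χ σ T := by
  unfold BNCFun.conv
  congr!

/-- The incidence algebra acts from the right; exchanging the two sums produces the sum over the
interval `[ρ, π]` that defines its product. -/
theorem BNCFun.conv_conv (Φ : P.BNCFun) (f g : IA) :
    (Φ.conv f).conv g = Φ.conv fun _ χ => f χ * g χ := by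
  classical
  funext n χ π T
  simp only [BNCFun.conv_apply, Finset.smul_sum]
  rw [Finset.sum_comm' (s' := fun ρ => Finset.Icc ρ π) (t' := Finset.univ.filter fun ρ => ρ ≤ π)]
  · refine Finset.sum_congr rfl fun ρ _ => ?_
    rw [IncidenceAlgebra.mul_apply, Finset.sum_smul]
    refine Finset.sum_congr rfl fun σ _ => ?_
    rw [smul_smul, mul_comm]
  · intro σ ρ
    simp only [Finset.mem_filter, Finset.mem_univ, true_and, Finset.mem_Icc]
    exact ⟨fun h => ⟨⟨h.2, h.1⟩, h.2.trans h.1⟩, fun h => ⟨h.1.2, h.1.1⟩⟩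

open Classical in
theorem BNCFun.conv_eq_self (Φ : P.BNCFun) {f : IA}
    (hf : ∀ {n : ℕ} (χ : Fin n → Side), f χ = 1) : Φ.conv f = Φ := by
  funext n χ π T
  rw [BNCFun.conv_apply, Finset.sum_eq_single_of_mem π (by simp)]
  · simp [hf, IncidenceAlgebra.one_apply]
  · intro σ _ h
    simp [hf, IncidenceAlgebra.one_apply, h]

open Classical in
theorem BNCFun.conv_zeta_conv_mu (Φ : P.BNCFun) : (Φ.conv zetaBNC).conv muBNC = Φ := by
  rw [BNCFun.conv_conv]
  exact Φ.conv_eq_self fun _ => IncidenceAlgebra.zeta_mul_mu ..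

open Classical in
theorem BNCFun.conv_mu_conv_zeta (Φ : P.BNCFun) : (Φ.conv muBNC).conv zetaBNC = Φ := by
  rw [BNCFun.conv_conv]
  exact Φ.conv_eq_self fun _ => IncidenceAlgebra.mu_mul_zeta ..

open Classical in
theorem BNCFun.conv_zeta_apply (Φ : P.BNCFun) {χ : Fin n → Side} (π : BNC χ)
    (T : P.Entries χ) [DecidablePred fun σ : BNC χ => σ ≤ π] :
    Φ.conv zetaBNC χ π T = ∑ σ : BNC χ with σ ≤ π, Φ χ σ T := by
  rw [BNCFun.conv_apply]
  refine Finset.sum_congr rfl fun σ hσ => ?_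
  rw [zetaBNC, IncidenceAlgebra.zeta_of_le (Finset.mem_filter.1 hσ).2, one_smul]

section sums

variable {χ : Fin n → Side} {ι : Type*} (I : Finset ι) {S : Finset (Fin n)}

theorem isLinearOn_sum {f : ι → P.Entries χ → B} (c : ι → ℂ) (hf : ∀ i ∈ I, IsLinearOn S (f i)) :
    IsLinearOn S fun T => ∑ i ∈ I, c i • f i T := by
  intro T k hk d x y
  simp only [Finset.smul_sum, ← Finset.sum_add_distrib]
  refine Finset.sum_congr rfl fun i hi => ?_
  rw [hf i hi T k hk d x y, smul_add, smul_comm]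

theorem isBalanced_sum {f : ι → P.Entries χ → B} (c : ι → ℂ) (hf : ∀ i ∈ I, IsBalanced χ S (f i)) :
    IsBalanced χ S fun T => ∑ i ∈ I, c i • f i T := by
  constructor
  · intro T b p q hp hq hpq hcons
    exact Finset.sum_congr rfl fun i hi => by rw [(hf i hi).mid T b p q hp hq hpq hcons]
  · intro T b p hp h
    simp only [Finset.mul_sum, mul_smul_comm]
    exact Finset.sum_congr rfl fun i hi => by rw [(hf i hi).first T b p hp h]
  · intro T b p hp h
    simp only [Finset.sum_mul, smul_mul_assoc]
    exact Finset.sum_congr rfl fun i hi => by rw [(hf i hi).last T b p hp h]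

theorem gapInsert_sum_fun (f : ι → P.Entries χ → B) (x : Fin n) (b : B) (T : P.Entries χ) :
    gapInsert (fun T => ∑ i ∈ I, f i T) S x b T = ∑ i ∈ I, gapInsert (f i) S x b T := by
  rcases exists_isPred_or_forall χ S x with ⟨p, hp⟩ | h
  · simp only [gapInsert_of_isPred hp]
  · simp only [gapInsert_of_forall h, Finset.mul_sum]

theorem IsLinearOn.gapInsert_sum {f : P.Entries χ → B} (hf : IsLinearOn S f) (x : Fin n)
    (b : ι → B) (T : P.Entries χ) :
    NCPS.gapInsert f S x (∑ i ∈ I, b i) T = ∑ i ∈ I, NCPS.gapInsert f S x (b i) T := by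
  let φ : B →+ B := AddMonoidHom.mk' (fun b => NCPS.gapInsert f S x b T) fun b b' => by
    simpa using hf.gapInsert x T 1 b b'
  exact map_sum φ b I

end sums

theorem IsLinearOn.comp_restrict {χ : Fin n → Side} {S : Finset (Fin n)}
    {f : P.Entries (resSide χ S) → B} (hf : IsLinearOn Finset.univ f) :
    IsLinearOn S fun T => f (T.restrict S) := by
  intro T k hk c x y
  obtain ⟨k, rfl⟩ := exists_enum_eq hk
  simp only [Entries.restrict_update]
  exact hf _ k (Finset.mem_univ k) c x y

open Classical in
/-- The sum over the partitions finer than `π` factors over a union of blocks of `π`. -/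
theorem BNCFun.sum_gapInsert (Ψ : P.BNCFun)
    (hΨ : ∀ {n : ℕ} (χ : Fin n → Side) (π : BNC χ), IsLinearOn Finset.univ (Ψ χ π))
    {χ : Fin n → Side} (π : BNC χ) {U : Finset (Fin n)}
    (hU : IsSaturatedIn π.1 Finset.univ U) (hne : U.Nonempty) (hne' : (Finset.univ \ U).Nonempty)
    (u : Fin n) (T : P.Entries χ) :
    ∑ σ : BNC χ with σ ≤ π,
        gapInsert (Ψ.sys σ (Finset.univ \ U)) (Finset.univ \ U) u (Ψ.sys σ U T) T =
      gapInsert ((Ψ.conv zetaBNC).sys π (Finset.univ \ U)) (Finset.univ \ U) u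
        ((Ψ.conv zetaBNC).sys π U T) T := by
  have h1 : (Ψ.conv zetaBNC).sys π (Finset.univ \ U) = fun T =>
      ∑ σ : BNC (resSide χ (Finset.univ \ U)) with σ ≤ π.restrict _,
        Ψ _ σ (T.restrict (Finset.univ \ U)) := by
    funext T
    rw [BNCFun.sys_of_nonempty _ _ hne', BNCFun.conv_zeta_apply]
  rw [h1, BNCFun.sys_of_nonempty _ _ hne, BNCFun.conv_zeta_apply, gapInsert_sum_fun]
  -- The insertion is additive in the function and, by linearity, in the inserted element, so the
  -- right side becomes a double sum. Its index pairs are the restrictions of the partitions `σ ≤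
  -- π`, by `BNC.exists_glue` and `BNC.eq_of_restrict_eq`.
  rw [Finset.sum_congr rfl fun σ _ => (hΨ _ σ).comp_restrict.gapInsert_sum _ u _ T,
    ← Finset.sum_product']
  refine Finset.sum_bij (fun σ _ => (σ.restrict (Finset.univ \ U), σ.restrict U)) ?_ ?_ ?_ ?_
  · intro σ hσ
    have hσ := (Finset.mem_filter.1 hσ).2
    simp only [Finset.mem_product, Finset.mem_filter, Finset.mem_univ, true_and]
    exact ⟨BNC.restrict_mono hσ _, BNC.restrict_mono hσ _⟩
  · intro σ hσ σ' hσ' h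
    exact BNC.eq_of_restrict_eq hU (Finset.mem_filter.1 hσ).2 (Finset.mem_filter.1 hσ').2
      (congrArg Prod.snd h) (congrArg Prod.fst h)
  · rintro ⟨σ₂, σ₁⟩ h
    simp only [Finset.mem_product, Finset.mem_filter, Finset.mem_univ, true_and] at h
    obtain ⟨σ, hσ, rfl, rfl⟩ := π.exists_glue hU σ₁ σ₂ h.2 h.1
    exact ⟨σ, by simpa using hσ, rfl⟩
  · intro σ _
    have : Ψ.sys σ (Finset.univ \ U) = fun T => Ψ _ (σ.restrict _) (T.restrict _) :=
      funext fun T => Ψ.sys_of_nonempty σ hne' T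
    rw [this, Ψ.sys_of_nonempty σ hne]

theorem isBalanced_of_sys (Φ : P.BNCFun) (hn : 0 < n) {χ : Fin n → Side} {π : BNC χ} :
    IsBalanced χ Finset.univ (Φ.sys π Finset.univ) ↔ IsBalanced χ Finset.univ (Φ χ π) := by
  rw [show Φ.sys π Finset.univ = Φ χ π from funext fun T => Φ.sys_univ hn π T]

theorem IsMultiplicative.linear_conv {Φ : P.BNCFun} (h : IsMultiplicative Φ) (f : IA)
    (χ : Fin n → Side) (π : BNC χ) : IsLinearOn Finset.univ (Φ.conv f χ π) :=
  isLinearOn_sum _ _ fun σ _ => h.linear χ σ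

/-- Balancedness consists of linear conditions for a fixed `χ`, so it survives convolution with any
`f`, as linearity does. Only removal depends on the choice of `f`. -/
theorem IsMultiplicative.balanced_conv {Φ : P.BNCFun} (h : IsMultiplicative Φ) (f : IA)
    (χ : Fin n → Side) (π : BNC χ) :
    IsBalanced χ Finset.univ ((Φ.conv f).sys π Finset.univ) := by
  rcases Nat.eq_zero_or_pos n with rfl | hn
  · exact ⟨fun _ _ p => p.elim0, fun _ _ p => p.elim0, fun _ _ p => p.elim0⟩
  · rw [isBalanced_of_sys _ hn]
    exact isBalanced_sum _ _ fun σ _ => (isBalanced_of_sys _ hn).1 (h.balanced χ σ)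

open Classical in
theorem IsMultiplicative.conv_zeta {Ψ : P.BNCFun} (h : IsMultiplicative Ψ) :
    IsMultiplicative (Ψ.conv zetaBNC) := by
  refine ⟨h.linear_conv _, h.balanced_conv _, ?_⟩
  intro n χ π U hUs hsat hint u hu T
  by_cases hU : U = Finset.univ
  · rw [hU]
    exact removes_self _ ((Ψ.conv zetaBNC).sys_empty π) _ u T
  have hne : (Finset.univ \ U).Nonempty := by
    rw [Finset.sdiff_nonempty]
    exact fun h => hU (Finset.univ_subset_iff.1 h)
  change _ = gapInsert _ _ u _ T
  rw [← Ψ.sum_gapInsert h.linear π hsat ⟨u, hu⟩ hne, BNCFun.sys_univ _ u.pos,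
    BNCFun.conv_zeta_apply]
  refine Finset.sum_congr rfl fun σ hσ => ?_
  rw [← Ψ.sys_univ u.pos]
  exact h.removes χ σ U hUs (IsSaturatedIn.mono_rel hsat (Finset.mem_filter.1 hσ).2) hint u hu T

-- For each `σ ≤ π` the set `U` is also a union of blocks of `σ`, so `Ψ_σ` can be evaluated by
-- removal, and the sum of the results factors by `BNCFun.sum_gapInsert` into the removal formula
-- for the convolution. In the present direction this is used backwards: both sides are sums over `σ
-- ≤ π`, the terms with `σ < π` agree by induction, and cancelling them leaves the formula for `π`.
open Classical in
theorem isMultiplicative_of_conv_zeta {Ψ : P.BNCFun} (h : IsMultiplicative (Ψ.conv zetaBNC)) :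
    IsMultiplicative Ψ := by
  have hΨ : (Ψ.conv zetaBNC).conv muBNC = Ψ := Ψ.conv_zeta_conv_mu
  have hlin : ∀ {n : ℕ} (χ : Fin n → Side) (π : BNC χ), IsLinearOn Finset.univ (Ψ χ π) := by
    rw [← hΨ]
    exact h.linear_conv _
  refine ⟨hlin, ?_, ?_⟩
  · rw [← hΨ]
    exact h.balanced_conv _
  intro n χ π
  induction π using WellFoundedLT.induction with
  | _ π ih =>
  intro U hUs hsat hint u hu T
  by_cases hU : U = Finset.univ
  · rw [hU]
    exact removes_self _ (Ψ.sys_empty π) _ u T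
  have hne : (Finset.univ \ U).Nonempty := by
    rw [Finset.sdiff_nonempty]
    exact fun h => hU (Finset.univ_subset_iff.1 h)
  have h1 : (Ψ.conv zetaBNC).sys π Finset.univ T =
      gapInsert ((Ψ.conv zetaBNC).sys π (Finset.univ \ U)) (Finset.univ \ U) u
        ((Ψ.conv zetaBNC).sys π U T) T := h.removes χ π U hUs hsat hint u hu T
  rw [← Ψ.sum_gapInsert hlin π hsat ⟨u, hu⟩ hne, BNCFun.sys_univ _ u.pos,
    BNCFun.conv_zeta_apply] at h1
  simp only [← Ψ.sys_univ u.pos] at h1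
  have hmem : π ∈ Finset.univ.filter fun σ : BNC χ => σ ≤ π := by simp
  rw [← Finset.add_sum_erase _ _ hmem, ← Finset.add_sum_erase _ _ hmem] at h1
  have h2 := Finset.sum_congr (rfl : (Finset.univ.filter fun σ : BNC χ => σ ≤ π).erase π = _)
    fun σ hσ => by
      have hσ' := Finset.mem_erase.1 hσ
      have hle := (Finset.mem_filter.1 hσ'.2).2
      exact ih σ (lt_of_le_of_ne hle hσ'.1) U hUs (IsSaturatedIn.mono_rel hsat hle) hint u hu T
  rw [h2] at h1
  exact add_right_cancel h1

end NCPS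

end BiFree

end

/-! ### Joining the blocks of consecutive nodes -/

noncomputable section

namespace BiFree

variable {n : ℕ}

/-- Two consecutive nodes on the same side are adjacent for `≺_χ`. -/
theorem pos_adjacent {χ : Fin n → Side} {a a' : Fin n} (h : χ a = χ a') (ha : (a' : ℕ) = a + 1) :
    pos χ a' = pos χ a + 1 ∨ pos χ a = pos χ a' + 1 := by
  rcases side_cases χ a with ⟨hs, hp⟩ | ⟨hs, hp⟩
  · have := pos_l (h ▸ hs)
    omega
  · have := pos_r (h ▸ hs)
    omega

/-- The partition obtained by joining the blocks of `a` and `a'`. -/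
def joinSetoid (σ : Setoid (Fin n)) (a a' : Fin n) : Setoid (Fin n) where
  r x y := σ x y ∨ ((σ x a ∨ σ x a') ∧ (σ y a ∨ σ y a'))
  iseqv := by
    refine ⟨fun x => Or.inl (σ.refl x), ?_, ?_⟩
    · rintro x y (h | h)
      · exact Or.inl (σ.symm h)
      · exact Or.inr h.symm
    · have key : ∀ {x y}, σ x y → (σ y a ∨ σ y a') → (σ x a ∨ σ x a') := fun h =>
        Or.imp (σ.trans h) (σ.trans h)
      rintro x y z (h | h) (h' | h')
      · exact Or.inl (σ.trans h h')
      · exact Or.inr ⟨key h h'.1, h'.2⟩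
      · exact Or.inr ⟨h.1, key (σ.symm h') h.2⟩
      · exact Or.inr ⟨h.1, h'.2⟩

/-- A block cannot have nodes both between and beyond two nodes of a different block without
crossing it. -/
theorem BNC.between_of_between {χ : Fin n → Side} (σ : BNC χ) {p q u x : Fin n} (hpq : σ.1 p q)
    (hux : σ.1 u x) (hpx : ¬ σ.1 p x) (h : pos χ p < pos χ u ∧ pos χ u < pos χ q) :
    pos χ p < pos χ x ∧ pos χ x < pos χ q := by
  have hcr : ∀ {u₁ v₁ u₂ v₂}, pos χ u₁ < pos χ v₁ → pos χ v₁ < pos χ u₂ → pos χ u₂ < pos χ v₂ →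
      σ.1 u₁ u₂ → σ.1 v₁ v₂ → σ.1 u₁ v₁ := fun h₁ h₂ h₃ =>
    σ.2 _ _ _ _ (prec_iff.2 h₁) (prec_iff.2 h₂) (prec_iff.2 h₃)
  have hp : pos χ x ≠ pos χ p := fun h => hpx (pos_injective χ h ▸ σ.1.refl _)
  have hq : pos χ x ≠ pos χ q := fun h => hpx (pos_injective χ h ▸ hpq)
  by_contra h3
  have h4 : pos χ x < pos χ p ∨ pos χ q < pos χ x := by omega
  rcases h4 with h4 | h4
  · exact hpx (σ.1.symm (hcr h4 h.1 h.2 (σ.1.symm hux) hpq))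
  · exact hpx (σ.1.trans (hcr h.1 h.2 h4 hpq hux) hux)

theorem BNC.between_iff {χ : Fin n → Side} (σ : BNC χ) {p q u x : Fin n} (hpq : σ.1 p q)
    (hux : σ.1 u x) (hpx : ¬ σ.1 p x) :
    (pos χ p < pos χ u ∧ pos χ u < pos χ q) ↔ (pos χ p < pos χ x ∧ pos χ x < pos χ q) :=
  ⟨σ.between_of_between hpq hux hpx,
    σ.between_of_between hpq (σ.1.symm hux) fun h => hpx (σ.1.trans h hux)⟩

/-- As `a` and `a'` are neighbours for `≺_χ`, two nodes `p`, `q` of a third block enclose both or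
neither. The blocks of `a` and `a'` follow them, so the joined block is not crossed. -/
theorem isBiNonCrossing_joinSetoid {χ : Fin n → Side} (σ : BNC χ) {a a' : Fin n} (h : χ a = χ a')
    (ha : (a' : ℕ) = a + 1) : IsBiNonCrossing χ (joinSetoid σ.1 a a') := by
  have hadj := pos_adjacent h ha
  have key : ∀ {p q u v : Fin n}, ¬ (σ.1 p a ∨ σ.1 p a') → (σ.1 u a ∨ σ.1 u a') →
      (σ.1 v a ∨ σ.1 v a') → σ.1 p q → (pos χ p < pos χ u ∧ pos χ u < pos χ q) →
      (pos χ p < pos χ v ∧ pos χ v < pos χ q) := by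
    intro p q u v hp hu hv hpq hpos
    have hq : ¬ (σ.1 q a ∨ σ.1 q a') := fun h => hp (h.imp (σ.1.trans hpq) (σ.1.trans hpq))
    have hne : ∀ {x : Fin n}, ¬ (σ.1 x a ∨ σ.1 x a') →
        pos χ x ≠ pos χ a ∧ pos χ x ≠ pos χ a' := fun hx =>
      ⟨fun h => hx (Or.inl (pos_injective χ h ▸ σ.1.refl _)),
        fun h => hx (Or.inr (pos_injective χ h ▸ σ.1.refl _))⟩
    have hn₁ := hne hp
    have hn₂ := hne hq
    rw [not_or] at hp
    rcases hu with hu | hu <;> rcases hv with hv | hv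
    · have k1 := σ.between_iff hpq hu hp.1
      have k2 := σ.between_iff hpq hv hp.1
      omega
    · have k1 := σ.between_iff hpq hu hp.1
      have k2 := σ.between_iff hpq hv hp.2
      omega
    · have k1 := σ.between_iff hpq hu hp.2
      have k2 := σ.between_iff hpq hv hp.1
      omega
    · have k1 := σ.between_iff hpq hu hp.2
      have k2 := σ.between_iff hpq hv hp.2
      omega
  have hs : ∀ {x y}, σ.1 x y → (σ.1 x a ∨ σ.1 x a') → (σ.1 y a ∨ σ.1 y a') := fun h =>
    Or.imp (σ.1.trans (σ.1.symm h)) (σ.1.trans (σ.1.symm h))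
  intro u₁ v₁ u₂ v₂ h12 h23 h34 hu hv
  have hcr := σ.2 u₁ v₁ u₂ v₂ h12 h23 h34
  rw [prec_iff] at h12 h23 h34
  by_cases hu₁ : σ.1 u₁ a ∨ σ.1 u₁ a' <;> by_cases hv₁ : σ.1 v₁ a ∨ σ.1 v₁ a'
  · exact Or.inr ⟨hu₁, hv₁⟩
  · have hu₂ : σ.1 u₂ a ∨ σ.1 u₂ a' := hu.elim (fun h => hs h hu₁) fun h => h.2
    have := key hv₁ hu₂ hu₁ (hv.resolve_right fun h => hv₁ h.1) ⟨h23, h34⟩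
    omega
  · have hv₂ : σ.1 v₂ a ∨ σ.1 v₂ a' := hv.elim (fun h => hs h hv₁) fun h => h.2
    have := key hu₁ hv₁ hv₂ (hu.resolve_right fun h => hu₁ h.1) ⟨h12, h23⟩
    omega
  · exact Or.inl (hcr (hu.resolve_right fun h => hu₁ h.1) (hv.resolve_right fun h => hv₁ h.1))

/-- The partition obtained by joining the blocks of two consecutive nodes on the same side. -/
def BNC.join {χ : Fin n → Side} (σ : BNC χ) {a a' : Fin n} (h : χ a = χ a')
    (ha : (a' : ℕ) = a + 1) : BNC χ :=
  ⟨joinSetoid σ.1 a a', isBiNonCrossing_joinSetoid σ h ha⟩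

section join

variable {χ : Fin n → Side} {a a' : Fin n} {h : χ a = χ a'} {ha : (a' : ℕ) = a + 1}

theorem BNC.join_eq_iff {σ π : BNC χ} : σ.join h ha = π ↔
    ∀ x y, π.1 x y ↔ σ.1 x y ∨ ((σ.1 x a ∨ σ.1 x a') ∧ (σ.1 y a ∨ σ.1 y a')) := by
  constructor
  · rintro rfl x y
    exact Iff.rfl
  · exact fun h => Subtype.ext (Setoid.ext fun x y => (h x y).symm)

theorem BNC.join_rel (σ : BNC χ) : (σ.join h ha).1 a a' :=
  Or.inr ⟨Or.inl (σ.1.refl a), Or.inr (σ.1.refl a')⟩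

theorem BNC.le_join (σ : BNC χ) : σ ≤ σ.join h ha := fun _ _ hxy => Or.inl hxy

theorem BNC.join_rel_left_iff (σ : BNC χ) {x : Fin n} :
    (σ.join h ha).1 x a ↔ σ.1 x a ∨ σ.1 x a' :=
  ⟨fun hx => hx.elim Or.inl fun hx => hx.1, fun hx => Or.inr ⟨hx, Or.inl (σ.1.refl a)⟩⟩

/-- Outside of the block of `a`, the two partitions agree. -/
theorem BNC.join_rel_iff_of_not (σ : BNC χ) {x y : Fin n} (hx : ¬ (σ.join h ha).1 x a) :
    (σ.join h ha).1 x y ↔ σ.1 x y :=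
  ⟨fun hxy => hxy.resolve_right fun hxy => hx (σ.join_rel_left_iff.2 hxy.1), fun hxy => Or.inl hxy⟩

theorem BNC.join_eq_one_iff {σ : BNC χ} : σ.join h ha = .one χ ↔ ∀ x, σ.1 x a ∨ σ.1 x a' := by
  rw [BNC.join_eq_iff]
  constructor
  · intro hσ x
    rcases (hσ x a).1 trivial with hx | hx
    · exact Or.inl hx
    · exact hx.1
  · exact fun hσ x y => iff_of_true trivial (Or.inr ⟨hσ x, hσ y⟩)

/-- The right side is also the condition that joining gives `1_χ`. Thus the index set in the
bi-cumulant rule is recognised as part of a fibre of the joining map. -/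
theorem BNC.numBlocks_eq_two_iff {σ : BNC χ} (hσ : ¬ σ.1 a a') :
    σ.numBlocks = 2 ↔ ∀ x, σ.1 x a ∨ σ.1 x a' := by
  have hne : {x | σ.1 x a} ≠ {x | σ.1 x a'} := fun h =>
    hσ (h.subset (show a ∈ {x | σ.1 x a} from σ.1.refl a))
  have hsub : {{x | σ.1 x a}, {x | σ.1 x a'}} ⊆ σ.1.classes := by
    rintro _ (rfl | rfl)
    · exact ⟨a, rfl⟩
    · exact ⟨a', rfl⟩
  rw [BNC.numBlocks, ← Set.ncard_pair hne]
  constructor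
  · intro hcard x
    have heq := Set.eq_of_subset_of_ncard_le hsub hcard.le (Set.toFinite _)
    have hx : {y | σ.1 y x} ∈ σ.1.classes := ⟨x, rfl⟩
    rw [← heq] at hx
    rcases hx with hx | hx
    · exact Or.inl (hx.subset (show x ∈ {y | σ.1 y x} from σ.1.refl x))
    · exact Or.inr (hx.subset (show x ∈ {y | σ.1 y x} from σ.1.refl x))
  · intro hall
    congr 1
    refine Set.Subset.antisymm ?_ hsub
    rintro _ ⟨x, rfl⟩
    rcases hall x with hx | hx
    · left
      ext y
      exact ⟨fun h => σ.1.trans h hx, fun h => σ.1.trans h (σ.1.symm hx)⟩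
    · right
      ext y
      exact ⟨fun h => σ.1.trans h hx, fun h => σ.1.trans h (σ.1.symm hx)⟩

end join

/-- The partitions with joined nodes are the partitions of the other nodes. -/
theorem BNC.delete_injOn {χ : Fin (n + 1) → Side} (q : Fin n) {π π' : BNC χ}
    (hπ : π.1 q.castSucc q.succ) (hπ' : π'.1 q.castSucc q.succ)
    (h : π.delete q.castSucc = π'.delete q.castSucc) : π = π' := by
  have hrel : ∀ i j, π.1 (q.castSucc.succAbove i) (q.castSucc.succAbove j) ↔
      π'.1 (q.castSucc.succAbove i) (q.castSucc.succAbove j) := fun i j =>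
    iff_of_eq (congrArg (fun ρ : BNC (fun i => χ (q.castSucc.succAbove i)) => ρ.1 i j) h)
  have hcase : ∀ x, ∃ i, π.1 x (q.castSucc.succAbove i) ∧ π'.1 x (q.castSucc.succAbove i) := by
    intro x
    by_cases hx : x = q.castSucc
    · refine ⟨q, ?_⟩
      rw [Fin.succAbove_castSucc_self, hx]
      exact ⟨hπ, hπ'⟩
    · obtain ⟨i, rfl⟩ := Fin.exists_succAbove_eq hx
      exact ⟨i, π.1.refl _, π'.1.refl _⟩
  refine Subtype.ext (Setoid.ext fun x y => ?_)
  obtain ⟨i, hi, hi'⟩ := hcase x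
  obtain ⟨j, hj, hj'⟩ := hcase y
  constructor
  · exact fun hxy => π'.1.trans hi' (π'.1.trans ((hrel i j).1 (π.1.trans (π.1.symm hi)
      (π.1.trans hxy hj))) (π'.1.symm hj'))
  · exact fun hxy => π.1.trans hi (π.1.trans ((hrel i j).2 (π'.1.trans (π'.1.symm hi')
      (π'.1.trans hxy hj'))) (π.1.symm hj))

/-- The partition is pulled back along `predAbove`, which identifies the nodes `q` and `q+1`. These
are neighbours for `≺_χ`, so this map preserves the order of nodes with different images. -/
theorem BNC.exists_delete_eq {χ : Fin (n + 1) → Side} (q : Fin n) (h : χ q.castSucc = χ q.succ)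
    (ρ : BNC (fun i => χ (q.castSucc.succAbove i))) :
    ∃ π : BNC χ, π.1 q.castSucc q.succ ∧ π.delete q.castSucc = ρ := by
  have hadj := pos_adjacent h (by simp)
  have hf : ∀ x, (x ≠ q.castSucc ∧ q.castSucc.succAbove (q.predAbove x) = x) ∨
      (x = q.castSucc ∧ q.castSucc.succAbove (q.predAbove x) = q.succ) := by
    intro x
    by_cases hx : x = q.castSucc
    · right
      subst hx
      simp
    · exact Or.inl ⟨hx, Fin.succAbove_predAbove hx⟩
  have hmono : ∀ {x y}, Prec χ x y → q.predAbove x ≠ q.predAbove y →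
      Prec (fun i => χ (q.castSucc.succAbove i)) (q.predAbove x) (q.predAbove y) := by
    intro x y hxy hne
    refine (prec_comp_iff χ (Fin.succAboveOrderEmb q.castSucc)).2 ?_
    simp only [Fin.succAboveOrderEmb_apply]
    have hne' : pos χ (q.castSucc.succAbove (q.predAbove x)) ≠
        pos χ (q.castSucc.succAbove (q.predAbove y)) := fun h =>
      hne (Fin.succAbove_right_injective (pos_injective χ h))
    rw [prec_iff] at hxy ⊢
    have hpos : ∀ {z}, z ≠ q.castSucc → pos χ z ≠ pos χ q.castSucc := fun hz h =>
      hz (pos_injective χ h)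
    rcases hf x with ⟨hx, hx'⟩ | ⟨hx, hx'⟩ <;> rcases hf y with ⟨hy, hy'⟩ | ⟨hy, hy'⟩ <;>
      rw [hx', hy'] at hne' ⊢
    · exact hxy
    · have := hpos hx
      subst hy
      omega
    · have := hpos hy
      subst hx
      omega
    · exact absurd rfl hne'
  refine ⟨⟨ρ.1.comap q.predAbove, ?_⟩, ?_, ?_⟩
  · intro u₁ v₁ u₂ v₂ h12 h23 h34 hu hv
    rw [Setoid.comap_rel] at hu hv ⊢
    -- If two consecutive points of the crossing have the same image, the conclusion is immediate;
    -- otherwise strict order is preserved.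
    by_cases e1 : q.predAbove u₁ = q.predAbove v₁
    · rw [e1]
    by_cases e2 : q.predAbove v₁ = q.predAbove u₂
    · rwa [e2]
    by_cases e3 : q.predAbove u₂ = q.predAbove v₂
    · rw [e3] at hu
      exact ρ.1.trans hu (ρ.1.symm hv)
    exact ρ.2 _ _ _ _ (hmono h12 e1) (hmono h23 e2) (hmono h34 e3) hu hv
  · rw [Setoid.comap_rel]
    simp
  · refine Subtype.ext (Setoid.ext fun i j => ?_)
    change ρ.1 (q.predAbove (q.castSucc.succAbove i)) (q.predAbove (q.castSucc.succAbove j)) ↔ _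
    rw [Fin.predAbove_succAbove, Fin.predAbove_succAbove]

end BiFree

end

/-! ### Multiplying consecutive entries -/

noncomputable section

namespace BiFree

variable {n : ℕ}

variable {B A : Type*} [Ring B] [Algebra ℂ B] [Ring A] [Algebra ℂ A]

namespace NCPS

variable {P : NCPS B A}

section mulInto

variable {χ : Fin n → Side} {a a' : Fin n} {h : χ a = χ a'}

theorem Entries.mulInto_of_ne (T : P.Entries χ) {k : Fin n} (hk : k ≠ a') :
    T.mulInto a a' h k = T k := Function.update_of_ne hk _ _

/-- Insertions commute with multiplying the entry at `a` into the entry at the next node `a'`. -/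
theorem gapInsert_mulInto (ha : (a' : ℕ) = a + 1) {S : Finset (Fin n)} {f : P.Entries χ → B}
    (hf : DependsOnlyOn (S \ {a}) f) (haS : a ∈ S) (haS' : a' ∈ S) {v : Fin n} (hva : v ≠ a)
    (hva' : v ≠ a') (b : B) (T : P.Entries χ) :
    gapInsert f (S \ {a}) v b (T.mulInto a a' h) =
      gapInsert (fun T => f (T.mulInto a a' h)) S v b T := by
  have hadj := pos_adjacent h ha
  have hne : a ≠ a' := fun h => by rw [h] at ha; omega
  have hpa : pos χ v ≠ pos χ a := fun h => hva (pos_injective χ h)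
  have hpa' : pos χ v ≠ pos χ a' := fun h => hva' (pos_injective χ h)
  have hmem : ∀ {k}, k ∈ S \ {a} ↔ k ∈ S ∧ k ≠ a := by simp
  rcases exists_isPred_or_forall χ S v with ⟨p, hp⟩ | hall
  · rw [gapInsert_of_isPred hp]
    -- This happens only on the right side, where `a'` precedes `a` for `≺_χ`. With `a` deleted,
    -- `a'` is the predecessor, and `R_b (T_a T_{a'}) = (R_b T_a) T_{a'}`.
    by_cases hpa1 : p = a
    · subst hpa1
      have hlt := hp.2.1
      have hle := hp.2.2 a' haS'
      have hr : χ p = .r := by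
        rcases side_cases χ p with ⟨hs, hpos⟩ | ⟨hs, hpos⟩
        · have := pos_l (h ▸ hs)
          omega
        · exact hs
      have hp' : IsPred χ (S \ {p}) v a' := by
        refine ⟨hmem.2 ⟨haS', hne.symm⟩, by omega, fun k hk hkv => ?_⟩
        have h1 := hp.2.2 k (hmem.1 hk).1 hkv
        have h2 : pos χ k ≠ pos χ p := fun h => (hmem.1 hk).2 (pos_injective χ h)
        omega
      rw [gapInsert_of_isPred hp']
      refine hf _ _ fun k hk => ?_
      by_cases hka : k = a'
      · subst hka
        refine Subtype.ext ?_
        change Entries.coe _ _ = Entries.coe _ _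
        rw [Entries.coe_mulInto, Entries.coe_after_r (h ▸ hr), Entries.coe_after_r hr,
          Entries.coe_mulInto]
        simp [hne.symm, mul_assoc]
      · rw [Entries.after_of_ne _ hka, Entries.mulInto_of_ne _ hka, Entries.mulInto_of_ne _ hka,
          Entries.after_of_ne _ (hmem.1 hk).2]
    · have hp' : IsPred χ (S \ {a}) v p :=
        ⟨hmem.2 ⟨hp.1, hpa1⟩, hp.2.1, fun k hk => hp.2.2 k (hmem.1 hk).1⟩
      rw [gapInsert_of_isPred hp']
      refine hf _ _ fun k hk => ?_
      -- This happens only on the left side, where the identity is `(T_a T_{a'}) L_b = T_a (T_{a'}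
      -- L_b)`.
      by_cases hpa2 : p = a'
      · subst hpa2
        have hlt := hp.2.1
        have hle := hp.2.2 a haS
        have hl : χ p = .l := by
          rcases side_cases χ p with ⟨hs, hpos⟩ | ⟨hs, hpos⟩
          · exact hs
          · have := pos_r (h.trans hs)
            omega
        by_cases hka : k = p
        · subst hka
          refine Subtype.ext ?_
          change Entries.coe _ _ = Entries.coe _ _
          rw [Entries.coe_mulInto, Entries.coe_after_l hl, Entries.coe_after_l hl,
            Entries.coe_mulInto]
          simp [hne, mul_assoc]
        · rw [Entries.after_of_ne _ hka, Entries.mulInto_of_ne _ hka,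
            Entries.mulInto_of_ne _ hka, Entries.after_of_ne _ hka]
      · refine Subtype.ext ?_
        change Entries.coe _ _ = Entries.coe _ _
        by_cases hkp : k = p
        · subst hkp
          rw [Entries.coe_mulInto, Function.update_of_ne hpa2]
          change ((T.mulInto a a' h).after k b k : A) = (T.after k b k : A)
          rw [Entries.after_self, Entries.after_self, Entries.mulInto_of_ne _ hpa2]
        · change ((T.mulInto a a' h).after p b k : A) = ((T.after p b).mulInto a a' h k : A)
          rw [Entries.after_of_ne _ hkp]
          by_cases hka : k = a'
          · subst hka
            change Entries.coe _ _ = Entries.coe _ _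
            rw [Entries.coe_mulInto, Entries.coe_mulInto]
            simp [Entries.coe, Entries.after_of_ne _ hkp, Entries.after_of_ne _ (Ne.symm hpa1)]
          · rw [Entries.mulInto_of_ne _ hka, Entries.mulInto_of_ne _ hka,
              Entries.after_of_ne _ hkp]
  · rw [gapInsert_of_forall hall, gapInsert_of_forall fun k hk => hall k (hmem.1 hk).1]

end mulInto

open Classical in
/-- If merging holds on the block of `a` then it holds on all unions of blocks containing `a`. -/
theorem IsMultiplicative.sys_mulInto {Ψ : P.BNCFun} (hΨ : IsMultiplicative Ψ) {χ : Fin n → Side}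
    {a a' : Fin n} (h : χ a = χ a') (ha : (a' : ℕ) = a + 1) (π : BNC χ) (hπ : π.1 a a')
    (hblock : ∀ T : P.Entries χ,
      Ψ.sys π (blockOf π.1 Finset.univ a \ {a}) (T.mulInto a a' h) =
        ∑ σ : BNC χ with σ.join h ha = π, Ψ.sys σ (blockOf π.1 Finset.univ a) T) :
    ∀ S : Finset (Fin n), IsSaturatedIn π.1 Finset.univ S → a ∈ S → ∀ T : P.Entries χ,
      Ψ.sys π (S \ {a}) (T.mulInto a a' h) = ∑ σ : BNC χ with σ.join h ha = π, Ψ.sys σ S T := by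
  have hne : a ≠ a' := fun h => by rw [h] at ha; omega
  intro S
  induction S using Finset.strongInduction with
  | _ S ih =>
  intro hS haS T
  have haS' : a' ∈ S := hS a haS a' (Finset.mem_univ _) hπ
  obtain ⟨v, hv⟩ := exists_isTopMin π.1 ⟨a, haS⟩
  have hvV : v ∈ blockOf π.1 S v := mem_blockOf.2 ⟨hv.mem, π.1.refl v⟩
  have hint := isIntervalIn_blockOf (π.isNonCrossingOn S) hv
  have hVS : blockOf π.1 S v ⊆ S := blockOf_subset
  have hsat := isSaturatedIn_blockOf π.1 S v
  -- Joining alters only the block of `a`, so all `σ` in the fibre coincide with `π` elsewhere.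
  have hout : ∀ {σ : BNC χ}, σ.join h ha = π → ∀ {x y}, ¬ π.1 x a → (σ.1 x y ↔ π.1 x y) := by
    rintro σ rfl x y hx
    exact (σ.join_rel_iff_of_not hx).symm
  have hle : ∀ {σ : BNC χ}, σ.join h ha = π → σ ≤ π := by
    rintro σ rfl
    exact σ.le_join
  have hrem : ∀ {σ : BNC χ}, σ.join h ha = π → ∀ u ∈ blockOf π.1 S v, Ψ.sys σ S T =
      gapInsert (Ψ.sys σ (S \ blockOf π.1 S v)) (S \ blockOf π.1 S v) u
        (Ψ.sys σ (blockOf π.1 S v) T) T := fun hσ u hu =>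
    hΨ.removes_sys _ S _ hVS (IsSaturatedIn.mono_rel hsat (hle hσ)) hint u hu T
  have hdep := Ψ.dependsOnlyOn_sys π
  -- The block of the largest minimum in `S` is removed. If it contains `a`, `hblock` applies to it
  -- and the rest is the same for all `σ`. If not, its value is the same for all `σ`, the insertion
  -- commutes with the merging, and induction applies to the rest.
  by_cases hav : π.1 v a
  · have hV : blockOf π.1 S v = blockOf π.1 Finset.univ a := by
      ext x
      simp only [mem_blockOf, Finset.mem_univ, true_and]
      exact ⟨fun hx => π.1.trans (π.1.symm hav) hx.2, fun hx =>
        ⟨hS a haS x (Finset.mem_univ x) hx, π.1.trans hav hx⟩⟩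
    have haV : a ∈ blockOf π.1 S v := mem_blockOf.2 ⟨haS, hav⟩
    have haV' : a' ∈ blockOf π.1 S v := mem_blockOf.2 ⟨haS', π.1.trans hav hπ⟩
    rw [← hV] at hblock
    have hsd : (S \ {a}) \ (blockOf π.1 S v \ {a}) = S \ blockOf π.1 S v := by
      ext x
      simp only [Finset.mem_sdiff, Finset.mem_singleton, not_and, not_not]
      constructor
      · rintro ⟨⟨hx, hxa⟩, hx'⟩
        exact ⟨hx, fun hxV => hxa (hx' hxV)⟩
      · rintro ⟨hx, hxV⟩
        exact ⟨⟨hx, fun hxa => hxV (hxa ▸ haV)⟩, fun hxV' => absurd hxV' hxV⟩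
    rw [hΨ.removes_sys π (S \ {a}) (blockOf π.1 S v \ {a})
      (Finset.sdiff_subset_sdiff hVS (le_refl _)) ?_ ?_ a'
      (by simp [haV', hne.symm, -mem_blockOf]) _, hsd, hblock,
      gapInsert_congr (hdep _) _ (T' := T),
      (hΨ.linear_sys π _).gapInsert_sum]
    · refine Finset.sum_congr rfl fun σ hσ => ?_
      have hσ := (Finset.mem_filter.1 hσ).2
      rw [hrem hσ a' haV']
      congr 1
      funext T
      refine Ψ.sys_congr (fun x hx y _ => ?_) fun _ _ => rfl
      refine (hout hσ fun hxa => ?_).symm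
      rw [Finset.mem_sdiff] at hx
      exact hx.2 (mem_blockOf.2 ⟨hx.1, π.1.trans hav (π.1.symm hxa)⟩)
    · intro k hk
      refine Entries.mulInto_of_ne _ ?_
      rintro rfl
      exact (Finset.mem_sdiff.1 hk).2 haV'
    · intro x hx y hy hxy
      rw [Finset.mem_sdiff] at hx hy ⊢
      exact ⟨hsat x hx.1 y hy.1 hxy, hy.2⟩
    · intro x hx y hy k hk hxk hky
      rw [Finset.mem_sdiff] at hx hy hk ⊢
      exact ⟨hint x hx.1 y hy.1 k hk.1 hxk hky, hk.2⟩
  · have haV : a ∉ blockOf π.1 S v := fun ha => hav (mem_blockOf.1 ha).2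
    have haV' : a' ∉ blockOf π.1 S v := fun ha =>
      hav (π.1.trans (mem_blockOf.1 ha).2 (π.1.symm hπ))
    have hsd : (S \ {a}) \ blockOf π.1 S v = (S \ blockOf π.1 S v) \ {a} := sdiff_right_comm ..
    have hVa : blockOf π.1 S v ⊆ S \ {a} := fun x hx =>
      Finset.mem_sdiff.2 ⟨hVS hx, fun hxa => haV (Finset.mem_singleton.1 hxa ▸ hx)⟩
    have hval : ∀ {σ : BNC χ}, σ.join h ha = π →
        Ψ.sys σ (blockOf π.1 S v) T = Ψ.sys π (blockOf π.1 S v) T := by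
      intro σ hσ
      refine Ψ.sys_congr (fun x hx y _ => hout hσ fun hxa => ?_) fun _ _ => rfl
      exact hav (π.1.trans (mem_blockOf.1 hx).2 hxa)
    rw [hΨ.removes_sys π (S \ {a}) _ hVa
      (fun x hx y hy hxy => hsat x hx y (Finset.mem_sdiff.1 hy).1 hxy)
      (fun x hx y hy k hk => hint x hx y hy k (Finset.mem_sdiff.1 hk).1) v hvV, hsd,
      gapInsert_mulInto ha (hdep _) (Finset.mem_sdiff.2 ⟨haS, haV⟩)
        (Finset.mem_sdiff.2 ⟨haS', haV'⟩) (fun hva => haV (hva ▸ hvV)) fun hva => haV' (hva ▸ hvV),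
      Finset.sum_congr rfl fun σ hσ => by
        rw [hrem (Finset.mem_filter.1 hσ).2 v hvV, hval (Finset.mem_filter.1 hσ).2],
      ← gapInsert_sum_fun]
    have hIH := ih (S \ blockOf π.1 S v) (Finset.sdiff_ssubset hVS ⟨v, hvV⟩) ?_
      (Finset.mem_sdiff.2 ⟨haS, haV⟩)
    · rw [funext hIH, hdep (blockOf π.1 S v) _ T]
      intro k hk
      refine Entries.mulInto_of_ne _ ?_
      rintro rfl
      exact haV' hk
    · intro x hx y hy hxy
      rw [Finset.mem_sdiff] at hx ⊢
      have hyS := hS x hx.1 y hy hxy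
      exact ⟨hyS, fun hyV => hx.2 (hsat y hyV x hx.1 (π.1.symm hxy))⟩

end NCPS

end BiFree

end

/-! ### Bi-moment and bi-cumulant functions -/

noncomputable section

namespace BiFree

variable {n : ℕ}

variable {B A : Type*} [Ring B] [Algebra ℂ B] [Ring A] [Algebra ℂ A]

namespace NCPS

variable {P : NCPS B A}

open Classical in
/-- The merging rule of bi-cumulant functions for `n` nodes. -/
def MergesAt (Ψ : P.BNCFun) (n : ℕ) : Prop :=
  ∀ (χ : Fin n → Side) (a a' : Fin n) (h : χ a = χ a') (ha : (a' : ℕ) = a + 1) (T : P.Entries χ),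
    Ψ.sys (.one χ) (Finset.univ \ {a}) (T.mulInto a a' h) =
      ∑ σ : BNC χ with σ.join h ha = .one χ, Ψ χ σ T

-- A partition which becomes `1_χ` by joining either relates `a` to `a'` already, and is then `1_χ`,
-- or consists of exactly two blocks separating these nodes.
open Classical in
theorem sum_join_eq_one (Ψ : P.BNCFun) {χ : Fin n → Side} {a a' : Fin n} (h : χ a = χ a')
    (ha : (a' : ℕ) = a + 1) (T : P.Entries χ) :
    ∑ σ : BNC χ with σ.join h ha = .one χ, Ψ χ σ T =
      Ψ χ (.one χ) T + ∑ π : BNC χ with π.numBlocks = 2 ∧ ¬ π.1 a a', Ψ χ π T := by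
  have hone : BNC.one χ ∈ Finset.univ.filter fun σ : BNC χ => σ.join h ha = .one χ :=
    Finset.mem_filter.2 ⟨Finset.mem_univ _, BNC.join_eq_one_iff.2 fun x => Or.inl trivial⟩
  rw [← Finset.add_sum_erase _ _ hone]
  congr 1
  refine Finset.sum_congr ?_ fun _ _ => rfl
  ext σ
  simp only [Finset.mem_erase, Finset.mem_filter, Finset.mem_univ, true_and]
  rw [BNC.join_eq_one_iff]
  by_cases hσ : σ.1 a a'
  · refine iff_of_false (fun hc => hc.1 ?_) fun hc => hc.2 hσ
    have hall : ∀ x, σ.1 x a := fun x =>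
      (hc.2 x).elim id fun hx => σ.1.trans hx (σ.1.symm hσ)
    exact Subtype.ext (Setoid.ext fun x y =>
      iff_of_true (σ.1.trans (hall x) (σ.1.symm (hall y))) trivial)
  · rw [BNC.numBlocks_eq_two_iff hσ]
    refine ⟨fun hc => ⟨hc.2, hσ⟩, fun hc => ⟨?_, hc.1⟩⟩
    rintro rfl
    exact hσ trivial

open Classical in
theorem mergesAt_succ_iff (Ψ : P.BNCFun) : MergesAt Ψ (n + 1) ↔
    ∀ (χ : Fin (n + 1) → Side) (q : Fin n) (h : χ q.castSucc = χ q.succ) (T : P.Entries χ),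
      Ψ _ (.one _) (T.merge q h) = Ψ χ (.one χ) T +
        ∑ π : BNC χ with π.numBlocks = 2 ∧ ¬ π.1 q.castSucc q.succ, Ψ χ π T := by
  constructor
  · intro hm χ q h T
    rw [← sum_join_eq_one Ψ h (by simp), ← hm χ _ _ h (by simp)]
    exact Ψ.delete_merge (.one χ) q h T
  · intro hm χ a a' h ha T
    have hq : (a : ℕ) < n := by have := a'.2; omega
    obtain ⟨q, rfl⟩ : ∃ q : Fin n, a = q.castSucc := ⟨⟨a, hq⟩, rfl⟩
    obtain rfl : a' = q.succ := Fin.ext (by simpa using ha)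
    rw [sum_join_eq_one, ← hm χ q h T]
    exact (Ψ.delete_merge (.one χ) q h T).symm

open Classical in
/-- The merging rule for `|W|` nodes, on a block `W` of a partition. -/
theorem MergesAt.sys_blockOf {Ψ : P.BNCFun} {χ : Fin n → Side} {a a' : Fin n} (h : χ a = χ a')
    (ha : (a' : ℕ) = a + 1) (π : BNC χ) (hπ : π.1 a a')
    (hm : MergesAt Ψ (blockOf π.1 Finset.univ a).card) (T : P.Entries χ) :
    Ψ.sys π (blockOf π.1 Finset.univ a \ {a}) (T.mulInto a a' h) =
      ∑ σ : BNC χ with σ.join h ha = π, Ψ.sys σ (blockOf π.1 Finset.univ a) T := by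
  set W := blockOf π.1 Finset.univ a with hW
  have hmem : ∀ {x}, x ∈ W ↔ π.1 a x := by simp [hW]
  have hsat : IsSaturatedIn π.1 Finset.univ W := isSaturatedIn_blockOf _ _ _
  obtain ⟨α, hα⟩ := exists_enum_eq (hmem.2 (π.1.refl a))
  obtain ⟨α', hα'⟩ := exists_enum_eq (hmem.2 hπ)
  -- No label lies strictly between `a` and `a + 1`, so these nodes stay consecutive after
  -- relabelling `W`.
  have hα1 : (α' : ℕ) = α + 1 := by
    have hlt : α < α' := (enum W).lt_iff_lt.1 (by rw [hα, hα', Fin.lt_def]; omega)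
    by_contra hne
    have hβ : (α : ℕ) + 1 < W.card := by have := α'.2; omega
    have h1 : enum W α < enum W ⟨α + 1, hβ⟩ := (enum W).lt_iff_lt.2 (by simp [Fin.lt_def])
    have h2 : enum W ⟨α + 1, hβ⟩ < enum W α' :=
      (enum W).lt_iff_lt.2 (by rw [Fin.lt_def] at hlt ⊢; simp only; omega)
    rw [hα, Fin.lt_def] at h1
    rw [hα', Fin.lt_def] at h2
    omega
  have hαs : resSide χ W α = resSide χ W α' := by
    change χ (enum W α) = χ (enum W α')
    rw [hα, hα', h]
  have hall : ∀ x ∈ W, ∀ y ∈ W, π.1 x y := fun x hx y hy =>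
    π.1.trans (π.1.symm (hmem.1 hx)) (hmem.1 hy)
  have hleft : Ψ.sys π (W \ {a}) (T.mulInto a a' h) =
      Ψ.sys (.one (resSide χ W)) (Finset.univ \ {α}) ((T.restrict W).mulInto α α' hαs) := by
    have hWa : W \ {a} = (Finset.univ \ {α}).map (enum W).toEmbedding := by
      rw [Finset.map_sdiff, map_enum_univ]
      simp [hα]
    rw [hWa]
    refine (Ψ.sys_map (enum W) (fun _ _ => rfl) (fun i _ j _ => ?_) fun i _ => ?_).symm
    · exact iff_of_true trivial (hall _ (enum_mem W i) _ (enum_mem W j))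
    · rw [Entries.coe_mulInto, Entries.coe_mulInto]
      by_cases hi : i = α'
      · subst hi
        rw [Function.update_self, hα', Function.update_self, ← hα, ← hα']
        rfl
      · rw [Function.update_of_ne hi, Function.update_of_ne]
        · rfl
        · rw [← hα']
          exact (enum W).injective.ne hi
  rw [hleft, hm (resSide χ W) α α' hαs hα1 (T.restrict W)]
  symm
  -- Outside `W` such a `σ` must be equal to `π`, and inside it is any partition of `W` that becomes
  -- the one-block partition by joining.
  refine Finset.sum_bij (fun σ _ => σ.restrict W) ?_ ?_ ?_ ?_
  · intro σ hσ
    obtain rfl := (Finset.mem_filter.1 hσ).2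
    refine Finset.mem_filter.2 ⟨Finset.mem_univ _, BNC.join_eq_one_iff.2 fun x => ?_⟩
    have := σ.join_rel_left_iff.1 (BNC.join σ h ha |>.1.symm (hmem.1 (enum_mem W x)))
    rwa [← hα, ← hα'] at this
  · intro σ hσ σ' hσ' heq
    have hσ := (Finset.mem_filter.1 hσ).2
    have hσ' := (Finset.mem_filter.1 hσ').2
    refine BNC.eq_of_restrict_eq hsat (hσ ▸ σ.le_join) (hσ' ▸ σ'.le_join) heq ?_
    refine BNC.restrict_eq_iff.2 fun x hx y _ => ?_
    have hxa : ¬ π.1 x a := fun hxa => (Finset.mem_sdiff.1 hx).2 (hmem.2 (π.1.symm hxa))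
    have h1 := σ.join_rel_iff_of_not (h := h) (ha := ha) (x := x) (y := y) (by rwa [hσ])
    have h2 := σ'.join_rel_iff_of_not (h := h) (ha := ha) (x := x) (y := y) (by rwa [hσ'])
    rw [← h1, ← h2, hσ, hσ']
  · intro τ hτ
    have hτ := BNC.join_eq_one_iff.1 (Finset.mem_filter.1 hτ).2
    obtain ⟨σ, hσπ, rfl, hσ⟩ := π.exists_glue hsat τ (π.restrict (Finset.univ \ W))
      (fun i j _ => hall _ (enum_mem W i) _ (enum_mem W j)) le_rfl
    rw [BNC.restrict_eq_iff] at hσ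
    refine ⟨σ, Finset.mem_filter.2 ⟨Finset.mem_univ _, BNC.join_eq_iff.2 fun x y => ?_⟩, rfl⟩
    have hjoin : ∀ x, π.1 x a → σ.1 x a ∨ σ.1 x a' := by
      intro x hx
      obtain ⟨i, rfl⟩ := exists_enum_eq (hmem.2 (π.1.symm hx))
      have := hτ i
      change σ.1 _ (enum W α) ∨ σ.1 _ (enum W α') at this
      rwa [hα, hα'] at this
    have hjoin' : ∀ x, σ.1 x a ∨ σ.1 x a' → π.1 x a := fun x hx =>
      hx.elim (fun hx => hσπ hx) fun hx => π.1.trans (hσπ hx) (π.1.symm hπ)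
    constructor
    · intro hxy
      by_cases hx : π.1 x a
      · exact Or.inr ⟨hjoin x hx, hjoin y (π.1.trans (π.1.symm hxy) hx)⟩
      · have hxW : x ∉ W := fun hxW => hx (π.1.symm (hmem.1 hxW))
        have hyW : y ∉ W := fun hyW => hx (π.1.trans hxy (π.1.symm (hmem.1 hyW)))
        exact Or.inl ((hσ x (by simp [hxW]) y (by simp [hyW])).2 hxy)
    · rintro (hxy | hxy)
      · exact hσπ hxy
      · exact π.1.trans (hjoin' x hxy.1) (π.1.symm (hjoin' y hxy.2))
  · intro σ _
    exact Ψ.sys_of_nonempty σ ⟨a, hmem.2 (π.1.refl a)⟩ T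

open Classical in
/-- The two sides of the merging rule of bi-moment functions, as sums over the partitions in which
the two nodes are in the same block. -/
theorem conv_zeta_merge (Ψ : P.BNCFun) {χ : Fin (n + 1) → Side} (q : Fin n)
    (h : χ q.castSucc = χ q.succ) (T : P.Entries χ) :
    Ψ.conv zetaBNC _ (.one _) (T.merge q h) =
      ∑ π : BNC χ with π.1 q.castSucc q.succ,
        Ψ.sys π (Finset.univ \ {q.castSucc}) (T.mulInto q.castSucc q.succ h) := by
  rw [BNCFun.conv_zeta_apply]
  symm
  refine Finset.sum_bij (fun π _ => π.delete q.castSucc) ?_ ?_ ?_ ?_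
  · intro π _
    exact Finset.mem_filter.2 ⟨Finset.mem_univ _, BNC.le_iff.2 fun _ _ _ => trivial⟩
  · intro π hπ π' hπ' heq
    exact BNC.delete_injOn q (Finset.mem_filter.1 hπ).2 (Finset.mem_filter.1 hπ').2 heq
  · intro ρ _
    obtain ⟨π, hπ, rfl⟩ := BNC.exists_delete_eq q h ρ
    exact ⟨π, by simpa using hπ, rfl⟩
  · intro π _
    exact (Ψ.delete_merge π q h T).symm

-- The partitions `σ` are grouped by the result of joining the blocks of `a` and `a'`, which always
-- relates these two nodes.
open Classical in
theorem conv_zeta_one (Ψ : P.BNCFun) {χ : Fin n → Side} {a a' : Fin n}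
    (h : χ a = χ a') (ha : (a' : ℕ) = a + 1) (T : P.Entries χ) :
    Ψ.conv zetaBNC χ (.one χ) T =
      ∑ π : BNC χ with π.1 a a', ∑ σ : BNC χ with σ.join h ha = π, Ψ.sys σ Finset.univ T := by
  rw [BNCFun.conv_zeta_apply]
  simp only [Ψ.sys_univ a.pos]
  rw [Finset.filter_true_of_mem fun σ _ => BNC.le_iff.2 fun _ _ _ => trivial]
  refine (Finset.sum_fiberwise_of_maps_to (fun σ _ => ?_) _).symm
  exact Finset.mem_filter.2 ⟨Finset.mem_univ _, σ.join_rel⟩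

open Classical in
theorem MergesAt.sys_univ {Ψ : P.BNCFun} (hΨ : IsMultiplicative Ψ) {χ : Fin n → Side}
    {a a' : Fin n} (h : χ a = χ a') (ha : (a' : ℕ) = a + 1) (π : BNC χ) (hπ : π.1 a a')
    (hm : MergesAt Ψ (blockOf π.1 Finset.univ a).card) (T : P.Entries χ) :
    Ψ.sys π (Finset.univ \ {a}) (T.mulInto a a' h) =
      ∑ σ : BNC χ with σ.join h ha = π, Ψ.sys σ Finset.univ T :=
  hΨ.sys_mulInto h ha π hπ (MergesAt.sys_blockOf h ha π hπ hm) Finset.univ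
    (fun _ _ _ _ _ => Finset.mem_univ _) (Finset.mem_univ a) T

open Classical in
theorem conv_zeta_merge_eq {Ψ : P.BNCFun} (hΨ : IsMultiplicative Ψ) (hm : ∀ n, MergesAt Ψ n)
    (χ : Fin (n + 1) → Side) (q : Fin n) (h : χ q.castSucc = χ q.succ) (T : P.Entries χ) :
    Ψ.conv zetaBNC χ (.one χ) T = Ψ.conv zetaBNC _ (.one _) (T.merge q h) := by
  rw [conv_zeta_merge, conv_zeta_one Ψ h (by simp)]
  exact Finset.sum_congr rfl fun π hπ =>
    (MergesAt.sys_univ hΨ h (by simp) π (Finset.mem_filter.1 hπ).2 (hm _) T).symm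

-- By strong induction on the number of nodes: a partition `π ≠ 1_χ` relating `q` and `q+1` has a
-- smaller block there, so its terms agree on both sides of the moment rule. Cancelling them leaves
-- the term of `1_χ`, which is the cumulant rule.
open Classical in
theorem mergesAt_of_conv_zeta {Ψ : P.BNCFun} (hΨ : IsMultiplicative Ψ)
    (hm : ∀ {n : ℕ} (χ : Fin (n + 1) → Side) (q : Fin n) (h : χ q.castSucc = χ q.succ)
      (T : P.Entries χ),
      Ψ.conv zetaBNC χ (.one χ) T = Ψ.conv zetaBNC _ (.one _) (T.merge q h)) (n : ℕ) :
    MergesAt Ψ n := by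
  induction n using Nat.strong_induction_on with
  | _ n ih =>
  rcases n with _ | n
  · exact fun χ a => a.elim0
  intro χ a a' h ha T
  have hq : (a : ℕ) < n := by have := a'.2; omega
  obtain ⟨q, rfl⟩ : ∃ q : Fin n, a = q.castSucc := ⟨⟨a, hq⟩, rfl⟩
  obtain rfl : a' = q.succ := Fin.ext (by simpa using ha)
  have h1 := hm χ q h T
  rw [conv_zeta_merge, conv_zeta_one Ψ h ha] at h1
  have hone : BNC.one χ ∈ Finset.univ.filter fun π : BNC χ => π.1 q.castSucc q.succ :=
    Finset.mem_filter.2 ⟨Finset.mem_univ _, trivial⟩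
  rw [← Finset.add_sum_erase _ _ hone, ← Finset.add_sum_erase _ _ hone,
    Finset.sum_congr (rfl : (Finset.univ.filter fun π : BNC χ =>
      π.1 q.castSucc q.succ).erase (.one χ) = _) fun π hπ => by
      have hπ' := Finset.mem_erase.1 hπ
      have hrel := (Finset.mem_filter.1 hπ'.2).2
      refine (MergesAt.sys_univ hΨ h ha π hrel (ih _ ?_) T).symm
      have hne : blockOf π.1 Finset.univ q.castSucc ≠ Finset.univ := fun hall => hπ'.1 <|
        Subtype.ext (Setoid.ext fun i j => iff_of_true
          (rel_blockOf i (hall.symm.subset (Finset.mem_univ i)) j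
            (hall.symm.subset (Finset.mem_univ j))) trivial)
      have := Finset.card_lt_card (Finset.ssubset_univ_iff.2 hne)
      simpa only [Finset.card_fin] using this] at h1
  simpa only [Ψ.sys_univ (Nat.succ_pos n)] using (add_right_cancel h1).symm

theorem isBiMoment_conv_zeta_iff (Ψ : P.BNCFun) :
    IsBiMoment (Ψ.conv zetaBNC) ↔ IsBiCumulant Ψ := by
  constructor
  · intro h
    have hΨ := isMultiplicative_of_conv_zeta h.biMultiplicative.isMultiplicative
    exact ⟨hΨ.isBiMultiplicative, fun {n} =>
      (mergesAt_succ_iff Ψ).1 (mergesAt_of_conv_zeta hΨ h.merge (n + 1))⟩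
  · intro h
    have hΨ := h.biMultiplicative.isMultiplicative
    refine ⟨hΨ.conv_zeta.isBiMultiplicative, conv_zeta_merge_eq hΨ fun n => ?_⟩
    rcases n with _ | n
    · exact fun χ a => a.elim0
    · exact (mergesAt_succ_iff Ψ).2 h.merge

end NCPS

end BiFree

end

/-! ### The main theorem. -/

theorem mainTheorem6 {B A : Type*} [Ring B] [Algebra ℂ B] [Ring A] [Algebra ℂ A]
    (P : BiFree.NCPS B A) :
    (∀ Φ Ψ : P.BNCFun,
      (Φ = Ψ.conv BiFree.zetaBNC ↔ Ψ = Φ.conv BiFree.muBNC) ∧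
      (Φ = Ψ.conv BiFree.zetaBNC →
        (BiFree.NCPS.IsBiMoment Φ ↔ BiFree.NCPS.IsBiCumulant Ψ))) ∧
    BiFree.NCPS.IsBiCumulant P.cumulantFun := by
  refine ⟨fun Φ Ψ => ⟨⟨?_, ?_⟩, ?_⟩, ?_⟩
  · rintro rfl
    exact Ψ.conv_zeta_conv_mu.symm
  · rintro rfl
    exact Φ.conv_mu_conv_zeta.symm
  · rintro rfl
    exact BiFree.NCPS.isBiMoment_conv_zeta_iff Ψ
  -- Since `κ ∗ ζ` is the moment function, the claim about `κ` reduces to the moment function being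
  -- a bi-moment function.
  · rw [← BiFree.NCPS.isBiMoment_conv_zeta_iff, BiFree.NCPS.cumulantFun,
      BiFree.NCPS.BNCFun.conv_mu_conv_zeta]
    exact BiFree.NCPS.isBiMoment_momentFun P
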